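/- All vector spaces are over $\mathbb{C}$, and $[\,,]$ denotes the supercommutator. An \emph{$N_W=1$ SUSY vertex algebra} is a superspace $V$ with an even vacuum vector $|0\rangle$, commuting operators $\partial$ (even) and $D$ (odd, $D^2=0$) killing $|0\rangle$, and an even operation $a\otimes b\mapsto Y(a,z,\theta)b\in V\otimes\mathbb{C}((z))[\theta]$ ($\theta$ odd) such that $Y(|0\rangle,z,\theta)=\mathrm{id}$; $Y(a,z,\theta)|0\rangle$ has no pole and equals $a$ at $z=\theta=0$; $[D,Y(a,z,\theta)]=\partial_\theta Y(a,z,\theta)$ and $[\partial,Y(a,z,\theta)]=\partial_zY(a,z,\theta)$; and $(z-w)^n[Y(a,z,\theta),Y(b,w,\xi)]=0$ for $n\gg0$. Write $Y(a,z,\theta)|_{\theta=0}=\sum_{n\in\mathbb{Z}}a_{(n)}z^{-1-n}$. A \emph{$V$-module} is a superspace $M$ with an even operation $Y^M(a,z,\theta)=\sum_{n}a^M_{(n)}z^{-1-n}+\theta\sum_n(Da)^M_{(n)}z^{-1-n}$, with values in $M\otimes\mathbb{C}((z))[\theta]$ on each vector of $M$, such that $Y^M(|0\rangle,z,\theta)=\mathrm{id}$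 and the associativity relation $Y^M(a,z,\theta)Y^M(b,w,\xi)=Y^M(Y(a,z-w,\theta-\xi)b,w,\xi)$ holds in the usual sense of the Borcherds identity. $V$ is \emph{conformal} of central charge $c\in\mathbb{C}$ if there are an even vector $j$ and an odd vector $h$ in $V$ with $Y(j,z,\theta)=J(z)-\theta Q(z)$, $Y(h,z,\theta)=H(z)+\theta(L(z)+\partial_zJ(z))$, where the coefficients in $J(z)=\sum J_nz^{-1-n}$, $Q(z)=\sum Q_nz^{-2-n}$, $H(z)=\sum H_nz^{-1-n}$, $L(z)=\sum L_nz^{-2-n}$ satisfy, for all $m,n\in\mathbb{Z}$, \[\begin{gathered} [L_m,L_n]=(m-n)L_{m+n},\quad [L_m,J_n]=-nJ_{m+n}+\tfrac{(m^2+m)c}{6}\delta_{m,-n},\quad [L_m,H_n]=-nH_{m+n},\\ [L_m,Q_n]=(m-n)Q_{m+n},\quad [J_m,J_n]=\tfrac c3m\,\delta_{m,-n},\quad [J_m,Q_n]=Q_{m+n},\quad [J_m,H_n]=-H_{m+n},\\ [H_m,Q_n]=L_{m+n}-mJ_{m+n}+\tfrac{(m^2-m)c}{6}\delta_{m,-n},\quad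 [H_m,H_n]=[Q_m,Q_n]=0, \end{gathered}\] with $L_{-1}=\partial$, $Q_{-1}=D$, and such that (*) $L_0$ and $J_0$ are diagonalizable with integer eigenvalues and finite-dimensional joint eigenspaces, the eigenvalues of $L_0$ being nonnegative. A $V$-module $M$ is of \emph{positive energy} if (*) holds on $M$ for the operators $L_0,J_0$ on $M$ given by the corresponding modes of $Y^M(j,z,\theta)$ and $Y^M(h,z,\theta)$. $V$ is \emph{$C_2$-cofinite} if the span of $\{a_{(-2)}b : a,b\in V\}$ has finite codimension in $V$. For $a\in V$ with $L_0a=\Delta a$ put $o(a)=a^M_{(\Delta-1)}\in\mathrm{End}(M)$, and extend $o$ linearly to $V$. \textbf{Theorem.} Let $V$ be a $C_2$-cofinite conformal $N_W=1$ SUSY vertex algebra and let $M$ be a positive energy $V$-module. For $a\in V$ and $n,k\in\mathbb{Z}$ let $c_{n,k}(a)$ be the supertrace of the diagonal block of $o(a)$ on the joint eigenspace of $M$ with $L_0=n$, $J_0=k$. Then for each $a\in V$ the series \[\mathrm{str}_M\,o(a)q^{L_0}y^{J_0}=\sum_{n,k\in\mathbb{Z}}c_{n,k}(a)\,q^ny^k,\qquad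 q=e^{2\pi i\tau},\quad y=e^{2\pi i\alpha},\] converges absolutely at every point of \[S=\{(\tau,\alpha)\in\mathbb{H}\times\mathbb{C} : \alpha\notin\mathbb{Z}+\mathbb{Z}\tau\}\] and uniformly on every compact subset of $S$. -/

import Mathlib

open scoped VertexOperator

noncomputable section

/-- The sign `(-1)^{ij}` of the rule of signs, for parities `i`, `j`. -/
def koszulSign (i j : ZMod 2) : ℂ := (-1) ^ (i.val * j.val)

/-- The supercommutator `[A, B] = A B - (-1)^{ij} B A` of operators of parities `i` and `j`. -/
def superComm {M : Type*} [AddCommGroup M] [Module ℂ M] (i j : ZMod 2) (A B : Module.End ℂ M) :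
    Module.End ℂ M :=
  A * B - koszulSign i j • (B * A)

/-- A linear family of superfields `Y(a, z, θ) = Y 0 a (z) + θ Y 1 a (z)` on `M`, one for each
`a : V`: the two components are ordinary fields `A(z) = ∑ A_(n) z^{-1-n}`, where `A_(n)` is written
`A[[n]]`. -/
abbrev SuperFieldMap (V M : Type*) [AddCommGroup V] [Module ℂ V] [AddCommGroup M] [Module ℂ M] :=
  ZMod 2 → V →ₗ[ℂ] VertexOperator ℂ M

/-- Fields `A(z)`, `B(w)` of parities `i`, `j` are mutually local:
`(z - w)^N [A(z), B(w)] = 0` for some `N`, written out for each coefficient. -/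
def MutuallyLocal {M : Type*} [AddCommGroup M] [Module ℂ M] (i j : ZMod 2)
    (A B : VertexOperator ℂ M) : Prop :=
  ∃ N : ℕ, ∀ m k : ℤ,
    ∑ r ∈ Finset.range (N + 1),
      ((-1 : ℂ) ^ r * (N.choose r : ℂ)) • superComm i j (A[[m + N - r]]) (B[[k + r]]) = 0

/-- An `N_W = 1` SUSY vertex algebra structure on a complex vector space `V`.
The superspace is `V = par 0 ⊕ par 1`; `T` (written `∂` in the literature) and `D` make `V` a
module over `ℂ[∂, D]`, `∂` even, `D` odd, `D² = 0`. Every axiom on superfields is written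
for the coefficients of `1`, `θ` (and `ξ`, `θ ξ`). -/
structure SUSYVertexAlgebra (V : Type*) [AddCommGroup V] [Module ℂ V] where
  par : ZMod 2 → Submodule ℂ V
  par_internal : DirectSum.IsInternal par
  vac : V
  T : Module.End ℂ V
  D : Module.End ℂ V
  Y : SuperFieldMap V V
  vac_even : vac ∈ par 0
  T_even : ∀ i, ∀ a ∈ par i, T a ∈ par i
  D_odd : ∀ i, ∀ a ∈ par i, D a ∈ par (i + 1)
  D_sq : D * D = 0
  T_comm_D : T * D = D * T
  /-- The operation `a ⊗ b ↦ Y(a, z, θ) b` is even. -/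
  Y_even : ∀ (ε i j : ZMod 2), ∀ a ∈ par i, ∀ b ∈ par j, ∀ n : ℤ,
    ((Y ε a)[[n]]) b ∈ par (i + ε + j)
  T_vac : T vac = 0
  D_vac : D vac = 0
  /-- `Y(a, z, θ)|0⟩` has no pole. -/
  Y_vac_regular : ∀ (ε : ZMod 2) (a : V) (n : ℤ), 0 ≤ n → ((Y ε a)[[n]]) vac = 0
  /-- `Y(a, z, θ)|0⟩` equals `a` at `z = θ = 0`. -/
  Y_vac_value : ∀ a : V, ((Y 0 a)[[-1]]) vac = a
  /-- `Y(|0⟩, z, θ) = id`. -/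
  Y_of_vac : ∀ n : ℤ, (Y 0 vac)[[n]] = if n = -1 then 1 else 0
  Y_one_of_vac : Y 1 vac = 0
  /-- `[D, Y(a, z, θ)] = ∂_θ Y(a, z, θ)`. -/
  D_comm : ∀ i, ∀ a ∈ par i, ∀ n : ℤ, superComm 1 i D ((Y 0 a)[[n]]) = (Y 1 a)[[n]]
  D_comm_one : ∀ i, ∀ a ∈ par i, ∀ n : ℤ, superComm 1 (i + 1) D ((Y 1 a)[[n]]) = 0
  /-- `[∂, Y(a, z, θ)] = ∂_z Y(a, z, θ)`. -/
  T_comm : ∀ (ε : ZMod 2) (a : V) (n : ℤ),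
    T * (Y ε a)[[n]] - (Y ε a)[[n]] * T = (-n : ℂ) • (Y ε a)[[n - 1]]
  /-- `(z - w)^N [Y(a, z, θ), Y(b, w, ξ)] = 0` for large `N`. -/
  locality : ∀ (ε δ i j : ZMod 2), ∀ a ∈ par i, ∀ b ∈ par j,
    MutuallyLocal (i + ε) (j + δ) (Y ε a) (Y δ b)

/-- A module `M = par 0 ⊕ par 1` over an `N_W = 1` SUSY vertex algebra. The associativity
`Y^M(a, z, θ) Y^M(b, w, ξ) m = Y^M(Y(a, z - w, θ - ξ) b, w, ξ) m`, read as usual as the equality of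
two expansions of one function, is stated in coefficients: the coefficient of `θ` (with `b` the
vacuum) is `Y_one`, the coefficient of `1` is the Borcherds identity. -/
structure SUSYModule {V : Type*} [AddCommGroup V] [Module ℂ V] (A : SUSYVertexAlgebra V)
    (M : Type*) [AddCommGroup M] [Module ℂ M] where
  par : ZMod 2 → Submodule ℂ M
  par_internal : DirectSum.IsInternal par
  Y : SuperFieldMap V M
  Y_even : ∀ (ε i j : ZMod 2), ∀ a ∈ A.par i, ∀ m ∈ par j, ∀ n : ℤ,
    ((Y ε a)[[n]]) m ∈ par (i + ε + j)
  Y_of_vac : ∀ n : ℤ, (Y 0 A.vac)[[n]] = if n = -1 then 1 else 0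
  /-- `Y^M(a, z, θ) = a^M(z) + θ (D a)^M(z)`. -/
  Y_one : ∀ a : V, Y 1 a = Y 0 (A.D a)
  /-- The sums are finite, since all the operators are coefficients of fields. -/
  borcherds : ∀ (i j : ZMod 2), ∀ a ∈ A.par i, ∀ b ∈ A.par j, ∀ (m : M) (p q r : ℤ),
    ∑ᶠ s : ℕ, Ring.choose p s • ((Y 0 (((A.Y 0 a)[[r + s]]) b))[[p + q - s]]) m =
      ∑ᶠ s : ℕ, ((-1 : ℤ) ^ s * Ring.choose r s) •
        (((Y 0 a)[[p + r - s]]) (((Y 0 b)[[q + s]]) m) -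
          (koszulSign i j * (-1 : ℂ) ^ r) •
            ((Y 0 b)[[q + r - s]]) (((Y 0 a)[[p + s]]) m))

section Modes

variable {V M : Type*} [AddCommGroup V] [Module ℂ V] [AddCommGroup M] [Module ℂ M]

/-- `a ↦ a_(n)`, the `n`-th Fourier mode of the field `a(z) = Y(a, z, θ)|_{θ = 0}`. -/
def fourierMode (Y : SuperFieldMap V M) (n : ℤ) : V →ₗ[ℂ] Module.End ℂ M :=
  LinearMap.proj n ∘ₗ VertexOperator.ncoeff ∘ₗ Y 0

/-! The modes of the fields `J(z) = ∑ J_n z^{-1-n}`, `Q(z) = ∑ Q_n z^{-2-n}`,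
`H(z) = ∑ H_n z^{-1-n}`, `L(z) = ∑ L_n z^{-2-n}` which are given by vectors `j`, `h` through
`Y(j, z, θ) = J(z) - θ Q(z)` and `Y(h, z, θ) = H(z) + θ (L(z) + ∂_z J(z))`. -/

def modeJ (Y : SuperFieldMap V M) (j : V) (n : ℤ) : Module.End ℂ M := (Y 0 j)[[n]]

def modeQ (Y : SuperFieldMap V M) (j : V) (n : ℤ) : Module.End ℂ M := -(Y 1 j)[[n + 1]]

def modeH (Y : SuperFieldMap V M) (h : V) (n : ℤ) : Module.End ℂ M := (Y 0 h)[[n]]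

def modeL (Y : SuperFieldMap V M) (j h : V) (n : ℤ) : Module.End ℂ M :=
  (Y 1 h)[[n + 1]] + ((n : ℂ) + 1) • modeJ Y j n

end Modes

/-- The commutation relations of the topological algebra with central parameter `c`
(`L`, `J` even; `Q`, `H` odd). -/
structure TopologicalRelations {M : Type*} [AddCommGroup M] [Module ℂ M] (c : ℂ)
    (L J Q H : ℤ → Module.End ℂ M) : Prop where
  LL : ∀ m n : ℤ, superComm 0 0 (L m) (L n) = ((m : ℂ) - n) • L (m + n)
  LJ : ∀ m n : ℤ, superComm 0 0 (L m) (J n) =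
    (-n : ℂ) • J (m + n) + (if m = -n then ((m : ℂ) ^ 2 + m) * c / 6 else 0) • 1
  LH : ∀ m n : ℤ, superComm 0 1 (L m) (H n) = (-n : ℂ) • H (m + n)
  LQ : ∀ m n : ℤ, superComm 0 1 (L m) (Q n) = ((m : ℂ) - n) • Q (m + n)
  JJ : ∀ m n : ℤ, superComm 0 0 (J m) (J n) = (if m = -n then c / 3 * m else 0) • 1
  JQ : ∀ m n : ℤ, superComm 0 1 (J m) (Q n) = Q (m + n)
  JH : ∀ m n : ℤ, superComm 0 1 (J m) (H n) = -H (m + n)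
  HQ : ∀ m n : ℤ, superComm 1 1 (H m) (Q n) =
    L (m + n) - (m : ℂ) • J (m + n) + (if m = -n then ((m : ℂ) ^ 2 - m) * c / 6 else 0) • 1
  HH : ∀ m n : ℤ, superComm 1 1 (H m) (H n) = 0
  QQ : ∀ m n : ℤ, superComm 1 1 (Q m) (Q n) = 0

/-- The vectors of weight `x.1` (eigenvalue of `L0`), charge `x.2.1` (eigenvalue of `J0`) and
parity `x.2.2`. -/
def gradedPiece {M : Type*} [AddCommGroup M] [Module ℂ M] (par : ZMod 2 → Submodule ℂ M)
    (L0 J0 : Module.End ℂ M) (x : ℤ × ℤ × ZMod 2) : Submodule ℂ M :=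
  L0.eigenspace (x.1 : ℂ) ⊓ J0.eigenspace (x.2.1 : ℂ) ⊓ par x.2.2

/-- `L0` and `J0` are (simultaneously, and compatibly with the parity) diagonal with integer
eigenvalues, their joint eigenspaces are finite dimensional and the eigenvalues of `L0` are
nonnegative. -/
structure IntegrabilityConditions {M : Type*} [AddCommGroup M] [Module ℂ M]
    (par : ZMod 2 → Submodule ℂ M) (L0 J0 : Module.End ℂ M) : Prop where
  internal : DirectSum.IsInternal (gradedPiece par L0 J0)
  finite : ∀ n k : ℤ,
    FiniteDimensional ℂ ↥(L0.eigenspace (n : ℂ) ⊓ J0.eigenspace (k : ℂ))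
  nonneg : ∀ n : ℤ, n < 0 → L0.eigenspace (n : ℂ) = ⊥

/-- A (strongly) conformal structure of central charge `c` on an `N_W = 1` SUSY vertex algebra,
given by an even vector `j` and an odd vector `h`. The commutators of the modes of `j`, `h` with
all superfields are those of a quasi-conformal structure automatically, by the commutator formula
and `Q_{-1} = D`. -/
structure ConformalStructure {V : Type*} [AddCommGroup V] [Module ℂ V]
    (A : SUSYVertexAlgebra V) where
  j : V
  h : V
  c : ℂ
  j_even : j ∈ A.par 0
  h_odd : h ∈ A.par 1
  relations : TopologicalRelations c (modeL A.Y j h) (modeJ A.Y j) (modeQ A.Y j) (modeH A.Y h)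
  L_neg_one : modeL A.Y j h (-1) = A.T
  Q_neg_one : modeQ A.Y j (-1) = A.D
  integrability : IntegrabilityConditions A.par (modeL A.Y j h 0) (modeJ A.Y j 0)

/-- `C_2`-cofiniteness: the span of all `a_(-2) b` has finite codimension. -/
def SUSYVertexAlgebra.IsC2Cofinite {V : Type*} [AddCommGroup V] [Module ℂ V]
    (A : SUSYVertexAlgebra V) : Prop :=
  FiniteDimensional ℂ (V ⧸ Submodule.span ℂ {v : V | ∃ a b : V, v = ((A.Y 0 a)[[-2]]) b})

section Trace

variable {V M : Type*} [AddCommGroup V] [Module ℂ V] [AddCommGroup M] [Module ℂ M]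
  {A : SUSYVertexAlgebra V}

/-- Positive energy modules over a conformal `N_W = 1` SUSY vertex algebra: the operators `L_0`
and `J_0` on `M`, modes of the fields `Y^M(j, z, θ)` and `Y^M(h, z, θ)`, satisfy the integrability
conditions. (The commutation relations on `M` follow from those on `V`.) -/
def SUSYModule.IsPositiveEnergy (C : ConformalStructure A) (N : SUSYModule A M) : Prop :=
  IntegrabilityConditions N.par (modeL N.Y C.j C.h 0) (modeJ N.Y C.j 0)

/-- The components of the vectors of an internal direct sum. -/
def internalDecomp {ι E : Type*} [DecidableEq ι] [AddCommGroup E] [Module ℂ E]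
    {W : ι → Submodule ℂ E} (hW : DirectSum.IsInternal W) :
    E ≃ₗ[ℂ] DirectSum ι (fun i => W i) :=
  (LinearEquiv.ofBijective (DirectSum.coeLinearMap W)
    (show Function.Bijective (DirectSum.coeLinearMap W) from hW)).symm

theorem internalDecomp_of_mem {ι E : Type*} [DecidableEq ι] [AddCommGroup E] [Module ℂ E]
    {W : ι → Submodule ℂ E} (hW : DirectSum.IsInternal W) (x : ι) {v : E} (hv : v ∈ W x) :
    internalDecomp hW v = DirectSum.lof ℂ ι (fun i => W i) x ⟨v, hv⟩ := by
  rw [internalDecomp, LinearEquiv.symm_apply_eq, LinearEquiv.ofBijective_apply,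
    DirectSum.coeLinearMap_lof]

/-- `o(a)`: the Fourier mode of `a` that preserves the weights of `M`. It is `a_(Δ - 1)` for `a` of
conformal weight `Δ`, extended linearly to `V`. -/
def zeroMode (C : ConformalStructure A) (N : SUSYModule A M) : V →ₗ[ℂ] Module.End ℂ M :=
  DirectSum.toModule ℂ (ℤ × ℤ × ZMod 2) (Module.End ℂ M)
      (fun x => fourierMode N.Y (x.1 - 1) ∘ₗ
        (gradedPiece A.par (modeL A.Y C.j C.h 0) (modeJ A.Y C.j 0) x).subtype) ∘ₗ
    (internalDecomp C.integrability.internal).toLinearMap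

/-- The trace of the diagonal block of the operator `X` at the component with index `x`. -/
def blockTrace {ι E : Type*} [DecidableEq ι] [AddCommGroup E] [Module ℂ E]
    {W : ι → Submodule ℂ E} (hW : DirectSum.IsInternal W) (X : Module.End ℂ E) (x : ι) : ℂ :=
  LinearMap.trace ℂ (W x)
    (DirectSum.component ℂ ι (fun i => W i) x ∘ₗ (internalDecomp hW).toLinearMap ∘ₗ X ∘ₗ
      (W x).subtype)

/-- The coefficient of `q^n y^k` in the formal series `str_M o(a) q^{L_0} y^{J_0}`: the supertrace
of the diagonal block of `o(a)` on the joint eigenspace of `M` of weight `n` and charge `k`. -/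
def supertraceCoeff {C : ConformalStructure A} {N : SUSYModule A M} (hN : N.IsPositiveEnergy C)
    (a : V) (n k : ℤ) : ℂ :=
  blockTrace hN.internal (zeroMode C N a) (n, k, 0) -
    blockTrace hN.internal (zeroMode C N a) (n, k, 1)

/-- The term with index `(n, k)` of `str_M o(a) q^{L_0} y^{J_0}`, as a function of `(τ, α)`, where
`q = e^{2πiτ}` and `y = e^{2πiα}`. -/
def supertraceTerm {C : ConformalStructure A} {N : SUSYModule A M} (hN : N.IsPositiveEnergy C)
    (a : V) (x : ℤ × ℤ) (p : ℂ × ℂ) : ℂ :=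
  supertraceCoeff hN a x.1 x.2 *
    Complex.exp (2 * Real.pi * Complex.I * p.1) ^ x.1 *
    Complex.exp (2 * Real.pi * Complex.I * p.2) ^ x.2

/-- `o(a) = a_(Δ - 1)` for `a` homogeneous of conformal weight `Δ`. -/
theorem zeroMode_of_mem (C : ConformalStructure A) (N : SUSYModule A M) (x : ℤ × ℤ × ZMod 2)
    {a : V} (ha : a ∈ gradedPiece A.par (modeL A.Y C.j C.h 0) (modeJ A.Y C.j 0) x) :
    zeroMode C N a = (N.Y 0 a)[[x.1 - 1]] := by
  rw [zeroMode, LinearMap.comp_apply, LinearEquiv.coe_coe, internalDecomp_of_mem _ x ha,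
    DirectSum.toModule_lof]
  rfl

end Trace

/-- The domain `{(τ, α) ∈ ℍ × ℂ : α ∉ ℤ + ℤ τ}`. -/
def convergenceDomain : Set (ℂ × ℂ) :=
  {p | 0 < p.1.im ∧ ∀ m n : ℤ, p.2 ≠ (m : ℂ) + n * p.1}

end

/-!
Zhu's argument for the convergence of trace functions, adapted to traces which also record the
charge.

For an invertible parameter `Y` write `str X g` for `∑ str(X |_{n, k}) Y^k q^n`. Moving an
operator which changes the weight by `d ≠ 0` and the charge by `e` around the supertrace
multiplies the series by `± Y^e q^d`, so `str(a_(p) b_(q) g)`, for modes that change the weight,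
is a geometric series in `Y^e q^d` times the supertrace of a commutator, hence a combination of
the series of the vectors `a_(j) b`, `j ≥ 0`. Summing the Borcherds identity for `o(a_(-1) b)`,
with `a` of positive weight, one finds (`supertraceSeries_neg_one`)

  `str(o(a_(-1) b) g) = ± str(o(b) o(a) g) + ∑_{j ≥ 0} f_j str(o(a_(j) b) g)`,

where the coefficients `f_j` are Lambert and geometric series, convergent for `|q| < 1` and `|Y| =
1`. In a suitable combination of this formula for `a` and `∂ a` the first term on the right
cancels. It expresses `str(o(a_(-2) b) g)` through vectors of lower weight, so `C_2`-cofiniteness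
makes the module spanned by all the `str(o(v) g)` over the ring of convergent series finitely
generated (`supertraceSeries_mem`). For `a = ω` the first term on the right is `q d/dq str(o(b)
g)`; hence the generators solve a linear system `q dS/dq = f S`, and their coefficients are
`O(ρ⁻ⁿ)` for every `ρ < 1` (`exists_norm_coeff_supertraceSeries_le`). Everything happens over a
Banach algebra that contains `Y`; in the algebra of continuous functions on the circle, with `Y`
the standard character, the coefficients `c_{n, k}` are Fourier coefficients and inherit the bound
uniformly in `k` (`exists_norm_supertraceCoeff_le`).

To sum over `k` it remains to see that few charges occur in each weight (`exists_charge_bound`). A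
version of Zhu's algebra is finite dimensional, so `M` is generated by finitely many joint
eigenspaces, and it is spanned by words `a_(n_1) b_(n_2) ⋯ m` with letters from finitely many
components of `V`. The identity for `(a_(-1) b)_(2n + 1)` replaces repeated mode numbers by more
widely spread ones, up to shorter words, so that a word of length `r` has weight at least about
`r² / 2` while its charge is `O(r)`: the charges in weight `n` are `O(√n)`. Hence the terms
`c_{n, k} q^n y^k` are dominated on compact sets by a convergent series. This holds for all `(τ,
α)` with `τ` in the upper half plane, and in particular on the domain in question.
-/

/-! ### Shift operators and locality -/

section Shift

variable {G E : Type*} [AddCommGroup G] [AddCommGroup E] [Module ℂ E]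

/-- Translation by `u` on functions `G → E`. For `G = ℤ × ℤ` or `ℤ × ℤ × ℤ`, viewed as the set of
exponents of formal distributions, translations by the unit vectors are the multiplications by the
formal variables. -/
def shift (u : G) : Module.End ℂ (G → E) := LinearMap.funLeft ℂ E (fun p => p + u)

theorem shift_apply (u : G) (K : G → E) (p : G) : shift u K p = K (p + u) := rfl

theorem shift_mul (u v : G) : (shift u * shift v : Module.End ℂ (G → E)) = shift (u + v) := by
  ext K p
  simp [shift_apply, add_assoc]

theorem shift_commute (u v : G) : Commute (shift u : Module.End ℂ (G → E)) (shift v) := by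
  rw [Commute, SemiconjBy, shift_mul, shift_mul, add_comm]

theorem shift_pow (u : G) (n : ℕ) : (shift u : Module.End ℂ (G → E)) ^ n = shift (n • u) := by
  induction n with
  | zero => ext K p; simp [shift_apply]
  | succ n ih => rw [pow_succ, ih, shift_mul, succ_nsmul]

theorem shift_sub_commute (u v w x : G) :
    Commute (shift u - shift v : Module.End ℂ (G → E)) (shift w - shift x) :=
  ((shift_commute u w).sub_right (shift_commute u x)).sub_left
    ((shift_commute v w).sub_right (shift_commute v x))

/-- Multiplication by `(z - w)^N`, where `u` and `w` are the directions of the two variables. -/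
def diffPow (u w : G) (N : ℕ) : Module.End ℂ (G → E) := (shift u - shift w) ^ N

theorem diffPow_apply (u w : G) (N : ℕ) (K : G → E) (p : G) :
    diffPow u w N K p = ∑ r ∈ Finset.range (N + 1),
      ((-1 : ℂ) ^ r * (N.choose r : ℂ)) • K (p + ((N - r : ℕ) • u + r • w)) := by
  have hc : Commute (-shift w : Module.End ℂ (G → E)) (shift u) :=
    (shift_commute (E := E) w u).neg_left
  rw [diffPow, sub_eq_add_neg, add_comm, hc.add_pow, LinearMap.sum_apply, Finset.sum_apply]
  refine Finset.sum_congr rfl fun r _ => ?_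
  have h1 : (-shift w : Module.End ℂ (G → E)) ^ r = (-1 : ℂ) ^ r • shift (r • w) := by
    rw [← shift_pow, ← neg_one_smul ℂ (shift w : Module.End ℂ (G → E)), smul_pow]
  have h2 : ((N.choose r : ℕ) : Module.End ℂ (G → E)) =
      (N.choose r : ℂ) • (1 : Module.End ℂ (G → E)) := by
    rw [Nat.cast_smul_eq_nsmul, nsmul_one]
  rw [h1, shift_pow, h2, mul_smul_comm, mul_one, smul_mul_assoc, shift_mul]
  simp only [LinearMap.smul_apply, Pi.smul_apply, shift_apply, smul_smul]
  rw [mul_comm, add_comm (r • w)]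

theorem diffPow_mono {u w : G} {N N' : ℕ} (h : N ≤ N') {K : G → E}
    (hK : diffPow u w N K = 0) : diffPow u w N' K = 0 := by
  obtain ⟨d, rfl⟩ := Nat.exists_eq_add_of_le' h
  rw [diffPow, pow_add, Module.End.mul_apply]
  exact (congrArg _ hK).trans (map_zero _)

theorem diffPow_swap {u w : G} {N : ℕ} {K : G → E} (hK : diffPow u w N K = 0) :
    diffPow w u N K = 0 := by
  have : (shift w - shift u : Module.End ℂ (G → E)) = (-1 : ℂ) • (shift u - shift w) := by
    module
  rw [diffPow, this, smul_pow, LinearMap.smul_apply]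
  exact (congrArg _ hK).trans (smul_zero _)

end Shift

section Local

variable {E : Type*} [AddCommGroup E] [Module ℂ E]

/-- Sequences of operators `F`, `G`, viewed as formal distributions `∑ F_n z^{-1-n}`,
`∑ G_n w^{-1-n}`, commute up to the factor `ε` after multiplication by a power of `z - w`. -/
def LocalUpTo (ε : ℂ) (F G : ℤ → Module.End ℂ E) : Prop :=
  ∃ N : ℕ, diffPow ((1, 0) : ℤ × ℤ) (0, 1) N
    (fun p : ℤ × ℤ => F p.1 * G p.2 - ε • (G p.2 * F p.1)) = 0

theorem MutuallyLocal.localUpTo {i j : ZMod 2} {A B : VertexOperator ℂ E}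
    (h : MutuallyLocal i j A B) :
    LocalUpTo (koszulSign i j) (fun n => A[[n]]) (fun n => B[[n]]) := by
  obtain ⟨N, hN⟩ := h
  refine ⟨N, funext fun p => ?_⟩
  rw [diffPow_apply, Pi.zero_apply, ← hN p.1 p.2]
  refine Finset.sum_congr rfl fun r hr => ?_
  have hr' : r ≤ N := Nat.lt_succ_iff.mp (Finset.mem_range.mp hr)
  simp [superComm, Nat.cast_sub hr', add_sub_assoc]

theorem LocalUpTo.exists_le {ε : ℂ} {F G : ℤ → Module.End ℂ E} (h : LocalUpTo ε F G) :
    ∃ N : ℕ, ∀ n ≥ N, diffPow ((1, 0) : ℤ × ℤ) (0, 1) n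
      (fun p : ℤ × ℤ => F p.1 * G p.2 - ε • (G p.2 * F p.1)) = 0 := by
  obtain ⟨N, hN⟩ := h
  exact ⟨N, fun n hn => diffPow_mono hn hN⟩

theorem LocalUpTo.sub {ε : ℂ} {F F' G : ℤ → Module.End ℂ E} (h : LocalUpTo ε F G)
    (h' : LocalUpTo ε F' G) : LocalUpTo ε (fun n => F n - F' n) G := by
  obtain ⟨N, hN⟩ := h.exists_le
  obtain ⟨N', hN'⟩ := h'.exists_le
  refine ⟨max N N', ?_⟩
  have := congrArg₂ (· - ·) (hN _ (le_max_left N N')) (hN' _ (le_max_right N N'))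
  rw [← map_sub] at this
  simp only [sub_zero] at this
  convert this using 2
  ext p : 1
  simp only [Pi.sub_apply, sub_mul, mul_sub, smul_sub]
  abel

theorem LocalUpTo.shift_left {ε : ℂ} {F G : ℤ → Module.End ℂ E} (h : LocalUpTo ε F G) (d : ℤ) :
    LocalUpTo ε (fun n => F (n + d)) G := by
  obtain ⟨N, hN⟩ := h
  refine ⟨N, ?_⟩
  have hc : Commute ((shift (1, 0) - shift (0, 1) : Module.End ℂ (ℤ × ℤ → Module.End ℂ E)) ^ N)
      (shift (d, 0)) :=
    ((shift_commute _ _).sub_left (shift_commute _ _)).pow_left _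
  have := congrArg (shift ((d, 0) : ℤ × ℤ)) hN
  rw [map_zero, diffPow, ← Module.End.mul_apply, ← hc.eq, Module.End.mul_apply] at this
  convert (show diffPow (1, 0) (0, 1) N (shift (d, 0)
    (fun p : ℤ × ℤ => F p.1 * G p.2 - ε • (G p.2 * F p.1))) = 0 from this) using 2
  ext p : 1
  simp [shift_apply]

/-- The derivative of a local distribution is local: `(z - w)^N K = 0` implies
`(z - w)^{N + 1} ∂_z K = 0`. -/
theorem LocalUpTo.deriv {ε : ℂ} {F G : ℤ → Module.End ℂ E} (h : LocalUpTo ε F G) :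
    LocalUpTo ε (fun n => (-n : ℂ) • F (n - 1)) G := by
  have key : ∀ (N : ℕ) (K : ℤ × ℤ → Module.End ℂ E),
      diffPow ((1, 0) : ℤ × ℤ) (0, 1) N K = 0 →
      diffPow ((1, 0) : ℤ × ℤ) (0, 1) (N + 1)
        (fun p : ℤ × ℤ => (-p.1 : ℂ) • K (p.1 - 1, p.2)) = 0 := by
    intro N
    have comm : ∀ K : ℤ × ℤ → Module.End ℂ E, (shift (1, 0) - shift (0, 1) : Module.End ℂ _)
        (fun p : ℤ × ℤ => (-p.1 : ℂ) • K (p.1 - 1, p.2)) =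
        (fun p : ℤ × ℤ => (-p.1 : ℂ) •
          ((shift (1, 0) - shift (0, 1) : Module.End ℂ _) K) (p.1 - 1, p.2)) - K := by
      intro K
      ext p : 1
      simp only [LinearMap.sub_apply, Pi.sub_apply, shift_apply, Prod.fst_add, Prod.snd_add,
        add_zero, add_sub_cancel_right, sub_add_cancel, Prod.mk_add_mk, smul_sub]
      push_cast
      module
    induction N with
    | zero =>
      intro K hK
      simp only [diffPow, pow_zero, Module.End.one_apply] at hK
      subst hK
      simp only [Pi.zero_apply, smul_zero]
      exact map_zero _
    | succ N ih =>
      intro K hK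
      rw [diffPow, pow_succ, Module.End.mul_apply, comm, map_sub]
      change _ - diffPow ((1, 0) : ℤ × ℤ) (0, 1) (N + 1) K = 0
      rw [hK, sub_zero]
      refine ih _ ?_
      rwa [diffPow, ← Module.End.mul_apply, ← pow_succ]
  obtain ⟨N, hN⟩ := h
  refine ⟨N + 1, ?_⟩
  convert key N _ hN using 2
  ext p : 1
  simp [smul_sub, smul_comm ε]

/-- Dong's lemma: if `H`, `F`, `G` are pairwise local, so are `[H_p, F(z)]` and `G(w)`. -/
theorem LocalUpTo.commutator {ε : ℂ} {H F G : ℤ → Module.End ℂ E} (hHF : LocalUpTo 1 H F)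
    (hHG : LocalUpTo 1 H G) (hFG : LocalUpTo ε F G) (p : ℤ) :
    LocalUpTo ε (fun n => H p * F n - F n * H p) G := by
  obtain ⟨N₁, h₁⟩ := hHF.exists_le
  obtain ⟨N₂, h₂⟩ := hHG.exists_le
  obtain ⟨N₃, h₃⟩ := hFG.exists_le
  obtain ⟨N, h1, h2, h3⟩ : ∃ N, N₁ ≤ N ∧ N₂ ≤ N ∧ N₃ ≤ N :=
    ⟨max N₁ (max N₂ N₃), by simp, by simp, by simp⟩
  replace h₁ := h₁ N h1
  replace h₂ := h₂ N h2
  replace h₃ := h₃ N h3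
  let X : Module.End ℂ (ℤ × ℤ × ℤ → Module.End ℂ E) := shift (1, 0, 0)
  let Z : Module.End ℂ (ℤ × ℤ × ℤ → Module.End ℂ E) := shift (0, 1, 0)
  let W : Module.End ℂ (ℤ × ℤ × ℤ → Module.End ℂ E) := shift (0, 0, 1)
  let K₁ : ℤ × ℤ × ℤ → Module.End ℂ E := fun t =>
    H t.1 * (F t.2.1 * G t.2.2 - ε • (G t.2.2 * F t.2.1)) -
      (F t.2.1 * G t.2.2 - ε • (G t.2.2 * F t.2.1)) * H t.1
  let K₂ : ℤ × ℤ × ℤ → Module.End ℂ E := fun t =>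
    F t.2.1 * (H t.1 * G t.2.2 - G t.2.2 * H t.1) -
      ε • ((H t.1 * G t.2.2 - G t.2.2 * H t.1) * F t.2.1)
  let K : ℤ × ℤ × ℤ → Module.End ℂ E := fun t =>
    (H t.1 * F t.2.1 - F t.2.1 * H t.1) * G t.2.2 -
      ε • (G t.2.2 * (H t.1 * F t.2.1 - F t.2.1 * H t.1))
  have hK : K = K₁ - K₂ := by
    ext t : 1
    simp only [K, K₁, K₂, Pi.sub_apply, mul_sub, sub_mul, smul_sub, mul_smul_comm,
      smul_mul_assoc, mul_assoc]
    abel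
  have kX : diffPow (1, 0, 0) (0, 1, 0) N K = 0 := by
    ext t : 1
    have := congrFun h₁ (t.1, t.2.1)
    rw [diffPow_apply, Pi.zero_apply] at this
    rw [diffPow_apply, Pi.zero_apply]
    have e := congrArg (fun y => y * G t.2.2 - ε • (G t.2.2 * y)) this
    simp only [zero_mul, mul_zero, smul_zero, sub_zero, Finset.sum_mul, Finset.mul_sum,
      Finset.smul_sum, ← Finset.sum_sub_distrib] at e
    rw [← e]
    refine Finset.sum_congr rfl fun r _ => ?_
    simp only [K, Prod.fst_add, Prod.snd_add, Prod.smul_mk, smul_zero, add_zero, zero_add,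
      one_smul, smul_mul_assoc, mul_smul_comm]
    rw [smul_sub, smul_comm ε]
  have k₁ : diffPow (0, 1, 0) (0, 0, 1) N K₁ = 0 := by
    ext t : 1
    have := congrFun h₃ (t.2.1, t.2.2)
    rw [diffPow_apply, Pi.zero_apply] at this
    rw [diffPow_apply, Pi.zero_apply]
    have e := congrArg (fun y => H t.1 * y - y * H t.1) this
    simp only [zero_mul, mul_zero, sub_zero, Finset.sum_mul, Finset.mul_sum,
      ← Finset.sum_sub_distrib] at e
    rw [← e]
    refine Finset.sum_congr rfl fun r _ => ?_
    simp only [K₁, Prod.fst_add, Prod.snd_add, Prod.smul_mk, smul_zero, add_zero, zero_add,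
      smul_mul_assoc, mul_smul_comm]
    rw [← smul_sub]
  have k₂ : diffPow (1, 0, 0) (0, 0, 1) N K₂ = 0 := by
    ext t : 1
    have := congrFun h₂ (t.1, t.2.2)
    rw [diffPow_apply, Pi.zero_apply] at this
    rw [diffPow_apply, Pi.zero_apply]
    have e := congrArg (fun y => F t.2.1 * y - ε • (y * F t.2.1)) this
    simp only [zero_mul, mul_zero, smul_zero, sub_zero, Finset.sum_mul, Finset.mul_sum,
      Finset.smul_sum, ← Finset.sum_sub_distrib] at e
    rw [← e]
    refine Finset.sum_congr rfl fun r _ => ?_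
    simp only [K₂, Prod.fst_add, Prod.snd_add, Prod.smul_mk, smul_zero, add_zero, zero_add,
      one_smul, smul_mul_assoc, mul_smul_comm]
    rw [smul_sub, smul_comm ε]
  have cZW_XW : Commute (Z - W) (X - W) := shift_sub_commute _ _ _ _
  have cXZ_XW : Commute (Z - X) (X - W) := shift_sub_commute _ _ _ _
  have kZW : ((X - W) ^ N * (Z - W) ^ N) K = 0 := by
    change (Z - W) ^ N • K₁ = 0 at k₁
    change (X - W) ^ N • K₂ = 0 at k₂
    change ((X - W) ^ N * (Z - W) ^ N) • K = 0
    rw [hK, smul_sub, mul_smul, k₁, smul_zero, ← (cZW_XW.pow_pow N N).eq, mul_smul, k₂, smul_zero,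
      sub_zero]
  have kill : diffPow (0, 1, 0) (0, 0, 1) (3 * N) K = 0 := by
    have e3 : 3 * N = 2 * N + N := by ring
    -- `z - w = (z - x) + (x - w)`
    change ((Z - W) ^ (3 * N)) K = 0
    rw [e3, pow_add]
    have e2 : Z - W = (Z - X) + (X - W) := by abel
    nth_rewrite 1 [e2]
    rw [cXZ_XW.add_pow, Finset.sum_mul, LinearMap.sum_apply]
    refine Finset.sum_eq_zero fun i hi => ?_
    by_cases hiN : N ≤ i
    · have c1 : Commute ((Z - X) ^ i) ((X - W) ^ (2 * N - i)) := cXZ_XW.pow_pow _ _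
      have c2 : Commute ((Z - X) ^ i) ((Z - W) ^ N) :=
        (shift_sub_commute _ _ _ _).pow_pow _ _
      have c3 : Commute ((Z - X) ^ i) (((2 * N).choose i : ℕ) : Module.End ℂ _) :=
        Nat.commute_cast _ _
      have : ((Z - X) ^ i) * (X - W) ^ (2 * N - i) * (((2 * N).choose i : ℕ)) * (Z - W) ^ N =
          ((X - W) ^ (2 * N - i) * (((2 * N).choose i : ℕ)) * (Z - W) ^ N) * (Z - X) ^ i := by
        have := (c1.mul_right (c3.mul_right c2)).eq
        simpa only [mul_assoc] using this
      have z : ((Z - X) ^ i) K = 0 :=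
        diffPow_mono hiN (diffPow_swap kX)
      rw [this, Module.End.mul_apply, z, map_zero]
    · have e4 : 2 * N - i = (N - i) + N := by omega
      have c3 : Commute ((X - W) ^ N) (((2 * N).choose i : ℕ) : Module.End ℂ _) :=
        Nat.commute_cast _ _
      rw [e4, pow_add, mul_assoc, mul_assoc, mul_assoc, ← mul_assoc ((X - W) ^ N), c3.eq,
        mul_assoc, ← mul_assoc, ← mul_assoc, Module.End.mul_apply, kZW, map_zero]
  refine ⟨3 * N, ?_⟩
  ext t : 1
  have := congrFun kill (p, t.1, t.2)
  rw [diffPow_apply, Pi.zero_apply] at this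
  rw [diffPow_apply, Pi.zero_apply, ← this]
  refine Finset.sum_congr rfl fun r _ => ?_
  simp [K]

end Local

/-! ### Uniqueness of local fields and the low modes of even vectors -/

namespace SUSYVertexAlgebra

variable {V : Type*} [AddCommGroup V] [Module ℂ V] (A : SUSYVertexAlgebra V)

theorem iSup_par : ⨆ i, A.par i = ⊤ := A.par_internal.submodule_iSup_eq_top

theorem ext_par {E : Type*} [AddCommGroup E] [Module ℂ E] {f g : V →ₗ[ℂ] E}
    (h : ∀ i, ∀ a ∈ A.par i, f a = g a) : f = g := by
  ext a
  have ha : a ∈ ⨆ i, A.par i := A.iSup_par ▸ Submodule.mem_top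
  induction ha using Submodule.iSup_induction' with
  | mem i x hx => exact h i x hx
  | zero => simp
  | add x y _ _ hx hy => simp [hx, hy]

theorem mode_localUpTo {ε δ i j : ZMod 2} {a b : V} (ha : a ∈ A.par i) (hb : b ∈ A.par j) :
    LocalUpTo (koszulSign (i + ε) (j + δ)) (fun n => (A.Y ε a)[[n]]) (fun n => (A.Y δ b)[[n]]) :=
  (A.locality ε δ i j a ha b hb).localUpTo

theorem mode_localUpTo_zero {i j : ZMod 2} {a b : V} (ha : a ∈ A.par i) (hb : b ∈ A.par j) :
    LocalUpTo (koszulSign i j) (fun n => fourierMode A.Y n a) (fun n => fourierMode A.Y n b) := by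
  have := A.mode_localUpTo (ε := 0) (δ := 0) ha hb
  rwa [add_zero, add_zero] at this

theorem mode_vac_of_nonneg (a : V) {n : ℤ} (hn : 0 ≤ n) : fourierMode A.Y n a A.vac = 0 :=
  A.Y_vac_regular 0 a n hn

theorem mode_vac_neg_one (a : V) : fourierMode A.Y (-1) a A.vac = a := A.Y_vac_value a

theorem T_mode (a : V) (n : ℤ) : A.T * fourierMode A.Y n a - fourierMode A.Y n a * A.T =
    (-n : ℂ) • fourierMode A.Y (n - 1) a := A.T_comm 0 a n

/-- The data of a translation covariant field without pole at the vacuum. -/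
structure IsCovariant (F : ℤ → Module.End ℂ V) : Prop where
  T_comm : ∀ n : ℤ, A.T * F n - F n * A.T = (-n : ℂ) • F (n - 1)
  vac : ∀ n : ℤ, 0 ≤ n → F n A.vac = 0

theorem isCovariant_Y (ε : ZMod 2) (a : V) : A.IsCovariant (fun n => (A.Y ε a)[[n]]) :=
  ⟨A.T_comm ε a, A.Y_vac_regular ε a⟩

theorem isCovariant_mode (a : V) : A.IsCovariant (fun n => fourierMode A.Y n a) :=
  A.isCovariant_Y 0 a

variable {A}

theorem IsCovariant.sub {F G : ℤ → Module.End ℂ V} (hF : A.IsCovariant F)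
    (hG : A.IsCovariant G) : A.IsCovariant (fun n => F n - G n) where
  T_comm n := by
    have h1 := hF.T_comm n
    have h2 := hG.T_comm n
    rw [smul_sub, ← h1, ← h2]
    noncomm_ring
  vac n hn := by simp [hF.vac n hn, hG.vac n hn]

theorem IsCovariant.deriv {F : ℤ → Module.End ℂ V} (hF : A.IsCovariant F) :
    A.IsCovariant (fun n => (-n : ℂ) • F (n - 1)) where
  T_comm n := by
    have h1 := hF.T_comm (n - 1)
    rw [mul_smul_comm, smul_mul_assoc, ← smul_sub, h1]
  vac n hn := by
    rcases hn.eq_or_lt with rfl | h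
    · simp
    · simp [hF.vac (n - 1) (by omega)]

/-- A covariant field is determined on the vacuum by its value at `z = 0`. -/
theorem IsCovariant.vac_eq_zero {F : ℤ → Module.End ℂ V} (hF : A.IsCovariant F)
    (h0 : F (-1) A.vac = 0) (n : ℤ) : F n A.vac = 0 := by
  rcases le_or_gt 0 n with hn | hn
  · exact hF.vac n hn
  obtain ⟨k, rfl⟩ : ∃ k : ℕ, n = -1 - k := ⟨(-1 - n).toNat, by omega⟩
  clear hn
  induction k with
  | zero => simpa using h0
  | succ k ih =>
    have h := LinearMap.congr_fun (hF.T_comm (-1 - k)) A.vac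
    simp only [LinearMap.sub_apply, Module.End.mul_apply, A.T_vac, map_zero, ih, sub_zero,
      LinearMap.smul_apply] at h
    have hk : (-((-1 - (k : ℤ) : ℤ) : ℂ)) ≠ 0 := by
      push_cast
      rw [neg_sub, sub_neg_eq_add]
      exact_mod_cast Nat.succ_ne_zero k
    have := (smul_eq_zero.mp h.symm).resolve_left hk
    rw [show (-1 - ((k + 1 : ℕ) : ℤ)) = -1 - (k : ℤ) - 1 by push_cast; ring]
    exact this

/-- Goddard's uniqueness theorem: two covariant fields which are local with respect to all the
fields `Y(b, w)` and have the same value on the vacuum at `z = 0` are equal. -/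
theorem IsCovariant.eq_of_local {i : ZMod 2} {F G : ℤ → Module.End ℂ V} (hF : A.IsCovariant F)
    (hG : A.IsCovariant G)
    (lF : ∀ j, ∀ b ∈ A.par j, LocalUpTo (koszulSign i j) F (fun n => fourierMode A.Y n b))
    (lG : ∀ j, ∀ b ∈ A.par j, LocalUpTo (koszulSign i j) G (fun n => fourierMode A.Y n b))
    (h0 : F (-1) A.vac = G (-1) A.vac) (n : ℤ) : F n = G n := by
  refine A.ext_par fun j b hb => ?_
  have hv := (hF.sub hG).vac_eq_zero (by simp [h0])
  obtain ⟨N, hN⟩ := (lF j b hb).sub (lG j b hb)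
  have := LinearMap.congr_fun (congrFun hN (n - N, -1)) A.vac
  rw [diffPow_apply, LinearMap.sum_apply, Finset.sum_eq_single 0] at this
  · simp only [LinearMap.smul_apply, LinearMap.sub_apply, Module.End.mul_apply] at this hv
    simp only [Prod.smul_mk, Prod.mk_add_mk, pow_zero, Nat.choose_zero_right, Nat.cast_one,
      mul_one, one_smul, Nat.sub_zero, smul_zero, zero_smul, add_zero, nsmul_eq_mul,
      sub_add_cancel, A.mode_vac_neg_one] at this
    rw [hv n, map_zero, smul_zero] at this
    simpa [sub_eq_zero] using this
  · intro r _ hr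
    have hr1 : (0 : ℤ) ≤ -1 + r := by omega
    simp only [LinearMap.smul_apply, LinearMap.sub_apply, Module.End.mul_apply] at hv ⊢
    simp [A.mode_vac_of_nonneg b hr1, hv, -Nat.cast_sub, -map_sub]
  · simp

variable (A)

/-- `Y(a, z, θ) = a(z) + θ (D a)(z)` holds on the vertex algebra itself. -/
theorem Y_one_eq {i : ZMod 2} {a : V} (ha : a ∈ A.par i) (n : ℤ) :
    (A.Y 1 a)[[n]] = fourierMode A.Y n (A.D a) := by
  refine (A.isCovariant_Y 1 a).eq_of_local (A.isCovariant_mode _) (i := i + 1)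
    (fun j b hb => ?_) (fun j b hb => A.mode_localUpTo_zero (A.D_odd i a ha) hb) ?_ n
  · have := A.mode_localUpTo (ε := 1) (δ := 0) ha hb
    rwa [add_zero] at this
  · rw [A.mode_vac_neg_one]
    have := LinearMap.congr_fun (A.D_comm i a ha (-1)) A.vac
    simp only [← this, superComm, LinearMap.sub_apply, Module.End.mul_apply, LinearMap.smul_apply,
      A.D_vac, map_zero, smul_zero, sub_zero, A.Y_vac_value]

theorem T_eq_mode (a : V) : A.T a = fourierMode A.Y (-2) a A.vac := by
  have := LinearMap.congr_fun (A.T_mode a (-1)) A.vac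
  simpa [A.T_vac, A.mode_vac_neg_one] using this

theorem mode_T (a : V) (n : ℤ) :
    fourierMode A.Y n (A.T a) = (-n : ℂ) • fourierMode A.Y (n - 1) a := by
  suffices h : fourierMode A.Y n ∘ₗ A.T = (-n : ℂ) • fourierMode A.Y (n - 1) from
    LinearMap.congr_fun h a
  refine A.ext_par fun i a ha => ?_
  refine (A.isCovariant_mode _).eq_of_local (A.isCovariant_mode a).deriv (i := i)
    (fun j b hb => A.mode_localUpTo_zero (A.T_even i a ha) hb)
    (fun j b hb => (A.mode_localUpTo_zero ha hb).deriv) ?_ n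
  rw [A.mode_vac_neg_one, A.T_eq_mode]
  norm_num

theorem koszulSign_zero_left (j : ZMod 2) : koszulSign 0 j = 1 := by simp [koszulSign]

variable {A}

theorem mode_mem_par {i j : ZMod 2} {a b : V} (ha : a ∈ A.par i) (hb : b ∈ A.par j) (n : ℤ) :
    fourierMode A.Y n a b ∈ A.par (i + j) := by
  have := A.Y_even 0 i j a ha b hb n
  rwa [add_zero] at this

/-- `[u_(0), a_(n)] = (u_(0) a)_(n)` for `u` even. -/
theorem mode_zero_comm {u : V} (hu : u ∈ A.par 0) (a : V) (n : ℤ) :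
    fourierMode A.Y 0 u * fourierMode A.Y n a - fourierMode A.Y n a * fourierMode A.Y 0 u =
      fourierMode A.Y n (fourierMode A.Y 0 u a) := by
  suffices h : LinearMap.mulLeft ℂ (fourierMode A.Y 0 u) ∘ₗ fourierMode A.Y n -
      LinearMap.mulRight ℂ (fourierMode A.Y 0 u) ∘ₗ fourierMode A.Y n =
      fourierMode A.Y n ∘ₗ fourierMode A.Y 0 u from LinearMap.congr_fun h a
  refine A.ext_par fun i a ha => ?_
  refine IsCovariant.eq_of_local (A := A) (i := i)
    (F := fun n => fourierMode A.Y 0 u * fourierMode A.Y n a -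
      fourierMode A.Y n a * fourierMode A.Y 0 u) ⟨fun n => ?_, fun n hn => ?_⟩
    (A.isCovariant_mode _) (fun j b hb => ?_) (fun j b hb => ?_) ?_ n
  · have h1 := A.T_mode a n
    have h2 : A.T * fourierMode A.Y 0 u = fourierMode A.Y 0 u * A.T := by
      simpa [sub_eq_zero] using A.T_mode u 0
    rw [smul_sub, ← mul_smul_comm, ← smul_mul_assoc, ← h1]
    calc _ = (A.T * fourierMode A.Y 0 u) * fourierMode A.Y n a -
          A.T * fourierMode A.Y n a * fourierMode A.Y 0 u -
          fourierMode A.Y 0 u * fourierMode A.Y n a * A.T +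
          fourierMode A.Y n a * (fourierMode A.Y 0 u * A.T) := by noncomm_ring
      _ = _ := by rw [h2, ← h2]; nth_rewrite 1 [h2]; noncomm_ring
  · simp [A.mode_vac_of_nonneg _ hn, A.mode_vac_of_nonneg u le_rfl]
  · have h1 := A.mode_localUpTo_zero hu ha
    have h2 := A.mode_localUpTo_zero hu hb
    rw [koszulSign_zero_left] at h1 h2
    exact h1.commutator h2 (A.mode_localUpTo_zero ha hb) 0
  · refine A.mode_localUpTo_zero ?_ hb
    simpa using mode_mem_par hu ha 0
  · simp [A.mode_vac_neg_one, A.mode_vac_of_nonneg u le_rfl]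

/-- `[u_(1), a_(n)] = (u_(0) a)_(n + 1) + (u_(1) a)_(n)` for `u` even. -/
theorem mode_one_comm {u : V} (hu : u ∈ A.par 0) (a : V) (n : ℤ) :
    fourierMode A.Y 1 u * fourierMode A.Y n a - fourierMode A.Y n a * fourierMode A.Y 1 u =
      fourierMode A.Y (n + 1) (fourierMode A.Y 0 u a) +
        fourierMode A.Y n (fourierMode A.Y 1 u a) := by
  suffices h : LinearMap.mulLeft ℂ (fourierMode A.Y 1 u) ∘ₗ fourierMode A.Y n -
      LinearMap.mulRight ℂ (fourierMode A.Y 1 u) ∘ₗ fourierMode A.Y n -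
      fourierMode A.Y (n + 1) ∘ₗ fourierMode A.Y 0 u =
      fourierMode A.Y n ∘ₗ fourierMode A.Y 1 u by
    rw [← sub_eq_iff_eq_add']
    exact LinearMap.congr_fun h a
  refine A.ext_par fun i a ha => ?_
  have h0 : fourierMode A.Y 0 u a ∈ A.par i := by simpa using mode_mem_par hu ha 0
  have h1 : fourierMode A.Y 1 u a ∈ A.par i := by simpa using mode_mem_par hu ha 1
  refine IsCovariant.eq_of_local (A := A) (i := i)
    (F := fun n => fourierMode A.Y 1 u * fourierMode A.Y n a -
      fourierMode A.Y n a * fourierMode A.Y 1 u -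
      fourierMode A.Y (n + 1) (fourierMode A.Y 0 u a)) ⟨fun n => ?_, fun n hn => ?_⟩
    (A.isCovariant_mode _) (fun j b hb => ?_) (fun j b hb => A.mode_localUpTo_zero h1 hb) ?_ n
  · have e1 := A.T_mode a n
    have e2 : A.T * fourierMode A.Y 1 u = fourierMode A.Y 1 u * A.T - fourierMode A.Y 0 u := by
      have := A.T_mode u 1
      rw [sub_eq_iff_eq_add] at this
      rw [this]
      norm_num
      abel
    have e3 := A.T_mode (fourierMode A.Y 0 u a) (n + 1)
    have e4 := mode_zero_comm hu a n
    have e5 : n + 1 - 1 = n - 1 + 1 := by ring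
    rw [smul_sub, smul_sub, ← mul_smul_comm, ← smul_mul_assoc, ← e1]
    have e6 : A.T * fourierMode A.Y (n + 1) (fourierMode A.Y 0 u a) -
        fourierMode A.Y (n + 1) (fourierMode A.Y 0 u a) * A.T =
        (-n : ℂ) • fourierMode A.Y (n - 1 + 1) (fourierMode A.Y 0 u a) -
        fourierMode A.Y n (fourierMode A.Y 0 u a) := by
      rw [e3, e5, show n - 1 + 1 = n by ring]
      push_cast
      module
    calc _ = (A.T * fourierMode A.Y 1 u) * fourierMode A.Y n a -
          A.T * fourierMode A.Y n a * fourierMode A.Y 1 u -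
          fourierMode A.Y 1 u * fourierMode A.Y n a * A.T +
          fourierMode A.Y n a * (fourierMode A.Y 1 u * A.T) -
          (A.T * fourierMode A.Y (n + 1) (fourierMode A.Y 0 u a) -
            fourierMode A.Y (n + 1) (fourierMode A.Y 0 u a) * A.T) := by noncomm_ring
      _ = _ := by
        rw [e6, ← e4, e2, show fourierMode A.Y 1 u * A.T =
          A.T * fourierMode A.Y 1 u + fourierMode A.Y 0 u by rw [e2]; abel]
        nth_rewrite 1 [show A.T * fourierMode A.Y 1 u =
          fourierMode A.Y 1 u * A.T - fourierMode A.Y 0 u from e2]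
        noncomm_ring
  · simp [A.mode_vac_of_nonneg _ hn, A.mode_vac_of_nonneg u zero_le_one,
      A.mode_vac_of_nonneg _ (show 0 ≤ n + 1 by omega)]
  · have l1 := A.mode_localUpTo_zero hu ha
    have l2 := A.mode_localUpTo_zero hu hb
    rw [koszulSign_zero_left] at l1 l2
    exact (l1.commutator l2 (A.mode_localUpTo_zero ha hb) 1).sub
      ((A.mode_localUpTo_zero h0 hb).shift_left 1)
  · simp [A.mode_vac_neg_one, A.mode_vac_of_nonneg u zero_le_one,
      A.mode_vac_of_nonneg _ (le_refl (0 : ℤ))]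

end SUSYVertexAlgebra

/-! ### Gradings of the vertex algebra and of the module -/

section Grading

variable {V M : Type*} [AddCommGroup V] [Module ℂ V] [AddCommGroup M] [Module ℂ M]
  {A : SUSYVertexAlgebra V}

namespace ConformalStructure

variable (C : ConformalStructure A)

/-- The conformal vector `ω = D h - ∂ j`, whose field is `L(z)`. -/
def omega : V := A.D C.h - A.T C.j

/-- The subspace of `V` of weight `x.1`, charge `x.2.1` and parity `x.2.2`. -/
abbrev piece (x : ℤ × ℤ × ZMod 2) : Submodule ℂ V :=
  gradedPiece A.par (modeL A.Y C.j C.h 0) (modeJ A.Y C.j 0) x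

theorem omega_even : C.omega ∈ A.par 0 :=
  sub_mem (show A.D C.h ∈ A.par (1 + 1) from A.D_odd 1 _ C.h_odd) (A.T_even 0 _ C.j_even)

theorem modeL_eq (n : ℤ) : modeL A.Y C.j C.h n = fourierMode A.Y (n + 1) C.omega := by
  rw [modeL, omega, map_sub, A.Y_one_eq C.h_odd, A.mode_T]
  simp only [modeJ, fourierMode, LinearMap.comp_apply, LinearMap.proj_apply, add_sub_cancel_right]
  push_cast
  module

theorem modeJ_eq (n : ℤ) : modeJ A.Y C.j n = fourierMode A.Y n C.j := rfl

theorem omega_zero : fourierMode A.Y 0 C.omega = A.T := by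
  rw [← C.L_neg_one, C.modeL_eq]
  rfl

theorem omega_one_of_mem {x : ℤ × ℤ × ZMod 2} {a : V} (ha : a ∈ C.piece x) :
    fourierMode A.Y 1 C.omega a = (x.1 : ℂ) • a := by
  have := Module.End.mem_eigenspace_iff.mp ha.1.1
  rwa [C.modeL_eq] at this

theorem j_zero_of_mem {x : ℤ × ℤ × ZMod 2} {a : V} (ha : a ∈ C.piece x) :
    fourierMode A.Y 0 C.j a = (x.2.1 : ℂ) • a :=
  Module.End.mem_eigenspace_iff.mp ha.1.2

theorem mem_piece_iff {x : ℤ × ℤ × ZMod 2} {a : V} : a ∈ C.piece x ↔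
    fourierMode A.Y 1 C.omega a = (x.1 : ℂ) • a ∧ fourierMode A.Y 0 C.j a = (x.2.1 : ℂ) • a ∧
      a ∈ A.par x.2.2 := by
  rw [piece, gradedPiece, C.modeL_eq, C.modeJ_eq, Submodule.mem_inf, Submodule.mem_inf,
    Module.End.mem_eigenspace_iff, Module.End.mem_eigenspace_iff, and_assoc]
  rfl

theorem mode_mem_piece {x y : ℤ × ℤ × ZMod 2} {a b : V} (ha : a ∈ C.piece x) (hb : b ∈ C.piece y)
    (n : ℤ) : fourierMode A.Y n a b ∈ C.piece (x.1 + y.1 - n - 1, x.2 + y.2) := by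
  rw [mem_piece_iff] at ha hb ⊢
  refine ⟨?_, ?_, SUSYVertexAlgebra.mode_mem_par ha.2.2 hb.2.2 n⟩
  · have h := LinearMap.congr_fun (SUSYVertexAlgebra.mode_one_comm C.omega_even a n) b
    rw [C.omega_zero, A.mode_T, ha.1, LinearMap.sub_apply, Module.End.mul_apply,
      Module.End.mul_apply, hb.1, sub_eq_iff_eq_add] at h
    rw [h]
    simp only [add_sub_cancel_right, LinearMap.add_apply, LinearMap.smul_apply, map_smul]
    push_cast
    module
  · have h := LinearMap.congr_fun (SUSYVertexAlgebra.mode_zero_comm C.j_even a n) b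
    rw [ha.2.1, LinearMap.sub_apply, Module.End.mul_apply, Module.End.mul_apply, hb.2.1,
      sub_eq_iff_eq_add] at h
    rw [h]
    simp only [LinearMap.smul_apply, map_smul, Prod.fst_add]
    push_cast
    module

theorem piece_neg {x : ℤ × ℤ × ZMod 2} (hx : x.1 < 0) {a : V} (ha : a ∈ C.piece x) : a = 0 := by
  have h : a ∈ (modeL A.Y C.j C.h 0).eigenspace (x.1 : ℂ) := ha.1.1
  rwa [C.integrability.nonneg _ hx, Submodule.mem_bot] at h

theorem vac_mem_piece : A.vac ∈ C.piece (0, 0, 0) := by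
  rw [mem_piece_iff]
  refine ⟨?_, ?_, A.vac_even⟩
  · simp [A.mode_vac_of_nonneg _ zero_le_one]
  · simp [A.mode_vac_of_nonneg _ (le_refl (0 : ℤ))]

theorem T_mem_piece {x : ℤ × ℤ × ZMod 2} {a : V} (ha : a ∈ C.piece x) :
    A.T a ∈ C.piece (x.1 + 1, x.2) := by
  rw [A.T_eq_mode]
  convert C.mode_mem_piece ha C.vac_mem_piece (-2) using 2
  ext <;> simp
  ring

theorem j_mem_piece : C.j ∈ C.piece (1, 0, 0) := by
  rw [mem_piece_iff]
  refine ⟨?_, ?_, C.j_even⟩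
  · have h := LinearMap.congr_fun (C.relations.LJ 0 (-1)) A.vac
    simp only [superComm, LinearMap.sub_apply, Module.End.mul_apply, LinearMap.smul_apply,
      SUSYVertexAlgebra.koszulSign_zero_left, one_smul, C.modeL_eq, C.modeJ_eq,
      A.mode_vac_neg_one, LinearMap.add_apply] at h
    rw [A.mode_vac_of_nonneg _ (by norm_num)] at h
    simpa [A.mode_vac_neg_one] using h
  · have h := LinearMap.congr_fun (C.relations.JJ 0 (-1)) A.vac
    simp only [superComm, LinearMap.sub_apply, Module.End.mul_apply, LinearMap.smul_apply,
      SUSYVertexAlgebra.koszulSign_zero_left, one_smul, C.modeJ_eq,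
      A.mode_vac_neg_one] at h
    rw [A.mode_vac_of_nonneg _ (by norm_num)] at h
    simpa using h

theorem omega_eq : C.omega = modeL A.Y C.j C.h (-2) A.vac := by
  rw [C.modeL_eq]
  exact (A.mode_vac_neg_one _).symm

theorem omega_mem_piece : C.omega ∈ C.piece (2, 0, 0) := by
  rw [mem_piece_iff]
  refine ⟨?_, ?_, C.omega_even⟩
  · have h := LinearMap.congr_fun (C.relations.LL 0 (-2)) A.vac
    simp only [superComm, LinearMap.sub_apply, Module.End.mul_apply, LinearMap.smul_apply,
      SUSYVertexAlgebra.koszulSign_zero_left, one_smul] at h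
    rw [← C.omega_eq, zero_add, ← C.omega_eq, C.modeL_eq, zero_add,
      A.mode_vac_of_nonneg _ (by norm_num)] at h
    simpa using h
  · have h := LinearMap.congr_fun (C.relations.LJ (-2) 0) A.vac
    simp only [superComm, LinearMap.sub_apply, Module.End.mul_apply,
      SUSYVertexAlgebra.koszulSign_zero_left, one_smul, C.modeJ_eq] at h
    rw [← C.omega_eq, A.mode_vac_of_nonneg _ (by norm_num)] at h
    simpa using h

theorem iSup_piece : ⨆ x, C.piece x = ⊤ := C.integrability.internal.submodule_iSup_eq_top

/-- A linear property which holds for homogeneous vectors holds for all vectors. -/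
theorem mem_of_pieces {X : Submodule ℂ V} (h : ∀ x, C.piece x ≤ X) (a : V) : a ∈ X := by
  have : (⊤ : Submodule ℂ V) ≤ X := C.iSup_piece ▸ iSup_le h
  exact this Submodule.mem_top

/-- The vectors of degree `x` which are sums of vectors `a_(-2) b` with `a`, `b` homogeneous. -/
def c2Piece (x : ℤ × ℤ × ZMod 2) : Submodule ℂ V :=
  Submodule.span ℂ {v | ∃ y z : ℤ × ℤ × ZMod 2, ∃ a ∈ C.piece y, ∃ b ∈ C.piece z,
    y.1 + z.1 + 1 = x.1 ∧ y.2 + z.2 = x.2 ∧ v = fourierMode A.Y (-2) a b}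

theorem c2Piece_le (x : ℤ × ℤ × ZMod 2) : C.c2Piece x ≤ C.piece x := by
  refine Submodule.span_le.mpr ?_
  rintro _ ⟨y, z, a, ha, b, hb, h1, h2, rfl⟩
  have := C.mode_mem_piece ha hb (-2)
  rwa [show (y.1 + z.1 - (-2) - 1, y.2 + z.2) = x from Prod.ext (by simp [← h1]; ring) h2] at this

theorem mode_neg_two_mem (a b : V) : fourierMode A.Y (-2) a b ∈ ⨆ x, C.c2Piece x := by
  let φ : V →ₗ[ℂ] V →ₗ[ℂ] V := fourierMode A.Y (-2)
  have h1 : ∀ x, ∀ a ∈ C.piece x, ∀ b, φ a b ∈ ⨆ x, C.c2Piece x := by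
    intro x a ha b
    refine C.mem_of_pieces (X := (⨆ x, C.c2Piece x).comap (φ a)) (fun y b hb => ?_) b
    exact Submodule.mem_iSup_of_mem (x.1 + y.1 + 1, x.2 + y.2)
      (Submodule.subset_span ⟨x, y, a, ha, b, hb, rfl, rfl, rfl⟩)
  exact C.mem_of_pieces (X := (⨆ x, C.c2Piece x).comap (φ.flip b)) (fun x a ha => h1 x a ha b) a

theorem _root_.iSupIndep.mem_of_mem_iSup {ι E : Type*} [AddCommGroup E] [Module ℂ E]
    {W W' : ι → Submodule ℂ E} (hW : iSupIndep W) (h : ∀ i, W' i ≤ W i) {i : ι} {a : E}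
    (ha : a ∈ W i) (ha' : a ∈ ⨆ i, W' i) : a ∈ W' i := by
  rw [iSup_split_single W' i, Submodule.mem_sup] at ha'
  obtain ⟨u, hu, v, hv, rfl⟩ := ha'
  have hv1 : v ∈ W i := by simpa using sub_mem ha (h i hu)
  have hv2 : v ∈ ⨆ (j) (_ : j ≠ i), W j := iSup₂_mono (fun j _ => h j) hv
  have : v = 0 := (Submodule.disjoint_def.mp (hW i)) v hv1 hv2
  rwa [this, add_zero]

/-- In a `C_2`-cofinite vertex algebra all but finitely many homogeneous components consist of sums
of vectors `a_(-2) b`. -/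
theorem exists_finset_piece_le (hA : A.IsC2Cofinite) :
    ∃ F : Finset (ℤ × ℤ × ZMod 2), ∀ x ∉ F, C.piece x ≤ C.c2Piece x := by
  classical
  let S : Submodule ℂ V := Submodule.span ℂ {v : V | ∃ a b : V, v = ((A.Y 0 a)[[-2]]) b}
  have hS : S ≤ ⨆ x, C.c2Piece x := by
    refine Submodule.span_le.mpr ?_
    rintro _ ⟨a, b, rfl⟩
    exact C.mode_neg_two_mem a b
  have : FiniteDimensional ℂ (V ⧸ S) := hA
  have htop : (⊤ : Submodule ℂ (V ⧸ S)) ≤ ⨆ x, (C.piece x).map S.mkQ := by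
    rw [← Submodule.map_iSup, C.iSup_piece, Submodule.map_top, Submodule.range_mkQ]
  obtain ⟨F, hF⟩ :=
    CompleteLattice.IsCompactElement.exists_finset_of_le_iSup _
      ((Submodule.fg_iff_compact _).mp (Module.finite_def.mp this)) _ htop
  refine ⟨F, fun x hx a ha => ?_⟩
  let W' : ℤ × ℤ × ZMod 2 → Submodule ℂ V := fun y => if y ∈ F then C.piece y else C.c2Piece y
  have hW' : ∀ y, W' y ≤ C.piece y := by
    intro y
    by_cases hy : y ∈ F
    · simp [W', hy]
    · simpa [W', hy] using C.c2Piece_le y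
  have hle : ∀ y, C.c2Piece y ≤ W' y := by
    intro y
    by_cases hy : y ∈ F
    · simpa [W', hy] using C.c2Piece_le y
    · simp [W', hy]
  have hmem : a ∈ ⨆ y, W' y := by
    have h1 : S.mkQ a ∈ (⨆ y ∈ F, C.piece y).map S.mkQ := by
      rw [Submodule.map_iSup]
      simp only [Submodule.map_iSup]
      exact hF Submodule.mem_top
    obtain ⟨u, hu, hua⟩ := h1
    have h2 : a - u ∈ S := by
      rw [← Submodule.ker_mkQ S, LinearMap.mem_ker, map_sub, hua, sub_self]
    have h3 : u ∈ ⨆ y, W' y := by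
      refine (iSup₂_le fun y hy => ?_ : (⨆ y ∈ F, C.piece y) ≤ ⨆ y, W' y) hu
      refine le_trans ?_ (le_iSup W' y)
      simp [W', hy]
    have h4 : a - u ∈ ⨆ y, W' y := (hS.trans (iSup_mono hle)) h2
    simpa using add_mem h4 h3
  have := C.integrability.internal.submodule_iSupIndep.mem_of_mem_iSup hW' ha hmem
  simpa [W', hx] using this

/-- Induction on the weight in a `C_2`-cofinite vertex algebra. -/
theorem c2_induction {F : Finset (ℤ × ℤ × ZMod 2)} (hF : ∀ x ∉ F, C.piece x ≤ C.c2Piece x)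
    {X : Submodule ℂ V} (h0 : ∀ x ∈ F, C.piece x ≤ X)
    (h1 : ∀ x y : ℤ × ℤ × ZMod 2, ∀ a ∈ C.piece x, ∀ b ∈ C.piece y,
      (∀ z : ℤ × ℤ × ZMod 2, z.1 < x.1 + y.1 + 1 → C.piece z ≤ X) →
      fourierMode A.Y (-2) a b ∈ X) (v : V) : v ∈ X := by
  suffices h : ∀ (n : ℕ) (x : ℤ × ℤ × ZMod 2), x.1 < n → C.piece x ≤ X from
    C.mem_of_pieces (fun x => h (x.1.toNat + 1) x (by have := Int.self_le_toNat x.1; omega)) v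
  intro n
  induction n with
  | zero =>
    intro x hx a ha
    rw [C.piece_neg (by simpa using hx) ha]
    exact zero_mem _
  | succ n ih =>
    intro x hx
    by_cases hxF : x ∈ F
    · exact h0 x hxF
    refine (hF x hxF).trans (Submodule.span_le.mpr ?_)
    rintro _ ⟨y, z, a, ha, b, hb, e1, e2, rfl⟩
    refine h1 y z a ha b hb fun t ht => ih t ?_
    push_cast at hx
    omega

end ConformalStructure

namespace SUSYModule

variable (N : SUSYModule A M)

theorem exists_mode_eq_zero (a : V) (m : M) : ∃ K : ℕ, ∀ n : ℤ, K ≤ n →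
    fourierMode N.Y n a m = 0 := by
  refine ⟨(-(HahnSeries.order ((HahnModule.of ℂ).symm (N.Y 0 a m)))).toNat, fun n hn => ?_⟩
  refine VertexOperator.ncoeff_eq_zero_of_lt_order _ _ _ ?_
  have := Int.self_le_toNat (-(HahnSeries.order ((HahnModule.of ℂ).symm (N.Y 0 a m))))
  omega

theorem _root_.SUSYVertexAlgebra.exists_mode_eq_zero (a b : V) : ∃ K : ℕ, ∀ n : ℤ, K ≤ n →
    fourierMode A.Y n a b = 0 := by
  refine ⟨(-(HahnSeries.order ((HahnModule.of ℂ).symm (A.Y 0 a b)))).toNat, fun n hn => ?_⟩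
  refine VertexOperator.ncoeff_eq_zero_of_lt_order _ _ _ ?_
  have := Int.self_le_toNat (-(HahnSeries.order ((HahnModule.of ℂ).symm (A.Y 0 a b))))
  omega

/-- The Borcherds identity, written for the operators `a_(n)`. -/
theorem borcherds_mode {i j : ZMod 2} {a b : V} (ha : a ∈ A.par i) (hb : b ∈ A.par j) (m : M)
    (p q r : ℤ) :
    ∑ᶠ s : ℕ, Ring.choose p s • fourierMode N.Y (p + q - s) (fourierMode A.Y (r + s) a b) m =
      ∑ᶠ s : ℕ, ((-1 : ℤ) ^ s * Ring.choose r s) •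
        (fourierMode N.Y (p + r - s) a (fourierMode N.Y (q + s) b m) -
          (koszulSign i j * (-1 : ℂ) ^ r) •
            fourierMode N.Y (q + r - s) b (fourierMode N.Y (p + s) a m)) :=
  N.borcherds i j a ha b hb m p q r

theorem finsum_eq_sum_range {E : Type*} [AddCommMonoid E] {f : ℕ → E} {K : ℕ}
    (h : ∀ s, K ≤ s → f s = 0) : ∑ᶠ s, f s = ∑ s ∈ Finset.range K, f s := by
  refine finsum_eq_sum_of_support_subset _ fun s hs => ?_
  simp only [Finset.coe_range, Set.mem_Iio]
  by_contra hlt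
  exact hs (h s (not_lt.mp hlt))

theorem choose_zero_left {s : ℕ} (hs : s ≠ 0) : Ring.choose (0 : ℤ) s = 0 := by
  have := Ring.choose_natCast (R := ℤ) 0 s
  rw [Nat.cast_zero] at this
  rw [this, Nat.choose_eq_zero_of_lt (Nat.pos_of_ne_zero hs), Nat.cast_zero]

/-- The commutator formula `[a_(p), b_(q)] = ∑_s (p choose s) (a_(s) b)_(p + q - s)`. -/
theorem commutator_formula {i j : ZMod 2} {a b : V} (ha : a ∈ A.par i) (hb : b ∈ A.par j)
    {K : ℕ} (hK : ∀ s : ℕ, K ≤ s → fourierMode A.Y s a b = 0) (p q : ℤ) (m : M) :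
    fourierMode N.Y p a (fourierMode N.Y q b m) -
      koszulSign i j • fourierMode N.Y q b (fourierMode N.Y p a m) =
    ∑ s ∈ Finset.range K, Ring.choose p s •
      fourierMode N.Y (p + q - s) (fourierMode A.Y s a b) m := by
  have h := N.borcherds_mode ha hb m p q 0
  rw [finsum_eq_sum_range (K := K) (fun s hs => by simp [hK s hs])] at h
  rw [finsum_eq_single _ 0 (fun s hs => by rw [choose_zero_left hs]; simp)] at h
  simpa using h.symm

/-- The iterate formula `(a_(-1) b)_(q) = ∑_s (a_(-1-s) b_(q+s) ± b_(q-1-s) a_(s))`. -/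
theorem mode_neg_one {i j : ZMod 2} {a b : V} (ha : a ∈ A.par i) (hb : b ∈ A.par j) (q : ℤ)
    (m : M) {K : ℕ} (hKa : ∀ s : ℕ, K ≤ s → fourierMode N.Y s a m = 0)
    (hKb : ∀ s : ℕ, K ≤ s → fourierMode N.Y (q + s) b m = 0) :
    fourierMode N.Y q (fourierMode A.Y (-1) a b) m = ∑ s ∈ Finset.range K,
      (fourierMode N.Y (-1 - s) a (fourierMode N.Y (q + s) b m) +
        koszulSign i j • fourierMode N.Y (q - 1 - s) b (fourierMode N.Y s a m)) := by
  have h := N.borcherds_mode ha hb m 0 q (-1)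
  have hc : ∀ s : ℕ, (-1 : ℤ) ^ s * Ring.choose (-1 : ℤ) s = 1 := by
    intro s
    rw [Ring.choose_neg, add_sub_cancel_left, Ring.choose_natCast, Nat.choose_self,
      Int.negOnePow_def, Units.smul_def, zpow_natCast]
    push_cast
    rw [smul_eq_mul, mul_one, ← mul_pow]
    norm_num
  rw [finsum_eq_single _ 0 (fun s hs => by rw [choose_zero_left hs]; simp),
    finsum_eq_sum_range (K := K) (fun s hs => by simp [hKa s hs, hKb s hs])] at h
  simp only [Ring.choose_zero_right, one_smul, zero_add, Nat.cast_zero, sub_zero, add_zero, hc,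
    zpow_neg_one] at h
  rw [h]
  refine Finset.sum_congr rfl fun s _ => ?_
  norm_num [sub_eq_add_neg]

theorem mode_T (a : V) (n : ℤ) (m : M) :
    fourierMode N.Y n (A.T a) m = (-n : ℂ) • fourierMode N.Y (n - 1) a m := by
  suffices h : (LinearMap.applyₗ m) ∘ₗ fourierMode N.Y n ∘ₗ A.T =
      (-n : ℂ) • (LinearMap.applyₗ m) ∘ₗ fourierMode N.Y (n - 1) from LinearMap.congr_fun h a
  refine A.ext_par fun i a ha => ?_
  -- the Borcherds identity for `b = |0⟩`, `r = -2`, `q = 0`: one of the sides vanishes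
  have h := N.borcherds_mode ha A.vac_even m n 0 (-2)
  have hv : ∀ k : ℤ, k ≠ -1 → fourierMode N.Y k A.vac = 0 := fun k hk =>
    (N.Y_of_vac k).trans (if_neg hk)
  rw [finsum_eq_sum_range (K := 2) (fun s hs => by
      rw [A.mode_vac_of_nonneg _ (by omega)]; simp),
    finsum_eq_sum_range (K := 0) (fun s _ => by
      rw [hv (0 + s) (by omega), hv (0 + -2 - s) (by omega)]; simp)] at h
  simp only [Finset.sum_range_succ, Finset.sum_range_zero, Ring.choose_zero_right,
    Ring.choose_one_right, zero_add, add_zero, one_smul, Nat.cast_zero, sub_zero, Nat.cast_one,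
    ← A.T_eq_mode] at h
  rw [show (-2 + 1 : ℤ) = -1 by norm_num, A.mode_vac_neg_one] at h
  simp only [LinearMap.comp_apply, LinearMap.applyₗ_apply_apply, LinearMap.smul_apply]
  rw [eq_neg_of_add_eq_zero_left h, neg_smul, Int.cast_smul_eq_zsmul]

variable (C : ConformalStructure A)

/-- `a_(n) b` vanishes when its weight is negative. -/
theorem _root_.ConformalStructure.mode_eq_zero {x y : ℤ × ℤ × ZMod 2} {a b : V}
    (ha : a ∈ C.piece x) (hb : b ∈ C.piece y) {n : ℤ} (hn : x.1 + y.1 ≤ n) :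
    fourierMode A.Y n a b = 0 :=
  C.piece_neg (by simp; omega) (C.mode_mem_piece ha hb n)

theorem exists_even_comm {u b : V} {j : ZMod 2} (hu : u ∈ A.par 0) (hb : b ∈ A.par j)
    (p q : ℤ) (m : M) : ∃ K : ℕ, 2 ≤ K ∧ fourierMode N.Y p u (fourierMode N.Y q b m) -
      fourierMode N.Y q b (fourierMode N.Y p u m) =
    ∑ s ∈ Finset.range K, Ring.choose p s •
      fourierMode N.Y (p + q - s) (fourierMode A.Y s u b) m := by
  obtain ⟨K, hK⟩ := SUSYVertexAlgebra.exists_mode_eq_zero (A := A) u b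
  refine ⟨K + 2, by omega, ?_⟩
  have := N.commutator_formula hu hb (K := K + 2) (fun s hs => hK s (by omega)) p q m
  rwa [SUSYVertexAlgebra.koszulSign_zero_left, one_smul] at this

theorem mode_zero_comm {u : V} (hu : u ∈ A.par 0) {j : ZMod 2} {b : V} (hb : b ∈ A.par j) (q : ℤ)
    (m : M) : fourierMode N.Y 0 u (fourierMode N.Y q b m) =
      fourierMode N.Y q b (fourierMode N.Y 0 u m) +
        fourierMode N.Y q (fourierMode A.Y 0 u b) m := by
  obtain ⟨K, hK, h⟩ := N.exists_even_comm hu hb 0 q m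
  rw [Finset.sum_eq_single 0 (fun s _ hs => by rw [choose_zero_left hs, zero_smul])
    (fun h0 => absurd (Finset.mem_range.mpr (by omega)) h0), sub_eq_iff_eq_add'] at h
  simpa using h

theorem mode_one_comm {u : V} (hu : u ∈ A.par 0) {j : ZMod 2} {b : V} (hb : b ∈ A.par j) (q : ℤ)
    (m : M) : fourierMode N.Y 1 u (fourierMode N.Y q b m) =
      fourierMode N.Y q b (fourierMode N.Y 1 u m) +
        (fourierMode N.Y (q + 1) (fourierMode A.Y 0 u b) m +
          fourierMode N.Y q (fourierMode A.Y 1 u b) m) := by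
  obtain ⟨K, hK, h⟩ := N.exists_even_comm hu hb 1 q m
  have hc : ∀ s : ℕ, 2 ≤ s → Ring.choose (1 : ℤ) s = 0 := by
    intro s hs
    have := Ring.choose_natCast (R := ℤ) 1 s
    rw [Nat.cast_one] at this
    rw [this, Nat.choose_eq_zero_of_lt (by omega), Nat.cast_zero]
  rw [← Finset.sum_subset (Finset.range_subset_range.mpr hK)
    (fun s _ hs => by rw [hc s (by simpa [Nat.succ_le_iff] using hs), zero_smul]),
    sub_eq_iff_eq_add'] at h
  simpa [Finset.sum_range_succ, Ring.choose_zero_right, Ring.choose_one_right, add_comm] using h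

/-- The subspace of `M` of weight `x.1`, charge `x.2.1` and parity `x.2.2`. -/
abbrev piece (x : ℤ × ℤ × ZMod 2) : Submodule ℂ M :=
  gradedPiece N.par (modeL N.Y C.j C.h 0) (modeJ N.Y C.j 0) x

theorem modeL_eq (n : ℤ) : modeL N.Y C.j C.h n = fourierMode N.Y (n + 1) C.omega := by
  ext m
  have h : (N.Y 1 C.h)[[n + 1]] = fourierMode N.Y (n + 1) (A.D C.h) := by
    rw [N.Y_one]
    rfl
  rw [modeL, ConformalStructure.omega, map_sub, h, LinearMap.sub_apply, N.mode_T]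
  simp only [modeJ, fourierMode, LinearMap.comp_apply, LinearMap.proj_apply, add_sub_cancel_right,
    LinearMap.add_apply, LinearMap.smul_apply]
  push_cast
  module

theorem modeJ_eq (n : ℤ) : modeJ N.Y C.j n = fourierMode N.Y n C.j := rfl

theorem mem_piece_iff {x : ℤ × ℤ × ZMod 2} {m : M} : m ∈ N.piece C x ↔
    fourierMode N.Y 1 C.omega m = (x.1 : ℂ) • m ∧ fourierMode N.Y 0 C.j m = (x.2.1 : ℂ) • m ∧
      m ∈ N.par x.2.2 := by
  rw [piece, gradedPiece, N.modeL_eq, N.modeJ_eq, Submodule.mem_inf, Submodule.mem_inf,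
    Module.End.mem_eigenspace_iff, Module.End.mem_eigenspace_iff, and_assoc]
  rfl

variable {C N}

theorem _root_.ConformalStructure.mem_par {x : ℤ × ℤ × ZMod 2} {a : V} (ha : a ∈ C.piece x) :
    a ∈ A.par x.2.2 := ha.2

theorem mode_mem_piece {x y : ℤ × ℤ × ZMod 2} {a : V} {m : M} (ha : a ∈ C.piece x)
    (hm : m ∈ N.piece C y) (n : ℤ) :
    fourierMode N.Y n a m ∈ N.piece C (x.1 + y.1 - n - 1, x.2 + y.2) := by
  rw [mem_piece_iff] at hm ⊢
  refine ⟨?_, ?_, ?_⟩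
  · rw [N.mode_one_comm C.omega_even (C.mem_par ha), C.omega_zero, N.mode_T,
      C.omega_one_of_mem ha, hm.1]
    simp only [add_sub_cancel_right, LinearMap.smul_apply, map_smul]
    push_cast
    module
  · rw [N.mode_zero_comm C.j_even (C.mem_par ha), C.j_zero_of_mem ha, hm.2.1]
    simp only [LinearMap.smul_apply, map_smul, Prod.fst_add]
    push_cast
    module
  · have := N.Y_even 0 _ _ a (C.mem_par ha) m hm.2.2 n
    rwa [add_zero] at this

/-- The condition that `M` is a module of positive energy. -/
theorem IsPositiveEnergy.piece_neg (hN : N.IsPositiveEnergy C) {x : ℤ × ℤ × ZMod 2} (hx : x.1 < 0)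
    {m : M} (hm : m ∈ N.piece C x) : m = 0 := by
  have h : m ∈ (modeL N.Y C.j C.h 0).eigenspace (x.1 : ℂ) := hm.1.1
  rwa [IntegrabilityConditions.nonneg hN _ hx, Submodule.mem_bot] at h

theorem IsPositiveEnergy.mode_eq_zero (hN : N.IsPositiveEnergy C) {x y : ℤ × ℤ × ZMod 2} {a : V}
    {m : M} (ha : a ∈ C.piece x) (hm : m ∈ N.piece C y) {n : ℤ} (hn : x.1 + y.1 ≤ n) :
    fourierMode N.Y n a m = 0 :=
  hN.piece_neg (by simp; omega) (mode_mem_piece ha hm n)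

theorem IsPositiveEnergy.iSup_piece (hN : N.IsPositiveEnergy C) : ⨆ x, N.piece C x = ⊤ :=
  (IntegrabilityConditions.internal hN).submodule_iSup_eq_top

theorem IsPositiveEnergy.mem_of_pieces (hN : N.IsPositiveEnergy C) {X : Submodule ℂ M}
    (h : ∀ x, N.piece C x ≤ X) (m : M) : m ∈ X := by
  have : (⊤ : Submodule ℂ M) ≤ X := hN.iSup_piece ▸ iSup_le h
  exact this Submodule.mem_top

end SUSYModule

end Grading

/-! ### Lowest weight vectors modulo a submodule -/

section Zhu

variable {V M : Type*} [AddCommGroup V] [Module ℂ V] [AddCommGroup M] [Module ℂ M]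
  {A : SUSYVertexAlgebra V} {C : ConformalStructure A} {N : SUSYModule A M}

theorem zeroMode_apply_of_mem {x : ℤ × ℤ × ZMod 2} {a : V} (ha : a ∈ C.piece x) :
    zeroMode C N a = fourierMode N.Y (x.1 - 1) a := zeroMode_of_mem C N x ha

theorem zeroMode_mode {x y : ℤ × ℤ × ZMod 2} {a b : V} (ha : a ∈ C.piece x) (hb : b ∈ C.piece y)
    (n : ℤ) : zeroMode C N (fourierMode A.Y n a b) =
      fourierMode N.Y (x.1 + y.1 - n - 2) (fourierMode A.Y n a b) := by
  rw [zeroMode_apply_of_mem (C.mode_mem_piece ha hb n)]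
  congr 2
  ring

theorem zeroMode_T {x : ℤ × ℤ × ZMod 2} {a : V} (ha : a ∈ C.piece x) :
    zeroMode C N (A.T a) = (-x.1 : ℂ) • zeroMode C N a := by
  ext m
  rw [zeroMode_apply_of_mem (C.T_mem_piece ha), zeroMode_apply_of_mem ha, N.mode_T]
  simp

theorem zeroMode_vac : zeroMode C N A.vac = 1 := by
  rw [zeroMode_apply_of_mem C.vac_mem_piece]
  exact N.Y_of_vac _

namespace SUSYModule

variable (N) in
/-- A subspace of `M` which is stable under all the operators `a_(n)`. -/
def IsStable (W : Submodule ℂ M) : Prop :=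
  ∀ (a : V) (n : ℤ), ∀ m ∈ W, fourierMode N.Y n a m ∈ W

variable (C N) in
/-- The vector `v` is homogeneous, and its image in `M / W` is killed by all the operators which
lower the weight. -/
structure IsLowest (W : Submodule ℂ M) (y : ℤ × ℤ × ZMod 2) (v : M) : Prop where
  stable : N.IsStable W
  mem : v ∈ N.piece C y
  low : ∀ x : ℤ × ℤ × ZMod 2, ∀ a ∈ C.piece x, ∀ n : ℤ, x.1 - 1 < n →
    fourierMode N.Y n a v ∈ W

end SUSYModule

/-- The terms of weight less than that of `a_(-1) b` in the formula for `o(a_(-1) b)`; here `a` and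
`b` have weights `x` and `z`. -/
def lowerTerms (A : SUSYVertexAlgebra V) (x z : ℤ) (a b : V) : V :=
  ∑ s ∈ Finset.range (x - 1).toNat, ∑ k ∈ Finset.range (x + z).toNat,
    Ring.choose (s : ℤ) k • fourierMode A.Y k a b

theorem lowerTerms_mem {x z : ℤ × ℤ × ZMod 2} {a b : V} (ha : a ∈ C.piece x) (hb : b ∈ C.piece z)
    {X : Submodule ℂ V} (hX : ∀ t : ℤ × ℤ × ZMod 2, t.1 < x.1 + z.1 → C.piece t ≤ X) :
    lowerTerms A x.1 z.1 a b ∈ X := by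
  refine sum_mem fun s _ => sum_mem fun k _ => zsmul_mem ?_ _
  exact hX _ (by dsimp only; omega) (C.mode_mem_piece ha hb k)

/-- Modulo vectors of lower weight, `o(a_(-1) b) = ± o(b) o(a)` on lowest weight vectors. -/
theorem SUSYModule.IsLowest.zeroMode_neg_one {W : Submodule ℂ M} {y : ℤ × ℤ × ZMod 2} {v : M}
    (hv : N.IsLowest C W y v) {x z : ℤ × ℤ × ZMod 2} {a b : V} (ha : a ∈ C.piece x)
    (hb : b ∈ C.piece z) (hx : 1 ≤ x.1) :
    zeroMode C N (fourierMode A.Y (-1) a b + lowerTerms A x.1 z.1 a b) v -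
      koszulSign x.2.2 z.2.2 • zeroMode C N b (zeroMode C N a v) ∈ W := by
  obtain ⟨d, hd⟩ : ∃ d : ℕ, x.1 = d + 1 := ⟨(x.1 - 1).toNat, by omega⟩
  obtain ⟨q, hq⟩ : ∃ q : ℤ, q = x.1 + z.1 - 1 := ⟨_, rfl⟩
  obtain ⟨K₁, hK₁⟩ := N.exists_mode_eq_zero a v
  obtain ⟨K₂, hK₂⟩ := N.exists_mode_eq_zero b v
  let K := K₁ + K₂ + q.natAbs
  have h1 := N.mode_neg_one (C.mem_par ha) (C.mem_par hb) q v (K := d + 1 + K)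
    (fun s hs => hK₁ s (by omega)) (fun s hs => hK₂ _ (by omega))
  -- the terms which lower the weight of `v` first
  have hbv : ∀ n : ℤ, z.1 - 1 < n → ∀ k, W.mkQ (fourierMode N.Y k a (fourierMode N.Y n b v)) = 0 :=
    fun n hn k => by
      rw [← LinearMap.mem_ker, W.ker_mkQ]
      exact hv.stable a k _ (hv.low z b hb n hn)
  have hav : ∀ n : ℤ, x.1 - 1 < n → ∀ k, W.mkQ (fourierMode N.Y k b (fourierMode N.Y n a v)) = 0 :=
    fun n hn k => by
      rw [← LinearMap.mem_ker, W.ker_mkQ]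
      exact hv.stable b k _ (hv.low x a ha n hn)
  have hcomm : ∀ s : ℕ, s < d → W.mkQ (koszulSign x.2.2 z.2.2 •
      fourierMode N.Y (q - 1 - s) b (fourierMode N.Y s a v)) =
      -W.mkQ (∑ k ∈ Finset.range (x.1 + z.1).toNat, Ring.choose (s : ℤ) k •
        zeroMode C N (fourierMode A.Y k a b) v) := by
    intro s hs
    have h2 := N.commutator_formula (C.mem_par ha) (C.mem_par hb) (K := (x.1 + z.1).toNat)
      (fun k hk => C.mode_eq_zero ha hb (by omega)) s (q - 1 - s) v
    have h3 : ∀ k : ℕ, (s : ℤ) + (q - 1 - s) - k = x.1 + z.1 - k - 2 := fun k => by omega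
    simp only [h3, ← zeroMode_mode (N := N) ha hb] at h2
    rw [← h2, map_sub, hbv _ (by omega), zero_sub, neg_neg]
  refine (Submodule.Quotient.mk_eq_zero W).mp ?_
  change W.mkQ _ = 0
  rw [map_add, LinearMap.add_apply, zeroMode_mode ha hb, show x.1 + z.1 - (-1) - 2 = q by omega, h1,
    Finset.sum_range_add, Finset.sum_range_succ, map_sub, map_add, map_add, map_add]
  have e1 : W.mkQ (∑ s ∈ Finset.range d, (fourierMode N.Y (-1 - s) a (fourierMode N.Y (q + s) b v) +
      koszulSign x.2.2 z.2.2 • fourierMode N.Y (q - 1 - s) b (fourierMode N.Y s a v))) =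
      -W.mkQ (zeroMode C N (lowerTerms A x.1 z.1 a b) v) := by
    rw [map_sum, lowerTerms, map_sum, LinearMap.sum_apply, map_sum, ← Finset.sum_neg_distrib,
      show (x.1 - 1).toNat = d by omega]
    refine Finset.sum_congr rfl fun s hs => ?_
    rw [map_add, hbv _ (by omega), zero_add, hcomm s (Finset.mem_range.mp hs)]
    simp only [map_sum, LinearMap.sum_apply, map_zsmul, LinearMap.smul_apply]
  have e2 : W.mkQ (fourierMode N.Y (-1 - d) a (fourierMode N.Y (q + d) b v) +
      koszulSign x.2.2 z.2.2 • fourierMode N.Y (q - 1 - d) b (fourierMode N.Y d a v)) =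
      W.mkQ (koszulSign x.2.2 z.2.2 • zeroMode C N b (zeroMode C N a v)) := by
    rw [map_add, hbv _ (by omega), zero_add, zeroMode_apply_of_mem ha, zeroMode_apply_of_mem hb,
      show q - 1 - d = z.1 - 1 by omega, show (d : ℤ) = x.1 - 1 by omega]
  have e3 : W.mkQ (∑ s ∈ Finset.range K, (fourierMode N.Y (-1 - (d + 1 + s : ℕ)) a
      (fourierMode N.Y (q + (d + 1 + s : ℕ)) b v) + koszulSign x.2.2 z.2.2 •
        fourierMode N.Y (q - 1 - (d + 1 + s : ℕ)) b (fourierMode N.Y (d + 1 + s : ℕ) a v))) =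
      0 := by
    rw [map_sum]
    refine Finset.sum_eq_zero fun s _ => ?_
    rw [map_add, hbv _ (by push_cast; omega), map_smul, hav _ (by push_cast; omega), smul_zero,
      add_zero]
  rw [e1, e2, e3]
  abel

variable (C N) in
/-- The vectors whose zero modes act trivially on all lowest weight vectors of the quotients
of `M`. The quotient of `V` by it plays the role of Zhu's algebra. -/
def zhuSubspace : Submodule ℂ V where
  carrier := {a | ∀ (W : Submodule ℂ M) (y : ℤ × ℤ × ZMod 2) (v : M), N.IsLowest C W y v →
    zeroMode C N a v ∈ W}
  add_mem' ha hb W y v hv := by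
    rw [map_add]
    exact add_mem (ha W y v hv) (hb W y v hv)
  zero_mem' W y v _ := by simp
  smul_mem' c a ha W y v hv := by
    rw [map_smul]
    exact W.smul_mem c (ha W y v hv)

theorem zhuSubspace_T {x z : ℤ × ℤ × ZMod 2} {a b : V} (ha : a ∈ C.piece x) (hb : b ∈ C.piece z) :
    fourierMode A.Y (-2) a b + lowerTerms A (x.1 + 1) z.1 (A.T a) b + (x.1 : ℂ) •
      (fourierMode A.Y (-1) a b + lowerTerms A x.1 z.1 a b) ∈ zhuSubspace C N := by
  intro W y v hv
  by_cases hx0 : x.1 < 0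
  · simp [C.piece_neg hx0 ha, lowerTerms]
  have hT : fourierMode A.Y (-2) a b = fourierMode A.Y (-1) (A.T a) b := by
    rw [A.mode_T]
    norm_num
  have h1 := hv.zeroMode_neg_one (C.T_mem_piece ha) hb (by dsimp only; omega)
  rw [← hT, zeroMode_T ha, LinearMap.smul_apply, map_smul] at h1
  rw [map_add, LinearMap.add_apply, map_smul, LinearMap.smul_apply]
  rcases (not_lt.mp hx0).eq_or_lt with h0 | h0
  · rw [← h0] at h1 ⊢
    simpa using h1
  · have h2 := W.smul_mem (x.1 : ℂ) (hv.zeroMode_neg_one ha hb h0)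
    have h3 := add_mem h1 h2
    convert h3 using 1
    dsimp only
    module

/-- For a `C_2`-cofinite vertex algebra Zhu's algebra is finite dimensional. -/
theorem finiteDimensional_quotient_zhuSubspace (hA : A.IsC2Cofinite) :
    FiniteDimensional ℂ (V ⧸ zhuSubspace C N) := by
  obtain ⟨F, hF⟩ := C.exists_finset_piece_le hA
  let U : Submodule ℂ V := ⨆ x : F, C.piece x
  have hfin : ∀ x : F, FiniteDimensional ℂ (C.piece x) := fun x => by
    have := C.integrability.finite x.1.1 x.1.2.1
    exact Submodule.finiteDimensional_of_le (inf_le_left : C.piece x ≤ _)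
  have hU : FiniteDimensional ℂ U := Submodule.finiteDimensional_iSup _
  have htop : ∀ a : V, a ∈ U ⊔ zhuSubspace C N := by
    refine C.c2_induction hF (fun x hx => ?_) (fun x z a ha b hb hlow => ?_)
    · exact (le_iSup (fun x : F => C.piece x) ⟨x, hx⟩).trans le_sup_left
    · have h1 := Submodule.mem_sup_right (S := U) (zhuSubspace_T (N := N) ha hb)
      have h2 : lowerTerms A (x.1 + 1) z.1 (A.T a) b ∈ U ⊔ zhuSubspace C N :=
        lowerTerms_mem (C.T_mem_piece ha) hb fun t ht => hlow t (by dsimp only at ht; omega)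
      have h3 : lowerTerms A x.1 z.1 a b ∈ U ⊔ zhuSubspace C N :=
        lowerTerms_mem ha hb fun t ht => hlow t (by omega)
      have h4 : fourierMode A.Y (-1) a b ∈ U ⊔ zhuSubspace C N :=
        hlow _ (by dsimp only; omega) (C.mode_mem_piece ha hb (-1))
      have h5 := sub_mem (sub_mem h1 h2) (Submodule.smul_mem _ (x.1 : ℂ) (add_mem h4 h3))
      convert h5 using 1
      module
  have : LinearMap.range ((zhuSubspace C N).mkQ ∘ₗ U.subtype) = ⊤ := by
    rw [LinearMap.range_comp, Submodule.range_subtype, Submodule.map_mkQ_eq_top, sup_comm]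
    exact eq_top_iff.mpr fun a _ => htop a
  exact Module.Finite.of_surjective _ (LinearMap.range_eq_top.mp this)

/-- If `o(β b) v = λ o(b) v` modulo `W` for all `b`, then `λ` is a root of a polynomial
which depends only on `β`, unless `v ∈ W`. -/
theorem exists_polynomial (hA : A.IsC2Cofinite) (β : Module.End ℂ V) :
    ∃ P : Polynomial ℂ, P ≠ 0 ∧ ∀ (W : Submodule ℂ M) (y : ℤ × ℤ × ZMod 2) (v : M),
      N.IsLowest C W y v → ∀ c : ℂ,
        (∀ b : V, zeroMode C N (β b) v - c • zeroMode C N b v ∈ W) → P.eval c • v ∈ W := by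
  have := finiteDimensional_quotient_zhuSubspace (C := C) (N := N) hA
  have hdep : ¬ LinearIndependent ℂ
      (fun k : ℕ => (zhuSubspace C N).mkQ ((β ^ k) A.vac)) :=
    Module.Finite.not_linearIndependent_of_infinite _
  rw [linearIndependent_iff] at hdep
  push Not at hdep
  obtain ⟨l, hl, hl0⟩ := hdep
  refine ⟨∑ k ∈ l.support, Polynomial.monomial k (l k), fun h => hl0 ?_, fun W y v hv c hc => ?_⟩
  · ext k
    have h1 := congrArg (Polynomial.coeff · k) h
    simpa [Polynomial.finsetSum_coeff, Polynomial.coeff_monomial] using h1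
  have hpow : ∀ k : ℕ, zeroMode C N ((β ^ k) A.vac) v - c ^ k • v ∈ W := by
    intro k
    induction k with
    | zero => simp [zeroMode_vac]
    | succ k ih =>
      have h1 := add_mem (hc ((β ^ k) A.vac)) (W.smul_mem c ih)
      rw [pow_succ' β, Module.End.mul_apply]
      convert h1 using 1
      rw [pow_succ']
      module
  have hmem : ∑ k ∈ l.support, l k • (β ^ k) A.vac ∈ zhuSubspace C N := by
    rw [← Submodule.Quotient.mk_eq_zero, ← Submodule.mkQ_apply, map_sum, ← hl,
      Finsupp.linearCombination_apply, Finsupp.sum]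
    simp only [map_smul]
  have h1 := hmem W y v hv
  have h2 : ∑ k ∈ l.support, l k • (zeroMode C N ((β ^ k) A.vac) v - c ^ k • v) ∈ W :=
    sum_mem fun k _ => W.smul_mem _ (hpow k)
  have h3 := sub_mem h1 h2
  rw [map_sum, LinearMap.sum_apply, ← Finset.sum_sub_distrib] at h3
  rw [Polynomial.eval_finsetSum, Finset.sum_smul]
  convert h3 using 2 with k
  rw [Polynomial.eval_monomial, map_smul, LinearMap.smul_apply]
  module

/-- A module of positive energy is generated by finitely many of its joint eigenspaces. -/
theorem exists_finite_generators (hA : A.IsC2Cofinite) (hN : N.IsPositiveEnergy C) :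
    ∃ S : Set (ℤ × ℤ), S.Finite ∧ ∀ W : Submodule ℂ M, N.IsStable W →
      (∀ x : ℤ × ℤ × ZMod 2, (x.1, x.2.1) ∈ S → N.piece C x ≤ W) → W = ⊤ := by
  obtain ⟨P, hP0, hP⟩ := exists_polynomial (C := C) (N := N) hA
    (fourierMode A.Y (-1) C.omega + A.T)
  obtain ⟨Q, hQ0, hQ⟩ := exists_polynomial (C := C) (N := N) hA (fourierMode A.Y (-1) C.j)
  have hroots : ∀ R : Polynomial ℂ, R ≠ 0 → {n : ℤ | R.eval (n : ℂ) = 0}.Finite := by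
    intro R hR
    have := Polynomial.finite_setOfPred_isRoot hR
    exact this.preimage (Int.cast_injective.injOn)
  refine ⟨{n : ℤ | P.eval (n : ℂ) = 0} ×ˢ {n : ℤ | Q.eval (n : ℂ) = 0},
    (hroots P hP0).prod (hroots Q hQ0), fun W hW hS => ?_⟩
  suffices h : ∀ (n : ℕ) (y : ℤ × ℤ × ZMod 2), y.1 < n → N.piece C y ≤ W from
    eq_top_iff.mpr fun m _ => hN.mem_of_pieces
      (fun y => h (y.1.toNat + 1) y (by have := Int.self_le_toNat y.1; omega)) m
  intro n
  induction n with
  | zero =>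
    intro y hy m hm
    rw [hN.piece_neg (by simpa using hy) hm]
    exact zero_mem _
  | succ n ih =>
    intro y hy v hv
    have hl : N.IsLowest C W y v := ⟨hW, hv, fun x a ha k hk =>
      ih _ (by push_cast at hy; dsimp only; omega) (SUSYModule.mode_mem_piece ha hv k)⟩
    -- `o(j_(-1) b) = o(b) J_0` on lowest weight vectors
    have hJ : ∀ b : V, zeroMode C N (fourierMode A.Y (-1) C.j b) v -
        (y.2.1 : ℂ) • zeroMode C N b v ∈ W := by
      intro b
      refine C.mem_of_pieces (X := W.comap (LinearMap.applyₗ v ∘ₗ zeroMode C N ∘ₗ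
        fourierMode A.Y (-1) C.j - (y.2.1 : ℂ) • LinearMap.applyₗ v ∘ₗ zeroMode C N))
        (fun z b hb => ?_) b
      have h1 := hl.zeroMode_neg_one C.j_mem_piece hb le_rfl
      rw [zeroMode_apply_of_mem C.j_mem_piece] at h1
      simp only [lowerTerms, sub_self, Int.toNat_zero, Finset.range_zero, Finset.sum_empty,
        add_zero, SUSYVertexAlgebra.koszulSign_zero_left, one_smul,
        ((N.mem_piece_iff C).mp hv).2.1, map_smul] at h1
      exact h1
    -- `o(ω_(-1) b + ∂ b) = o(b) L_0` on lowest weight vectors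
    have hL : ∀ b : V, zeroMode C N ((fourierMode A.Y (-1) C.omega + A.T) b) v -
        (y.1 : ℂ) • zeroMode C N b v ∈ W := by
      intro b
      refine C.mem_of_pieces (X := W.comap (LinearMap.applyₗ v ∘ₗ zeroMode C N ∘ₗ
        (fourierMode A.Y (-1) C.omega + A.T) - (y.1 : ℂ) • LinearMap.applyₗ v ∘ₗ zeroMode C N))
        (fun z b hb => ?_) b
      have h1 := hl.zeroMode_neg_one C.omega_mem_piece hb one_le_two
      have h2 : lowerTerms A 2 z.1 C.omega b = A.T b := by
        by_cases hz : z.1 < 0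
        · simp [C.piece_neg hz hb, lowerTerms]
        rw [lowerTerms, show (2 - 1 : ℤ).toNat = 1 from rfl, Finset.sum_range_one,
          Finset.sum_eq_single 0]
        · simp [C.omega_zero]
        · intro k _ hk
          rw [Nat.cast_zero, SUSYModule.choose_zero_left hk, zero_smul]
        · intro h
          exact absurd (Finset.mem_range.mpr (by omega)) h
      rw [zeroMode_apply_of_mem C.omega_mem_piece] at h1
      simp only [h2, SUSYVertexAlgebra.koszulSign_zero_left, one_smul, 
        show (2 - 1 : ℤ) = 1 from rfl, ((N.mem_piece_iff C).mp hv).1, map_smul] at h1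
      exact h1
    by_cases h1 : P.eval (y.1 : ℂ) = 0
    · by_cases h2 : Q.eval (y.2.1 : ℂ) = 0
      · exact hS y ⟨h1, h2⟩ hv
      · exact (W.smul_mem_iff h2).mp (hQ W y v hl _ hJ)
    · exact (W.smul_mem_iff h1).mp (hP W y v hl _ hL)

end Zhu

/-! ### Charges of a module of positive energy -/

section Words

/-- The smallest sum of `r` distinct natural numbers is `0 + 1 + ⋯ + (r - 1)`. -/
theorem Finset.sum_range_card_le (s : Finset ℕ) : ∑ i ∈ Finset.range s.card, i ≤ ∑ i ∈ s, i := by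
  induction h : s.card generalizing s with
  | zero => simp
  | succ k ih =>
    have hs : s.Nonempty := Finset.card_pos.mp (by omega)
    have h1 : (s.erase (s.max' hs)).card = k := by
      rw [Finset.card_erase_of_mem (s.max'_mem hs), h, Nat.add_sub_cancel]
    have h2 := ih _ h1
    have h3 : k ≤ s.max' hs := by
      have : s ⊆ Finset.range (s.max' hs + 1) := fun i hi =>
        Finset.mem_range.mpr (Nat.lt_succ_of_le (s.le_max' i hi))
      have := Finset.card_le_card this
      rw [Finset.card_range] at this
      omega
    rw [Finset.sum_range_succ, ← Finset.sum_erase_add _ _ (s.max'_mem hs)]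
    omega

theorem List.Nodup.le_sum {l : List ℤ} (h : l.Nodup) (h0 : ∀ i ∈ l, 0 ≤ i) :
    (l.length : ℤ) * (l.length - 1) ≤ 2 * l.sum := by
  have h1 : ((l.map Int.toNat).length : ℤ) = l.length := by simp
  have h2 : (((l.map Int.toNat).sum : ℕ) : ℤ) = l.sum := by
    rw [Nat.cast_list_sum, List.map_map]
    congr 1
    nth_rewrite 2 [← List.map_id l]
    exact List.map_congr_left fun i hi => Int.toNat_of_nonneg (h0 i hi)
  have h3 : (l.map Int.toNat).Nodup := by
    refine h.map_on fun i hi j hj hij => ?_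
    rw [← Int.toNat_of_nonneg (h0 i hi), hij, Int.toNat_of_nonneg (h0 j hj)]
  have h4 := Finset.sum_range_card_le (l.map Int.toNat).toFinset
  rw [List.toFinset_card_of_nodup h3, List.sum_toFinset _ h3, List.map_id'] at h4
  have h5 := Finset.sum_range_id_mul_two (l.map Int.toNat).length
  rw [← h2, ← h1]
  set r := (l.map Int.toNat).length
  rcases Nat.eq_zero_or_pos r with h6 | h6
  · have : 0 ≤ (((l.map Int.toNat).sum : ℕ) : ℤ) := Nat.cast_nonneg _
    rw [h6, Nat.cast_zero, zero_mul]
    omega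
  · have h7 : ((r - 1 : ℕ) : ℤ) = r - 1 := by omega
    rw [← h7]
    norm_cast
    omega

theorem List.sum_sq_le_sq_sum {l : List ℤ} (h0 : ∀ i ∈ l, 0 ≤ i) :
    0 ≤ l.sum ∧ (l.map (· ^ 2)).sum ≤ l.sum ^ 2 := by
  induction l with
  | nil => simp
  | cons a l ih =>
    have ha := h0 a (by simp)
    obtain ⟨h1, h2⟩ := ih fun i hi => h0 i (by simp [hi])
    simp only [List.sum_cons, List.map_cons]
    exact ⟨by positivity, by nlinarith [mul_nonneg ha h1]⟩

/-- A list with a repetition can be permuted so that its first two entries agree. -/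
theorem List.exists_perm_of_not_nodup {α β : Type*} (f : α → β) {l : List α}
    (h : ¬ (l.map f).Nodup) : ∃ s t l', l.Perm (s :: t :: l') ∧ f s = f t := by
  induction l with
  | nil => simp at h
  | cons a l ih =>
    rw [List.map_cons, List.nodup_cons, not_and_or, not_not] at h
    rcases h with h | h
    · obtain ⟨b, hb, hab⟩ := List.mem_map.mp h
      obtain ⟨l₁, l₂, rfl⟩ := List.append_of_mem hb
      exact ⟨a, b, l₁ ++ l₂, List.Perm.cons _ List.perm_middle, hab.symm⟩
    · obtain ⟨s, t, l', hp, hst⟩ := ih h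
      refine ⟨s, t, a :: l', (hp.cons a).trans ?_, hst⟩
      exact (List.Perm.swap s a _).trans ((List.Perm.swap t a _).cons s)

variable {V M : Type*} [AddCommGroup V] [Module ℂ V] [AddCommGroup M] [Module ℂ M]
  {A : SUSYVertexAlgebra V} {C : ConformalStructure A} {N : SUSYModule A M}

variable (C) in
/-- An operator `a_(n)`, with `a` homogeneous. -/
structure Letter where
  deg : ℤ × ℤ × ZMod 2
  vec : V
  mode : ℤ
  mem : vec ∈ C.piece deg
  nonneg : 0 ≤ deg.1

/-- The weight of the vector `a` in the operator `a_(n)`. -/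
def Letter.wt (t : Letter C) : ℕ := t.deg.1.toNat

/-- The sum of the weights of the vectors in a word. -/
def wordWt (l : List (Letter C)) : ℕ := (l.map Letter.wt).sum

variable (N) in
/-- The product of the operators in a word. -/
def word (l : List (Letter C)) : Module.End ℂ M :=
  (l.map fun t => fourierMode N.Y t.mode t.vec).prod

@[simp] theorem word_nil (m : M) : word N ([] : List (Letter C)) m = m := rfl

@[simp] theorem word_cons (t : Letter C) (l : List (Letter C)) (m : M) :
    word N (t :: l) m = fourierMode N.Y t.mode t.vec (word N l m) := by
  simp [word]

@[simp] theorem word_append (l l' : List (Letter C)) (m : M) :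
    word N (l ++ l') m = word N l (word N l' m) := by
  simp [word]

@[simp] theorem wordWt_append (l l' : List (Letter C)) :
    wordWt (l ++ l') = wordWt l + wordWt l' := by
  simp [wordWt]

@[simp] theorem wordWt_cons (t : Letter C) (l : List (Letter C)) :
    wordWt (t :: l) = t.wt + wordWt l := by
  simp [wordWt]

theorem wordWt_perm {l l' : List (Letter C)} (h : l.Perm l') : wordWt l = wordWt l' :=
  (h.map _).sum_eq

variable (N) in
/-- The submodule `X` contains the words of weight less than `p`, and those of weight `p` and
length less than `r`, applied to `m`. -/
def ContainsShorter (m : M) (p r : ℕ) (X : Submodule ℂ M) : Prop :=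
  ∀ l : List (Letter C), wordWt l < p ∨ (wordWt l = p ∧ l.length < r) → word N l m ∈ X

namespace ContainsShorter

variable {m : M} {p r : ℕ} {X : Submodule ℂ M}

theorem insert_mem (hX : ContainsShorter (C := C) N m p r X) {pre suf : List (Letter C)}
    {x : ℤ × ℤ × ZMod 2} {a : V} (ha : a ∈ C.piece x)
    (hx : wordWt pre + x.1.toNat + wordWt suf < p ∨
      (wordWt pre + x.1.toNat + wordWt suf = p ∧ pre.length + suf.length + 1 < r)) (n : ℤ) :
    word N pre (fourierMode N.Y n a (word N suf m)) ∈ X := by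
  by_cases h0 : x.1 < 0
  · simp [C.piece_neg h0 ha]
  have := hX (pre ++ ⟨x, a, n, ha, not_lt.mp h0⟩ :: suf) (by
    simpa [Letter.wt, add_assoc] using hx)
  simpa using this

theorem insert_two_mem (hX : ContainsShorter (C := C) N m p r X) {pre suf : List (Letter C)}
    {x y : ℤ × ℤ × ZMod 2} {a b : V} (ha : a ∈ C.piece x) (hb : b ∈ C.piece y)
    (hx : wordWt pre + x.1.toNat + y.1.toNat + wordWt suf < p) (n k : ℤ) :
    word N pre (fourierMode N.Y n a (fourierMode N.Y k b (word N suf m))) ∈ X := by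
  by_cases h0 : x.1 < 0
  · simp [C.piece_neg h0 ha]
  by_cases h1 : y.1 < 0
  · simp [C.piece_neg h1 hb]
  have := hX (pre ++ ⟨x, a, n, ha, not_lt.mp h0⟩ :: ⟨y, b, k, hb, not_lt.mp h1⟩ :: suf) (by
    left
    simpa [Letter.wt, add_assoc] using hx)
  simpa using this

/-- Modulo shorter words, operators commute up to sign. -/
theorem swap (hX : ContainsShorter (C := C) N m p r X) {pre suf : List (Letter C)}
    {s t : Letter C} (hp : wordWt (pre ++ s :: t :: suf) = p)
    (h : word N (pre ++ s :: t :: suf) m ∈ X) : word N (pre ++ t :: s :: suf) m ∈ X := by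
  have hst := N.commutator_formula (C.mem_par t.mem) (C.mem_par s.mem)
    (K := (t.deg.1 + s.deg.1).toNat)
    (fun k hk => C.mode_eq_zero t.mem s.mem (by omega)) t.mode s.mode (word N suf m)
  rw [sub_eq_iff_eq_add] at hst
  simp only [word_append, word_cons] at h ⊢
  rw [hst, map_add, map_smul, map_sum]
  refine add_mem (sum_mem fun k hk => ?_) (X.smul_mem _ h)
  rw [map_zsmul]
  refine zsmul_mem (hX.insert_mem (C.mode_mem_piece t.mem s.mem k) (Or.inl ?_) _) _
  simp only [wordWt_append, wordWt_cons, Letter.wt] at hp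
  have hk := Finset.mem_range.mp hk
  have h1 := t.nonneg
  have h2 := s.nonneg
  dsimp only
  omega

theorem perm (hX : ContainsShorter (C := C) N m p r X) {l l' : List (Letter C)} (h : l.Perm l') :
    ∀ pre : List (Letter C), wordWt (pre ++ l) = p → word N (pre ++ l) m ∈ X →
      word N (pre ++ l') m ∈ X := by
  induction h with
  | nil => exact fun _ _ h => h
  | cons t _ ih =>
    intro pre hp h
    have := ih (pre ++ [t]) (by simpa using hp) (by simpa using h)
    simpa using this
  | swap s t l => exact fun pre hp h => hX.swap hp h
  | trans h1 _ ih1 ih2 =>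
    intro pre hp h
    refine ih2 pre ?_ (ih1 pre hp h)
    rw [← hp, wordWt_append, wordWt_append, wordWt_perm h1]

/-- A letter which is of the form `(a_(-2) b)_(n)` can be replaced by words of less weight. -/
theorem c2_mem (hX : ContainsShorter (C := C) N m p r X) {pre suf : List (Letter C)}
    {t : Letter C} (hp : wordWt (pre ++ t :: suf) = p) (ht : t.vec ∈ C.c2Piece t.deg) :
    word N (pre ++ t :: suf) m ∈ X := by
  rw [word_append, word_cons]
  have hle : C.c2Piece t.deg ≤ X.comap ((word N pre) ∘ₗ
      LinearMap.applyₗ (word N suf m) ∘ₗ fourierMode N.Y t.mode) := by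
    refine Submodule.span_le.mpr ?_
    rintro _ ⟨x, y, a, ha, b, hb, h1, h2, rfl⟩
    change word N pre (fourierMode N.Y t.mode (fourierMode A.Y (-2) a b) (word N suf m)) ∈ X
    by_cases hx : x.1 < 0
    · simp [C.piece_neg hx ha]
    by_cases hy : y.1 < 0
    · simp [C.piece_neg hy hb]
    have hwt : wordWt pre + x.1.toNat + y.1.toNat + wordWt suf < p := by
      simp only [wordWt_append, wordWt_cons, Letter.wt] at hp
      omega
    have hT : fourierMode A.Y (-2) a b = fourierMode A.Y (-1) (A.T a) b := by
      rw [A.mode_T]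
      norm_num
    obtain ⟨K₁, hK₁⟩ := N.exists_mode_eq_zero (A.T a) (word N suf m)
    obtain ⟨K₂, hK₂⟩ := N.exists_mode_eq_zero b (word N suf m)
    rw [hT, N.mode_neg_one (C.mem_par (C.T_mem_piece ha)) (C.mem_par hb) t.mode (word N suf m)
      (K := K₁ + K₂ + t.mode.natAbs) (fun s hs => hK₁ s (by omega))
      (fun s hs => hK₂ _ (by omega)), map_sum]
    refine sum_mem fun s _ => ?_
    rw [N.mode_T, N.mode_T]
    simp only [map_add, map_smul]
    exact add_mem (X.smul_mem _ (hX.insert_two_mem ha hb hwt _ _))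
      (X.smul_mem _ (X.smul_mem _ (hX.insert_two_mem hb ha (by omega) _ _)))
  exact hle ht

/-- The relation `∑_{i + j = 2n} a_(i) b_(j) = (a_(-1) b)_(2n+1)` expresses a word with a repeated
mode number by words with a larger sum of squares, and shorter words. -/
theorem repeat_mem (hX : ContainsShorter (C := C) N m p r X) {suf : List (Letter C)}
    {s t : Letter C} (hp : wordWt (s :: t :: suf) = p) (hr : suf.length + 2 = r)
    (hst : s.mode = t.mode)
    (h : ∀ i j : ℤ, i + j = 2 * s.mode → i ≠ j →
      word N ({s with mode := i} :: {t with mode := j} :: suf) m ∈ X) :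
    word N (s :: t :: suf) m ∈ X := by
  have hs := s.nonneg
  have ht := t.nonneg
  simp only [wordWt_cons, Letter.wt] at hp
  obtain ⟨n, hn⟩ : ∃ n, n = s.mode := ⟨_, rfl⟩
  rw [← hn] at h hst
  let ε := koszulSign s.deg.2.2 t.deg.2.2
  have hε : ε * ε = 1 := by
    simp only [ε, koszulSign, ← pow_add, ← two_mul]
    exact (even_two_mul _).neg_one_pow
  have hba : ∀ i j : ℤ, i + j = 2 * n → i ≠ j →
      fourierMode N.Y j t.vec (fourierMode N.Y i s.vec (word N suf m)) ∈ X := by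
    intro i j hij hne
    have := hX.swap (pre := []) (by simpa [Letter.wt] using hp) (h i j hij hne)
    simpa using this
  have hab : ∀ i j : ℤ, i + j = 2 * n → i ≠ j →
      fourierMode N.Y i s.vec (fourierMode N.Y j t.vec (word N suf m)) ∈ X := by
    intro i j hij hne
    simpa using h i j hij hne
  obtain ⟨K₁, hK₁⟩ := N.exists_mode_eq_zero s.vec (word N suf m)
  obtain ⟨K₂, hK₂⟩ := N.exists_mode_eq_zero t.vec (word N suf m)
  have hsum := N.mode_neg_one (C.mem_par s.mem) (C.mem_par t.mem) (2 * n + 1) (word N suf m)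
      (K := K₁ + K₂ + (2 * n + 1).natAbs + 1) (fun k hk => hK₁ k (by omega))
      (fun k hk => hK₂ _ (by omega))
  have htot : fourierMode N.Y (2 * n + 1) (fourierMode A.Y (-1) s.vec t.vec) (word N suf m) ∈ X :=
    hX.insert_mem (pre := []) (C.mode_mem_piece s.mem t.mem (-1))
      (Or.inr ⟨by simp only [wordWt, List.map_nil, List.sum_nil] at hp ⊢; omega,
        by simp; omega⟩) _
  rw [hsum] at htot
  rw [word_cons, word_cons, ← hn, ← hst]
  rcases lt_or_ge n 0 with hn0 | hn0
  · have hmem : (-1 - n).toNat ∈ Finset.range (K₁ + K₂ + (2 * n + 1).natAbs + 1) :=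
      Finset.mem_range.mpr (by omega)
    rw [← Finset.add_sum_erase _ _ hmem] at htot
    have h1 := (X.add_mem_iff_left (sum_mem fun k hk => ?_)).mp htot
    · have h2 := (X.add_mem_iff_left (X.smul_mem _ (hba _ _ (by omega) (by omega)))).mp h1
      rwa [show -1 - (((-1 - n).toNat : ℕ) : ℤ) = n by omega,
        show 2 * n + 1 + (((-1 - n).toNat : ℕ) : ℤ) = n by omega] at h2
    · have hk1 := Finset.ne_of_mem_erase hk
      exact add_mem (hab _ _ (by omega) (by omega))
        (X.smul_mem _ (hba _ _ (by omega) (by omega)))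
  · have hmem : n.toNat ∈ Finset.range (K₁ + K₂ + (2 * n + 1).natAbs + 1) :=
      Finset.mem_range.mpr (by omega)
    rw [← Finset.add_sum_erase _ _ hmem] at htot
    have h1 := (X.add_mem_iff_left (sum_mem fun k hk => ?_)).mp htot
    · have h2 := X.smul_mem ε ((X.add_mem_iff_right (hab _ _ (by omega) (by omega))).mp h1)
      rw [smul_smul, hε, one_smul, show ((n.toNat : ℕ) : ℤ) = n by omega,
        show 2 * n + 1 - 1 - n = n by omega] at h2
      have h3 := hX.swap (pre := []) (suf := suf) (s := {t with mode := n})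
        (t := {s with mode := n}) (by simp [Letter.wt]; omega) (by simpa using h2)
      simpa using h3
    · have hk1 := Finset.ne_of_mem_erase hk
      exact add_mem (hab _ _ (by omega) (by omega))
        (X.smul_mem _ (hba _ _ (by omega) (by omega)))

/-- Words with letters of weight at most `D` whose modes cannot be made distinct are combinations
of shorter words. The modes are counted from the number `T` from which on they vanish on `m`. -/
theorem mem_of_sum_lt (hX : ContainsShorter (C := C) N m p r X) {D T : ℤ}
    (hT : ∀ x : ℤ × ℤ × ZMod 2, x.1 ≤ D → ∀ a ∈ C.piece x, ∀ n : ℤ, T ≤ n →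
      fourierMode N.Y n a m = 0) (l : List (Letter C)) (hp : wordWt l = p) (hr : l.length = r)
    (hD : ∀ t ∈ l, t.deg.1 ≤ D)
    (hl : 2 * (l.map fun t => T - 1 - t.mode).sum < (r : ℤ) * (r - 1)) : word N l m ∈ X := by
  suffices h : ∀ (k : ℕ) (l : List (Letter C)), wordWt l = p → l.length = r →
      (∀ t ∈ l, t.deg.1 ≤ D) → 2 * (l.map fun t => T - 1 - t.mode).sum < (r : ℤ) * (r - 1) →
      (l.map fun t => T - 1 - t.mode).sum ^ 2 -
        ((l.map fun t => T - 1 - t.mode).map (· ^ 2)).sum < k → word N l m ∈ X from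
    h (_ + 1) l hp hr hD hl (by
      push_cast
      exact Int.lt_add_one_of_le (Int.self_le_toNat _))
  clear hp hr hD hl l
  -- a letter with mode at least `T` can be moved to the right, where it kills `m`
  have hneg : ∀ l : List (Letter C), wordWt l = p → (∀ t ∈ l, t.deg.1 ≤ D) →
      (¬ ∀ i ∈ l.map fun t => T - 1 - t.mode, 0 ≤ i) → word N l m ∈ X := by
    intro l hp hD h0
    push Not at h0
    obtain ⟨i, hi, hi0⟩ := h0
    obtain ⟨t, ht, rfl⟩ := List.mem_map.mp hi
    have htD := hD t ht
    obtain ⟨l₁, l₂, rfl⟩ := List.append_of_mem ht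
    have hperm : (l₁ ++ l₂ ++ [t]).Perm (l₁ ++ t :: l₂) := by
      rw [List.append_assoc]
      exact (List.perm_append_singleton t l₂).append_left l₁
    refine hX.perm hperm [] (by rw [List.nil_append, wordWt_perm hperm, hp]) ?_
    rw [List.nil_append, word_append, word_cons, word_nil,
      hT _ htD _ t.mem _ (by omega), map_zero]
    exact zero_mem _
  intro k
  induction k with
  | zero =>
    intro l hp hr hD hl hk
    by_cases h0 : ∀ i ∈ l.map fun t => T - 1 - t.mode, 0 ≤ i
    · have := (List.sum_sq_le_sq_sum h0).2
      push_cast at hk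
      omega
    · exact hneg l hp hD h0
  | succ k ih =>
    intro l hp hr hD hl hk
    by_cases h0 : ∀ i ∈ l.map fun t => T - 1 - t.mode, 0 ≤ i
    · have hnd : ¬ (l.map fun t => T - 1 - t.mode).Nodup := by
        intro hnd
        have := hnd.le_sum h0
        rw [List.length_map, hr] at this
        omega
      obtain ⟨s, t, l', hperm, hst⟩ := List.exists_perm_of_not_nodup _ hnd
      have hp' : wordWt (s :: t :: l') = p := by rw [← wordWt_perm hperm, hp]
      have hr' : (s :: t :: l').length = r := by rw [← hperm.length_eq, hr]
      have hsum := (hperm.map fun t => T - 1 - t.mode).sum_eq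
      have hsq := ((hperm.map fun t => T - 1 - t.mode).map (· ^ 2)).sum_eq
      refine hX.perm hperm.symm [] (by simpa using hp') ?_
      refine hX.repeat_mem hp' hr' (by omega) fun i j hij hne => ?_
      simp only [List.map_cons, List.sum_cons] at hsum hsq
      refine ih _ (by simpa [Letter.wt] using hp') (by simpa using hr') ?_ ?_ ?_
      · have hD' : ∀ u ∈ s :: t :: l', u.deg.1 ≤ D := fun u hu => hD u (hperm.mem_iff.mpr hu)
        simpa using hD'
      · simp only [List.map_cons, List.sum_cons]
        rw [hsum] at hl
        omega
      · simp only [List.map_cons, List.sum_cons]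
        rw [hsq, hsum] at hk
        have e1 : T - 1 - s.mode + (T - 1 - t.mode + (l'.map fun t => T - 1 - t.mode).sum) =
          T - 1 - i + (T - 1 - j + (l'.map fun t => T - 1 - t.mode).sum) := by omega
        rw [e1] at hk
        have e2 : (T - 1 - s.mode) ^ 2 + (T - 1 - t.mode) ^ 2 <
            (T - 1 - i) ^ 2 + (T - 1 - j) ^ 2 := by
          have e3 : T - 1 - t.mode = T - 1 - s.mode := hst.symm
          have e4 : j = 2 * s.mode - i := by omega
          have e5 : 0 < (i - s.mode) ^ 2 := by
            have : i - s.mode ≠ 0 := by omega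
            positivity
          rw [e3, e4]
          nlinarith
        push_cast at hk
        linarith
    · exact hneg l hp hD h0

end ContainsShorter

/-- The words which span a module generated by vectors of bounded degree: the letters belong to
finitely many components, and the modes are as small as if they were distinct. -/
theorem word_mem_of_good {F : Finset (ℤ × ℤ × ZMod 2)} (hF : ∀ x ∉ F, C.piece x ≤ C.c2Piece x)
    {T D : ℤ} (hD : ∀ x ∈ F, x.1 ≤ D) {m : M}
    (hT : ∀ x : ℤ × ℤ × ZMod 2, x.1 ≤ D → ∀ a ∈ C.piece x, ∀ n : ℤ, T ≤ n →
      fourierMode N.Y n a m = 0) {X : Submodule ℂ M}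
    (hX : ∀ l : List (Letter C), (∀ t ∈ l, t.deg ∈ F) →
      (l.length : ℤ) * (l.length - 1) ≤ 2 * (l.map fun t => T - 1 - t.mode).sum →
      word N l m ∈ X) (l : List (Letter C)) : word N l m ∈ X := by
  have step : ∀ p r : ℕ, ContainsShorter (C := C) N m p r X →
      ContainsShorter (C := C) N m p (r + 1) X := by
    intro p r h l hl
    by_cases hl' : wordWt l < p ∨ (wordWt l = p ∧ l.length < r)
    · exact h l hl'
    obtain ⟨hp, hr⟩ : wordWt l = p ∧ l.length = r := by omega
    by_cases hlF : ∀ t ∈ l, t.deg ∈ F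
    · by_cases hgood : (r : ℤ) * (r - 1) ≤ 2 * (l.map fun t => T - 1 - t.mode).sum
      · exact hX l hlF (by rwa [hr])
      · exact h.mem_of_sum_lt hT l hp hr (fun t ht => hD _ (hlF t ht)) (not_le.mp hgood)
    · push Not at hlF
      obtain ⟨t, ht, htF⟩ := hlF
      obtain ⟨l₁, l₂, rfl⟩ := List.append_of_mem ht
      exact h.c2_mem hp (hF _ htF t.mem)
  have all : ∀ p r : ℕ, ContainsShorter (C := C) N m p 0 X →
      ContainsShorter (C := C) N m p r X := by
    intro p r h
    induction r with
    | zero => exact h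
    | succ r ih => exact step p r ih
  have zero : ∀ p : ℕ, ContainsShorter (C := C) N m p 0 X := by
    intro p
    induction p with
    | zero => intro l hl; omega
    | succ p ih => exact fun l hl => all p (l.length + 1) ih l (by omega)
  exact zero (wordWt l + 1) l (Or.inl (Nat.lt_succ_self _))

/-- The change of degree effected by a word. -/
def wordDeg (l : List (Letter C)) : ℤ × ℤ × ZMod 2 :=
  (l.map fun t => (t.deg.1 - t.mode - 1, t.deg.2)).sum

theorem word_mem_piece (l : List (Letter C)) {y : ℤ × ℤ × ZMod 2} {m : M} (hm : m ∈ N.piece C y) :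
    word N l m ∈ N.piece C (wordDeg l + y) := by
  induction l with
  | nil => simpa [wordDeg] using hm
  | cons t l ih =>
    rw [word_cons]
    convert SUSYModule.mode_mem_piece t.mem ih t.mode using 2
    refine Prod.ext ?_ ?_
    · simp [wordDeg]
      ring
    · simp [wordDeg, add_assoc]

theorem abs_charge_wordDeg_le {F : Finset (ℤ × ℤ × ZMod 2)} {K : ℤ}
    (hK : ∀ x ∈ F, |x.2.1| ≤ K) (l : List (Letter C)) (hl : ∀ t ∈ l, t.deg ∈ F) :
    |(wordDeg l).2.1| ≤ K * l.length := by
  induction l with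
  | nil => simp [wordDeg]
  | cons t l ih =>
    have h1 := ih fun u hu => hl u (by simp [hu])
    have h2 := hK _ (hl t (by simp))
    have h3 : (wordDeg (t :: l)).2.1 = t.deg.2.1 + (wordDeg l).2.1 := by simp [wordDeg]
    rw [h3, List.length_cons]
    push_cast
    linarith [abs_add_le t.deg.2.1 (wordDeg l).2.1]

theorem le_weight_wordDeg (T : ℤ) (l : List (Letter C)) :
    (l.map fun t => T - 1 - t.mode).sum ≤ (wordDeg l).1 + l.length * T := by
  induction l with
  | nil => simp [wordDeg]
  | cons t l ih =>
    have h3 : (wordDeg (t :: l)).1 = t.deg.1 - t.mode - 1 + (wordDeg l).1 := by simp [wordDeg]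
    have := t.nonneg
    rw [h3, List.map_cons, List.sum_cons, List.length_cons]
    push_cast
    linarith

/-- The charges which occur in weight `n` grow at most like the square root of `n`. -/
theorem exists_charge_bound (hA : A.IsC2Cofinite) (hN : N.IsPositiveEnergy C) :
    ∃ K T : ℕ, ∀ x : ℤ × ℤ × ZMod 2, N.piece C x ≠ ⊥ →
      ∃ r : ℕ, |x.2.1| ≤ K * (r + 1) ∧ (r : ℤ) * (r - 1) ≤ 2 * (x.1 + r * T) := by
  obtain ⟨F, hF⟩ := C.exists_finset_piece_le hA
  obtain ⟨S, hSfin, hS⟩ := exists_finite_generators hA hN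
  obtain ⟨D, hD⟩ : ∃ D : ℕ, ∀ x ∈ F, x.1.natAbs ≤ D ∧ x.2.1.natAbs ≤ D :=
    ⟨F.sup fun x => max x.1.natAbs x.2.1.natAbs, fun x hx => by
      have := Finset.le_sup (f := fun x : ℤ × ℤ × ZMod 2 => max x.1.natAbs x.2.1.natAbs) hx
      exact max_le_iff.mp this⟩
  obtain ⟨E, hE⟩ : ∃ E : ℕ, ∀ s ∈ S, s.1.natAbs ≤ E ∧ s.2.natAbs ≤ E :=
    ⟨hSfin.toFinset.sup fun x => max x.1.natAbs x.2.natAbs, fun x hx => by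
      have := Finset.le_sup (f := fun x : ℤ × ℤ => max x.1.natAbs x.2.natAbs)
        (hSfin.mem_toFinset.mpr hx)
      exact max_le_iff.mp this⟩
  refine ⟨D + E, D + E, fun x hx => ?_⟩
  let good : ℤ × ℤ × ZMod 2 → Set M := fun x => {v | ∃ (y : ℤ × ℤ × ZMod 2) (m : M)
    (l : List (Letter C)), (y.1, y.2.1) ∈ S ∧ 0 ≤ y.1 ∧ m ∈ N.piece C y ∧ (∀ t ∈ l, t.deg ∈ F) ∧
    (l.length : ℤ) * (l.length - 1) ≤ 2 * (l.map fun t => ((D + E : ℕ) : ℤ) - 1 - t.mode).sum ∧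
    wordDeg l + y = x ∧ v = word N l m}
  have hgood : ∀ x, Submodule.span ℂ (good x) ≤ N.piece C x := by
    intro x
    refine Submodule.span_le.mpr ?_
    rintro _ ⟨y, m, l, -, -, hm, -, -, rfl, rfl⟩
    exact word_mem_piece l hm
  have hword : ∀ (y : ℤ × ℤ × ZMod 2) (m : M) (l : List (Letter C)), (y.1, y.2.1) ∈ S →
      m ∈ N.piece C y → word N l m ∈ ⨆ x, Submodule.span ℂ (good x) := by
    intro y m l hy hm
    by_cases hy0 : y.1 < 0
    · rw [hN.piece_neg hy0 hm, map_zero]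
      exact zero_mem _
    refine word_mem_of_good hF (T := (D + E : ℕ)) (D := D) (fun x hx => ?_)
      (fun x hxD a ha n hn => ?_) (fun l hl hlg => ?_) l
    · have := (hD x hx).1
      omega
    · refine hN.mode_eq_zero ha hm ?_
      have := (hE _ hy).1
      dsimp only at this
      omega
    · exact Submodule.mem_iSup_of_mem (wordDeg l + y)
        (Submodule.subset_span ⟨y, m, l, hy, not_lt.mp hy0, hm, hl, hlg, rfl, rfl⟩)
  let W : Submodule ℂ M := Submodule.span ℂ {v | ∃ (y : ℤ × ℤ × ZMod 2) (m : M)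
    (l : List (Letter C)), (y.1, y.2.1) ∈ S ∧ m ∈ N.piece C y ∧ v = word N l m}
  have hWtop : W = ⊤ := by
    refine hS W (fun a n m hm => ?_) fun x hx m hm => Submodule.subset_span ⟨x, m, [], hx, hm, rfl⟩
    refine (Submodule.span_le.mpr ?_ : W ≤ W.comap (fourierMode N.Y n a)) hm
    rintro _ ⟨y, m, l, hy, hm, rfl⟩
    refine C.mem_of_pieces (X := W.comap (LinearMap.applyₗ (word N l m) ∘ₗ fourierMode N.Y n))
      (fun x a ha => ?_) a
    by_cases hx0 : x.1 < 0
    · rw [C.piece_neg hx0 ha]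
      exact zero_mem _
    · exact Submodule.subset_span ⟨y, m, ⟨x, a, n, ha, not_lt.mp hx0⟩ :: l, hy, hm, by simp⟩
  have htop : ∀ v : M, v ∈ ⨆ x, Submodule.span ℂ (good x) := by
    have : W ≤ ⨆ x, Submodule.span ℂ (good x) := by
      refine Submodule.span_le.mpr ?_
      rintro _ ⟨y, m, l, hy, hm, rfl⟩
      exact hword y m l hy hm
    exact fun v => this (hWtop ▸ Submodule.mem_top)
  obtain ⟨v, hv, hv0⟩ := Submodule.exists_mem_ne_zero_of_ne_bot hx
  have hvx := (IntegrabilityConditions.internal hN).submodule_iSupIndep.mem_of_mem_iSup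
    hgood hv (htop v)
  obtain ⟨w, hw⟩ : (good x).Nonempty := by
    rw [Set.nonempty_iff_ne_empty]
    intro h0
    rw [h0, Submodule.span_empty, Submodule.mem_bot] at hvx
    exact hv0 hvx
  obtain ⟨y, m, l, hy, hy0, hm, hl, hlg, rfl, -⟩ := hw
  refine ⟨l.length, ?_, ?_⟩
  · have h1 := abs_charge_wordDeg_le (K := D) (fun x hx => by
      have := (hD x hx).2
      rw [Int.abs_eq_natAbs]
      exact_mod_cast this) l hl
    have h2 : |y.2.1| ≤ E := by
      rw [Int.abs_eq_natAbs]
      exact_mod_cast (hE _ hy).2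
    have h3 := abs_add_le (wordDeg l).2.1 y.2.1
    simp only [Prod.snd_add, Prod.fst_add]
    push_cast
    have h4 : (0 : ℤ) ≤ D := Nat.cast_nonneg _
    have h5 : (0 : ℤ) ≤ E * l.length := by positivity
    nlinarith
  · have h1 := le_weight_wordDeg ((D + E : ℕ) : ℤ) l
    simp only [Prod.fst_add]
    linarith

end Words

/-! ### Supertraces of graded operators -/

section BlockTrace

variable {ι E : Type*} [DecidableEq ι] [AddCommGroup E] [Module ℂ E] {W : ι → Submodule ℂ E}

/-- The trace of the diagonal block, as a linear functional. -/
noncomputable def blockTraceHom (hW : DirectSum.IsInternal W) (x : ι) : Module.End ℂ E →ₗ[ℂ] ℂ where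
  toFun X := blockTrace hW X x
  map_add' X Y := by
    simp only [blockTrace, LinearMap.add_comp, LinearMap.comp_add, map_add]
  map_smul' c X := by
    simp only [blockTrace, LinearMap.smul_comp, LinearMap.comp_smul, map_smul, RingHom.id_apply]

theorem component_internalDecomp (hW : DirectSum.IsInternal W) {x y : ι} {v : E} (hv : v ∈ W y) :
    DirectSum.component ℂ ι (fun i => W i) x (internalDecomp hW v) =
      if h : y = x then ⟨v, h ▸ hv⟩ else 0 := by
  rw [internalDecomp_of_mem hW y hv]
  split_ifs with h
  · subst h
    exact DirectSum.component.lof_self ..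
  · rw [DirectSum.component.of, dif_neg h]

theorem blockTrace_congr (hW : DirectSum.IsInternal W) {X Y : Module.End ℂ E} {x : ι}
    (h : ∀ v ∈ W x, X v = Y v) : blockTrace hW X x = blockTrace hW Y x := by
  rw [blockTrace, blockTrace]
  congr 3
  ext v
  exact h v v.2

theorem blockTrace_eq_zero_of_mapsTo (hW : DirectSum.IsInternal W) {X : Module.End ℂ E} {x y : ι}
    (hxy : y ≠ x) (h : ∀ v ∈ W x, X v ∈ W y) : blockTrace hW X x = 0 := by
  have h0 : DirectSum.component ℂ ι (fun i => W i) x ∘ₗ (internalDecomp hW).toLinearMap ∘ₗ X ∘ₗ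
      (W x).subtype = 0 := by
    ext v
    simp [component_internalDecomp hW (h v v.2), hxy]
  rw [blockTrace, h0, map_zero]

theorem blockTrace_eq_zero_of_eq_bot (hW : DirectSum.IsInternal W) (X : Module.End ℂ E) {x : ι}
    (h : W x = ⊥) : blockTrace hW X x = 0 := by
  rw [blockTrace_congr hW (Y := 0)]
  · exact map_zero (blockTraceHom hW x)
  · intro v hv
    rw [h, Submodule.mem_bot] at hv
    simp [hv]

/-- Cyclicity of the trace for operators which permute the components of a direct sum. -/
theorem blockTrace_mul_comm (hW : DirectSum.IsInternal W) {x y : ι} [FiniteDimensional ℂ (W x)]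
    [FiniteDimensional ℂ (W y)] {X Y : Module.End ℂ E} (hX : ∀ v ∈ W x, X v ∈ W y)
    (hY : ∀ v ∈ W y, Y v ∈ W x) : blockTrace hW (X * Y) y = blockTrace hW (Y * X) x := by
  have h : ∀ {x y : ι} {X Y : Module.End ℂ E} (hX : ∀ v ∈ W x, X v ∈ W y)
      (hY : ∀ v ∈ W y, Y v ∈ W x),
      blockTrace hW (X * Y) y = LinearMap.trace ℂ (W y) (X.restrict hX ∘ₗ Y.restrict hY) := by
    intro x y X Y hX hY
    rw [blockTrace]
    congr 1
    ext v
    simp [component_internalDecomp hW (hX _ (hY v v.2)), LinearMap.restrict_apply]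
  rw [h hX hY, h hY hX, LinearMap.trace_comp_comm']

end BlockTrace

section Series

open PowerSeries

variable {V M : Type*} [AddCommGroup V] [Module ℂ V] [AddCommGroup M] [Module ℂ M]
  {A : SUSYVertexAlgebra V} {C : ConformalStructure A} {N : SUSYModule A M}

theorem SUSYModule.IsPositiveEnergy.finiteDimensional (hN : N.IsPositiveEnergy C)
    (x : ℤ × ℤ × ZMod 2) : FiniteDimensional ℂ (N.piece C x) :=
  have := IntegrabilityConditions.finite hN x.1 x.2.1
  Submodule.finiteDimensional_of_le (inf_le_left : N.piece C x ≤ _)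

/-- The supertrace of the diagonal block of `X` on the vectors of weight `n` and charge `k`. -/
noncomputable def blockSupertrace (hN : N.IsPositiveEnergy C) (n k : ℤ) : Module.End ℂ M →ₗ[ℂ] ℂ :=
  blockTraceHom hN.internal (n, k, 0) - blockTraceHom hN.internal (n, k, 1)

theorem supertraceCoeff_eq (hN : N.IsPositiveEnergy C) (a : V) (n k : ℤ) :
    supertraceCoeff hN a n k = blockSupertrace hN n k (zeroMode C N a) := rfl

variable (C N) in
/-- The operator `X` changes the degree by `δ`. -/
def HasDegree (X : Module.End ℂ M) (δ : ℤ × ℤ × ZMod 2) : Prop :=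
  ∀ y, ∀ m ∈ N.piece C y, X m ∈ N.piece C (δ + y)

theorem hasDegree_mode {x : ℤ × ℤ × ZMod 2} {a : V} (ha : a ∈ C.piece x) (n : ℤ) :
    HasDegree C N (fourierMode N.Y n a) (x.1 - n - 1, x.2) := by
  intro y m hm
  convert SUSYModule.mode_mem_piece ha hm n using 2
  ext <;> simp
  ring

theorem HasDegree.mul {X Y : Module.End ℂ M} {δ δ' : ℤ × ℤ × ZMod 2} (hX : HasDegree C N X δ)
    (hY : HasDegree C N Y δ') : HasDegree C N (X * Y) (δ + δ') := fun y m hm => by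
  rw [add_assoc]
  exact hX _ _ (hY y m hm)

variable {hN : N.IsPositiveEnergy C}

theorem HasDegree.blockSupertrace_eq_zero {X : Module.End ℂ M} {δ : ℤ × ℤ × ZMod 2}
    (hX : HasDegree C N X δ) (hδ : δ ≠ 0) (n k : ℤ) : blockSupertrace hN n k X = 0 := by
  have h : ∀ i, blockTrace hN.internal X (n, k, i) = 0 := fun i =>
    blockTrace_eq_zero_of_mapsTo hN.internal (y := δ + (n, k, i)) (by simpa using hδ)
      (fun v hv => hX _ v hv)
  change blockTrace hN.internal X (n, k, 0) - blockTrace hN.internal X (n, k, 1) = 0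
  rw [h, h, sub_zero]

theorem blockSupertrace_congr {X Y : Module.End ℂ M} {n k : ℤ}
    (h : ∀ i, ∀ m ∈ N.piece C (n, k, i), X m = Y m) :
    blockSupertrace hN n k X = blockSupertrace hN n k Y :=
  congrArg₂ (· - ·) (blockTrace_congr hN.internal (h 0)) (blockTrace_congr hN.internal (h 1))

theorem blockSupertrace_eq_zero_of_eq_bot (X : Module.End ℂ M) {n k : ℤ}
    (h : ∀ i, N.piece C (n, k, i) = ⊥) : blockSupertrace hN n k X = 0 := by
  change blockTrace hN.internal X (n, k, 0) - blockTrace hN.internal X (n, k, 1) = 0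
  rw [blockTrace_eq_zero_of_eq_bot hN.internal X (h 0),
    blockTrace_eq_zero_of_eq_bot hN.internal X (h 1), sub_zero]

theorem blockSupertrace_eq_zero_of_neg (X : Module.End ℂ M) {n : ℤ} (hn : n < 0) (k : ℤ) :
    blockSupertrace hN n k X = 0 :=
  blockSupertrace_eq_zero_of_eq_bot X fun i =>
    (Submodule.eq_bot_iff _).mpr fun _ hm => hN.piece_neg (x := (n, k, i)) hn hm

/-- Cyclicity of the supertrace. -/
theorem HasDegree.blockSupertrace_mul_comm {X Y : Module.End ℂ M} {d e : ℤ} {i : ZMod 2}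
    (hX : HasDegree C N X (d, e, i)) (hY : HasDegree C N Y (-(d, e, i))) (n k : ℤ) :
    blockSupertrace hN n k (X * Y) =
      koszulSign i i * blockSupertrace hN (n - d) (k - e) (Y * X) := by
  have h : ∀ l, blockTrace hN.internal (X * Y) (n, k, l) =
      blockTrace hN.internal (Y * X) (n - d, k - e, l - i) := by
    intro l
    have := hN.finiteDimensional (n, k, l)
    have := hN.finiteDimensional (n - d, k - e, l - i)
    refine blockTrace_mul_comm hN.internal (fun v hv => ?_) (fun v hv => ?_)
    · convert hX _ v hv using 2
      ext <;> simp
    · convert hY _ v hv using 2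
      refine Prod.ext ?_ (Prod.ext ?_ ?_) <;> simp [sub_eq_neg_add]
  change blockTrace hN.internal (X * Y) (n, k, 0) - blockTrace hN.internal (X * Y) (n, k, 1) =
    koszulSign i i * (blockTrace hN.internal (Y * X) (n - d, k - e, 0) -
      blockTrace hN.internal (Y * X) (n - d, k - e, 1))
  rw [h, h]
  fin_cases i
  · have e1 : ∀ l : ZMod 2, l - 0 = l := sub_zero
    change blockTrace hN.internal (Y * X) (n - d, k - e, 0 - 0) -
      blockTrace hN.internal (Y * X) (n - d, k - e, 1 - 0) = koszulSign 0 0 * _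
    rw [e1, e1]
    simp [koszulSign]
  · have e1 : (0 : ZMod 2) - 1 = 1 := by decide
    have e2 : (1 : ZMod 2) - 1 = 0 := by decide
    change blockTrace hN.internal (Y * X) (n - d, k - e, 0 - 1) -
      blockTrace hN.internal (Y * X) (n - d, k - e, 1 - 1) = koszulSign 1 1 * _
    rw [e1, e2]
    simp [koszulSign, ZMod.val_one]

variable {B : Type*} [CommRing B] [Algebra ℂ B]

variable (C N) in
/-- Each weight space contains only finitely many charges. -/
def FiniteCharges : Prop :=
  ∀ n : ℤ, {k : ℤ | ∃ i, N.piece C (n, k, i) ≠ ⊥}.Finite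

theorem FiniteCharges.support_finite (hfin : FiniteCharges C N) (hN : N.IsPositiveEnergy C)
    (Y : Bˣ) (X : Module.End ℂ M)
    (n : ℤ) : (Function.support fun k : ℤ =>
      blockSupertrace hN n k X • ((Y ^ k : Bˣ) : B)).Finite := by
  refine (hfin n).subset fun k hk => ?_
  by_contra h
  simp only [Set.mem_ofPred_eq, not_exists, not_not] at h
  exact hk (by simp [blockSupertrace_eq_zero_of_eq_bot X h])

/-- The series `str X q^{L_0} Y^{J_0} = ∑_n (∑_k str(X |_{n, k}) Y^k) q^n`. The parameter `Y` is an
invertible element of an algebra `B`, for example a function with values in the unit circle. -/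
noncomputable def supertraceSeries (hN : N.IsPositiveEnergy C) (hfin : FiniteCharges C N)
    (Y : Bˣ) : Module.End ℂ M →ₗ[ℂ] B⟦X⟧ where
  toFun X := PowerSeries.mk fun n => ∑ᶠ k : ℤ, blockSupertrace hN n k X • ((Y ^ k : Bˣ) : B)
  map_add' X X' := by
    ext n
    simp only [coeff_mk, map_add, add_smul]
    exact finsum_add_distrib (hfin.support_finite hN Y X n) (hfin.support_finite hN Y X' n)
  map_smul' c X := by
    ext n
    simp only [coeff_mk, map_smul, smul_eq_mul, mul_smul, RingHom.id_apply, coeff_smul]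
    exact (smul_finsum' c (hfin.support_finite hN Y X n)).symm

variable (hN) (hfin : FiniteCharges C N) (Y : Bˣ)

theorem coeff_supertraceSeries (X : Module.End ℂ M) (n : ℕ) :
    coeff n (supertraceSeries hN hfin Y X) =
      ∑ᶠ k : ℤ, blockSupertrace hN n k X • ((Y ^ k : Bˣ) : B) := by
  simp [supertraceSeries]

theorem coeff_supertraceSeries_congr {X X' : Module.End ℂ M} {n : ℕ}
    (h : ∀ y : ℤ × ℤ × ZMod 2, y.1 = n → ∀ m ∈ N.piece C y, X m = X' m) :
    coeff n (supertraceSeries hN hfin Y X) = coeff n (supertraceSeries hN hfin Y X') := by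
  rw [coeff_supertraceSeries, coeff_supertraceSeries]
  exact finsum_congr fun k => by rw [blockSupertrace_congr fun i => h (n, k, i) rfl]

theorem HasDegree.supertraceSeries_eq_zero {X : Module.End ℂ M} {δ : ℤ × ℤ × ZMod 2}
    (hX : HasDegree C N X δ) (hδ : δ ≠ 0) : supertraceSeries hN hfin Y X = 0 := by
  ext n
  rw [coeff_supertraceSeries, map_zero]
  exact finsum_eq_zero_of_forall_eq_zero fun k => by
    rw [hX.blockSupertrace_eq_zero hδ, zero_smul]

/-- `str(X Z g) = ± Y^e q^d str(Z X g)` for `g = q^{L_0} Y^{J_0}` and an operator `X` which raises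
the weight by `d` and the charge by `e`. -/
theorem HasDegree.supertraceSeries_mul_comm {X Z : Module.End ℂ M} {d : ℕ} {e : ℤ} {i : ZMod 2}
    (hX : HasDegree C N X (d, e, i)) (hZ : HasDegree C N Z (-((d : ℤ), e, i))) :
    supertraceSeries hN hfin Y (X * Z) = koszulSign i i •
      (PowerSeries.C ((Y ^ e : Bˣ) : B) * PowerSeries.X ^ d *
        supertraceSeries hN hfin Y (Z * X)) := by
  ext n
  rw [coeff_smul, mul_assoc, coeff_C_mul, coeff_X_pow_mul', coeff_supertraceSeries]
  simp only [hX.blockSupertrace_mul_comm hZ]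
  split_ifs with hn
  · have hf := hfin.support_finite hN Y (Z * X) (n - d : ℕ)
    rw [coeff_supertraceSeries, mul_finsum' _ _ hf, smul_finsum' _ (hf.subset fun k hk => ?_),
      ← finsum_comp_equiv (Equiv.addRight e)]
    · refine finsum_congr fun k => ?_
      rw [Equiv.coe_addRight, mul_smul_comm, ← Units.val_mul, ← zpow_add, add_sub_cancel_right,
        mul_smul, Nat.cast_sub hn, add_comm e k]
    · exact fun h => hk (by simp only [h, mul_zero])
  · rw [mul_zero, smul_zero]
    refine finsum_eq_zero_of_forall_eq_zero fun k => ?_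
    rw [blockSupertrace_eq_zero_of_neg _ (by omega), mul_zero, zero_smul]

end Series

/-! ### Lambert series and convergent power series -/

section ConvergentSeries

open PowerSeries

section

variable {B : Type*} [CommRing B]

/-- The expansion of `∑_{i > 0} Y^{e i} q^{d i}`. -/
noncomputable def geometricTail (Y : Bˣ) (d : ℕ) (e : ℤ) : B⟦X⟧ :=
  PowerSeries.mk fun n => if n ≠ 0 ∧ d ∣ n then ((Y ^ (e * (n / d : ℕ)) : Bˣ) : B) else 0

theorem coeff_one_add_geometricTail (Y : Bˣ) {d : ℕ} (hd : d ≠ 0) (e : ℤ) (k : ℕ) :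
    coeff (d * k) (1 + geometricTail Y d e) = ((Y ^ (e * k) : Bˣ) : B) := by
  rw [map_add, coeff_one, geometricTail, coeff_mk]
  rcases eq_or_ne k 0 with rfl | hk
  · simp
  · rw [if_neg (Nat.mul_ne_zero hd hk), if_pos ⟨Nat.mul_ne_zero hd hk, dvd_mul_right d k⟩, zero_add,
      Nat.mul_div_cancel_left k (Nat.pos_of_ne_zero hd)]

theorem coeff_one_add_geometricTail_of_not_dvd (Y : Bˣ) {d n : ℕ} (h : ¬ d ∣ n) (e : ℤ) :
    coeff n (1 + geometricTail Y d e) = 0 := by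
  have hn : n ≠ 0 := fun h0 => h (h0 ▸ dvd_zero d)
  rw [map_add, coeff_one, geometricTail, coeff_mk, if_neg hn, if_neg fun h' => h h'.2, add_zero]

theorem mul_one_add_geometricTail (Y : Bˣ) {d : ℕ} (hd : d ≠ 0) (e : ℤ) :
    PowerSeries.C ((Y ^ e : Bˣ) : B) * PowerSeries.X ^ d * (1 + geometricTail Y d e) =
      geometricTail Y d e := by
  have h : ∀ n, n ≠ 0 → coeff n (geometricTail Y d e) = coeff n (1 + geometricTail Y d e) := by
    intro n hn
    rw [map_add, coeff_one, if_neg hn, zero_add]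
  ext n
  rw [mul_assoc, coeff_C_mul, coeff_X_pow_mul']
  by_cases hdn : d ∣ n
  · obtain ⟨k, rfl⟩ := hdn
    rcases k with _ | k
    · simp [hd, geometricTail]
    · rw [h _ (Nat.mul_ne_zero hd k.succ_ne_zero), if_pos (Nat.le_mul_of_pos_right d k.succ_pos),
        coeff_one_add_geometricTail Y hd, mul_add_one, Nat.add_sub_cancel,
        coeff_one_add_geometricTail Y hd, ← Units.val_mul, ← zpow_add]
      congr 2
      push_cast
      ring
  · rw [h n (fun h0 => hdn (h0 ▸ dvd_zero d)), coeff_one_add_geometricTail_of_not_dvd Y hdn]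
    split_ifs with hn
    · rw [coeff_one_add_geometricTail_of_not_dvd Y (fun h' => hdn ?_), mul_zero]
      exact (Nat.dvd_sub_iff_left hn dvd_rfl).mp h'
    · rw [mul_zero]

/-- The expansion of `∑_{d > 0} κ(d) ∑_{i > 0} Y^{e i} q^{d i}`. -/
noncomputable def lambertSeries (Y : Bˣ) (e : ℤ) (κ : ℕ → ℤ) : B⟦X⟧ :=
  PowerSeries.mk fun n => ∑ d ∈ n.divisors, κ d • ((Y ^ (e * (n / d : ℕ)) : Bˣ) : B)

theorem coeff_lambertSeries (Y : Bˣ) (e : ℤ) (κ : ℕ → ℤ) {n L : ℕ} (h : n ≤ L) :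
    coeff n (lambertSeries Y e κ) =
      coeff n (∑ s ∈ Finset.range L, κ (s + 1) • geometricTail Y (s + 1) e) := by
  have h1 : n.divisors ⊆ Finset.Ico 1 (L + 1) := fun d hd =>
    Finset.mem_Ico.mpr ⟨Nat.pos_of_mem_divisors hd, Nat.lt_succ_of_le ((Nat.divisor_le hd).trans h)⟩
  have h2 : ∀ d, coeff n (geometricTail Y d e) =
      if d ∈ n.divisors then ((Y ^ (e * (n / d : ℕ)) : Bˣ) : B) else 0 := fun d => by
    rw [geometricTail, coeff_mk]
    simp only [Nat.mem_divisors, and_comm]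
  have h3 : ∑ d ∈ Finset.Ico 1 (L + 1), κ d • coeff n (geometricTail Y d e) =
      coeff n (∑ s ∈ Finset.range L, κ (s + 1) • geometricTail Y (s + 1) e) := by
    rw [Finset.sum_Ico_eq_sum_range, map_sum, Nat.add_sub_cancel]
    exact Finset.sum_congr rfl fun s _ => by rw [add_comm 1 s, map_zsmul]
  rw [lambertSeries, coeff_mk, ← h3]
  refine Finset.sum_subset_zero_on_sdiff h1 (fun d hd => ?_) (fun d hd => ?_)
  · rw [h2, if_neg (Finset.mem_sdiff.mp hd).2, smul_zero]
  · rw [h2, if_pos hd]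

theorem coeff_lambertSeries_mul (Y : Bˣ) (e : ℤ) (κ : ℕ → ℤ) {n L : ℕ} (h : n ≤ L) (f : B⟦X⟧) :
    coeff n (lambertSeries Y e κ * f) =
      coeff n ((∑ s ∈ Finset.range L, κ (s + 1) • geometricTail Y (s + 1) e) * f) := by
  rw [coeff_mul, coeff_mul]
  refine Finset.sum_congr rfl fun p hp => ?_
  rw [coeff_lambertSeries Y e κ ((Finset.HasAntidiagonal.antidiagonal.fst_le hp).trans h)]

end

theorem norm_coeff_mul_le {B : Type*} [NormedCommRing B] {ρ : ℝ} (hρ : 0 ≤ ρ) (f g : B⟦X⟧) (n : ℕ) :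
    ‖coeff n (f * g)‖ * ρ ^ n ≤ ∑ p ∈ Finset.HasAntidiagonal.antidiagonal n,
      (‖coeff p.1 f‖ * ρ ^ p.1) * (‖coeff p.2 g‖ * ρ ^ p.2) := by
  rw [coeff_mul]
  calc _ ≤ (∑ p ∈ Finset.HasAntidiagonal.antidiagonal n, ‖coeff p.1 f‖ * ‖coeff p.2 g‖) * ρ ^ n :=
        mul_le_mul_of_nonneg_right ((norm_sum_le _ _).trans
          (Finset.sum_le_sum fun _ _ => norm_mul_le _ _)) (by positivity)
    _ = _ := by
        rw [Finset.sum_mul]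
        refine Finset.sum_congr rfl fun p hp => ?_
        rw [← Finset.HasAntidiagonal.mem_antidiagonal.mp hp, pow_add]
        ring

variable {B : Type*} [NormedCommRing B] [NormedAlgebra ℂ B]

variable (B) in
/-- The power series with coefficients in `B` which converge absolutely on the closed disc of
radius `ρ`. -/
def convergentSeries {ρ : ℝ} (hρ : 0 ≤ ρ) : Subalgebra ℂ B⟦X⟧ where
  carrier := {f | Summable fun n => ‖coeff n f‖ * ρ ^ n}
  add_mem' {f g} hf hg := by
    refine Summable.of_nonneg_of_le (fun n => by positivity) (fun n => ?_) (hf.add hg)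
    rw [map_add, ← add_mul]
    exact mul_le_mul_of_nonneg_right (norm_add_le _ _) (by positivity)
  mul_mem' {f g} hf hg := by
    have h := summable_norm_sum_mul_antidiagonal_of_summable_norm hf.norm hg.norm
    refine Summable.of_nonneg_of_le (fun n => by positivity) (fun n => ?_) h
    rw [Real.norm_of_nonneg (Finset.sum_nonneg fun _ _ => by positivity)]
    exact norm_coeff_mul_le hρ f g n
  algebraMap_mem' c := by
    refine summable_of_ne_finset_zero (s := {0}) fun n hn => ?_
    rw [Finset.mem_singleton] at hn
    rw [PowerSeries.algebraMap_apply, coeff_C, if_neg hn, norm_zero, zero_mul]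

/-- A function which grows at most polynomially. -/
def PolynomiallyBounded (κ : ℕ → ℤ) : Prop :=
  ∃ a j : ℕ, ∀ d : ℕ, |κ d| ≤ ((d : ℤ) + a) ^ j

theorem lambertSeries_mem {ρ : ℝ} (hρ : 0 ≤ ρ) (hρ1 : ρ < 1) {Y : Bˣ}
    (hY : ∀ k : ℤ, ‖((Y ^ k : Bˣ) : B)‖ ≤ 1) (e : ℤ) {κ : ℕ → ℤ} (hκ : PolynomiallyBounded κ) :
    lambertSeries Y e κ ∈ convergentSeries B hρ := by
  obtain ⟨a, j, hκ⟩ := hκ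
  have hs := (summable_pow_mul_geometric_of_norm_lt_one (j + 1)
    (r := ρ) (by rwa [Real.norm_of_nonneg hρ])).mul_left (((1 : ℝ) + a) ^ j)
  refine Summable.of_nonneg_of_le (fun n => by positivity) (fun n => ?_) hs
  rw [← mul_assoc]
  refine mul_le_mul_of_nonneg_right ?_ (by positivity)
  rw [lambertSeries, coeff_mk]
  have hd : ∀ d ∈ n.divisors, ‖κ d • ((Y ^ (e * (n / d : ℕ)) : Bˣ) : B)‖ ≤
      ((1 + a) * n : ℝ) ^ j := by
    intro d hd
    have h1 : (d : ℝ) ≤ n := by exact_mod_cast Nat.divisor_le hd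
    have h2 : (1 : ℝ) ≤ n := by
      exact_mod_cast Nat.pos_of_ne_zero (Nat.mem_divisors.mp hd).2
    calc _ ≤ ‖κ d‖ * ‖((Y ^ (e * (n / d : ℕ)) : Bˣ) : B)‖ := norm_zsmul_le ..
      _ ≤ ‖κ d‖ := mul_le_of_le_one_right (norm_nonneg _) (hY _)
      _ ≤ ((d : ℝ) + a) ^ j := by
          rw [Int.norm_eq_abs]
          exact_mod_cast hκ d
      _ ≤ ((1 + a) * n : ℝ) ^ j := by
          gcongr
          nlinarith [mul_nonneg (Nat.cast_nonneg (α := ℝ) a) (sub_nonneg.mpr h2)]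
  calc _ ≤ n.divisors.card • ((1 + a) * n : ℝ) ^ j :=
        (norm_sum_le _ _).trans (Finset.sum_le_card_nsmul _ _ _ hd)
    _ ≤ n * ((1 + a) * n : ℝ) ^ j := by
        rw [nsmul_eq_mul]
        gcongr
        exact Nat.card_divisors_le_self n
    _ = _ := by
        rw [mul_pow]
        ring

theorem geometricTail_mem {ρ : ℝ} (hρ : 0 ≤ ρ) (hρ1 : ρ < 1) {Y : Bˣ}
    (hY : ∀ k : ℤ, ‖((Y ^ k : Bˣ) : B)‖ ≤ 1) (d : ℕ) (e : ℤ) :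
    geometricTail Y d e ∈ convergentSeries B hρ := by
  refine Summable.of_nonneg_of_le (fun n => by positivity) (fun n => ?_)
    (summable_geometric_of_lt_one hρ hρ1)
  refine mul_le_of_le_one_left (by positivity) ?_
  rw [geometricTail, coeff_mk]
  split_ifs
  · exact hY _
  · simp

theorem polynomiallyBounded_choose (d j : ℕ) :
    PolynomiallyBounded fun D => Ring.choose ((d : ℤ) + D) j := by
  refine ⟨d, j, fun D => ?_⟩
  dsimp only
  rw [show (d : ℤ) + D = ((d + D : ℕ) : ℤ) by push_cast; rfl, Ring.choose_natCast, Nat.abs_cast]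
  have := Nat.choose_le_pow (d + D) j
  calc (((d + D).choose j : ℕ) : ℤ) ≤ ((d + D) ^ j : ℕ) := by exact_mod_cast this
    _ = _ := by push_cast; ring

theorem polynomiallyBounded_choose_neg (d j : ℕ) :
    PolynomiallyBounded fun D => if d < D then Ring.choose ((d : ℤ) - D) j else 0 := by
  refine ⟨j, j, fun D => ?_⟩
  dsimp only
  split_ifs with h
  · obtain ⟨s, rfl⟩ := Nat.exists_eq_add_of_lt h
    have e1 : (d : ℤ) - (d + s + 1 : ℕ) = -((s + 1 : ℕ) : ℤ) := by push_cast; ring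
    have e2 : ((s + 1 : ℕ) : ℤ) + j - 1 = ((s + j : ℕ) : ℤ) := by push_cast; ring
    rw [e1, Ring.choose_neg, e2, Ring.choose_natCast, Units.smul_def, smul_eq_mul, abs_mul,
      Int.isUnit_iff_abs_eq.mp (Units.isUnit _), one_mul, Nat.abs_cast]
    calc (((s + j).choose j : ℕ) : ℤ) ≤ ((s + j) ^ j : ℕ) := by
          exact_mod_cast Nat.choose_le_pow (s + j) j
      _ ≤ _ := by
          push_cast
          gcongr
          omega
  · simp only [abs_zero]
    positivity

end ConvergentSeries

/-! ### The recursion for supertraces of zero modes -/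

section Recursion

open PowerSeries

variable {V M : Type*} [AddCommGroup V] [Module ℂ V] [AddCommGroup M] [Module ℂ M]
  {A : SUSYVertexAlgebra V} {C : ConformalStructure A} {N : SUSYModule A M}

theorem koszulSign_mul_self (i j : ZMod 2) : koszulSign i j * koszulSign i j = 1 := by
  rw [koszulSign, ← mul_pow]
  simp

/-- Up to `q^n`, a sum over modes of weighted geometric series is a Lambert series. -/
theorem coeff_sum_geometricTail_mul {B : Type*} [CommRing B] (Y : Bˣ) (e : ℤ) (κ : ℕ → ℕ → ℤ)
    (S : ℕ → B⟦X⟧) (J : ℕ) {n L : ℕ}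
    (h : n ≤ L) : coeff n (∑ s ∈ Finset.range L, geometricTail Y (s + 1) e *
        ∑ j ∈ Finset.range J, κ j (s + 1) • S j) =
      coeff n (∑ j ∈ Finset.range J, lambertSeries Y e (κ j) * S j) := by
  simp only [map_sum (coeff n), coeff_lambertSeries_mul Y e _ h]
  simp only [← map_sum (coeff n), Finset.sum_mul, Finset.mul_sum]
  rw [Finset.sum_comm]
  simp only [smul_mul_assoc, mul_smul_comm]

/-- The formula for `o(a_(-1) b)` given by the Borcherds identity, on vectors of weight `n`. -/
theorem zeroMode_neg_one_apply (hN : N.IsPositiveEnergy C) {x z : ℤ × ℤ × ZMod 2} {a b : V}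
    (ha : a ∈ C.piece x) (hb : b ∈ C.piece z) {d : ℕ} (hd : x.1 = d + 1) {n : ℕ}
    {y : ℤ × ℤ × ZMod 2} (hy : y.1 = n) {m : M} (hm : m ∈ N.piece C y) :
    zeroMode C N (fourierMode A.Y (-1) a b) m =
      (∑ s ∈ Finset.range (d + 1 + n),
        (fourierMode N.Y (-1 - s) a * fourierMode N.Y (x.1 + z.1 - 1 + s) b +
          koszulSign x.2.2 z.2.2 •
            (fourierMode N.Y (x.1 + z.1 - 1 - 1 - s) b * fourierMode N.Y s a))) m := by
  rw [zeroMode_mode ha hb, show x.1 + z.1 - (-1) - 2 = x.1 + z.1 - 1 by ring,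
    N.mode_neg_one (C.mem_par ha) (C.mem_par hb) _ m (K := d + 1 + n)
      (fun s hs => hN.mode_eq_zero ha hm (by omega))
      (fun s hs => hN.mode_eq_zero hb hm (by omega)), LinearMap.sum_apply]
  rfl

section Algebra

variable {B : Type*} [CommRing B] [Algebra ℂ B] (hN : N.IsPositiveEnergy C)
  (hfin : FiniteCharges C N) (Y : Bˣ)

/-- `str(Z X g)` for an operator `X` which raises the weight is determined by the supertrace of the
supercommutator of `X` and `Z`. -/
theorem HasDegree.supertraceSeries_mul_of_raising' {X Z : Module.End ℂ M} {d : ℕ} (hd : d ≠ 0)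
    {e : ℤ} {i : ZMod 2} (hX : HasDegree C N X (d, e, i))
    (hZ : HasDegree C N Z (-((d : ℤ), e, i))) :
    koszulSign i i • supertraceSeries hN hfin Y (Z * X) =
      -((1 + geometricTail Y d e) * supertraceSeries hN hfin Y (superComm i i X Z)) := by
  have h1 := mul_one_add_geometricTail Y hd e
  rw [superComm, map_sub, map_smul, hX.supertraceSeries_mul_comm hN hfin Y hZ]
  simp only [Algebra.smul_def]
  linear_combination (algebraMap ℂ B⟦X⟧ (koszulSign i i) *
    supertraceSeries hN hfin Y (Z * X)) * h1

theorem HasDegree.supertraceSeries_mul_of_raising {X Z : Module.End ℂ M} {d : ℕ} (hd : d ≠ 0)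
    {e : ℤ} {i : ZMod 2} (hX : HasDegree C N X (d, e, i))
    (hZ : HasDegree C N Z (-((d : ℤ), e, i))) :
    supertraceSeries hN hfin Y (X * Z) =
      -(geometricTail Y d e * supertraceSeries hN hfin Y (superComm i i X Z)) := by
  have h1 := hX.supertraceSeries_mul_of_raising' hN hfin Y hd hZ
  have h2 : supertraceSeries hN hfin Y (superComm i i X Z) = supertraceSeries hN hfin Y (X * Z) -
      koszulSign i i • supertraceSeries hN hfin Y (Z * X) := by
    rw [superComm, map_sub, map_smul]
  linear_combination -h2 + h1

theorem HasDegree.supertraceSeries_mul_of_lowering {X Z : Module.End ℂ M} {d : ℕ} (hd : d ≠ 0)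
    {e : ℤ} {i : ZMod 2} (hX : HasDegree C N X (-(d : ℤ), e, i))
    (hZ : HasDegree C N Z (d, -e, -i)) :
    koszulSign i i • supertraceSeries hN hfin Y (Z * X) =
      geometricTail Y d (-e) * supertraceSeries hN hfin Y (superComm i i X Z) := by
  have hi : -i = i := ZModModule.neg_eq_self i
  have h1 := HasDegree.supertraceSeries_mul_of_raising hN hfin Y hd hZ
    (by convert hX using 1; simp)
  rw [hi] at h1
  have h2 : superComm i i Z X = -koszulSign i i • superComm i i X Z := by
    rw [superComm, superComm, smul_sub, smul_smul, neg_mul, koszulSign_mul_self]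
    module
  rw [h1, h2, map_smul]
  simp only [neg_smul, mul_neg, mul_smul_comm, smul_smul, koszulSign_mul_self, one_smul, neg_neg]

/-- The supercommutators of modes of complementary weights are combinations of zero modes. -/
theorem superComm_mode {x z : ℤ × ℤ × ZMod 2} {a b : V} (ha : a ∈ C.piece x) (hb : b ∈ C.piece z)
    {p q : ℤ} (hpq : p + q = x.1 + z.1 - 2) :
    superComm x.2.2 z.2.2 (fourierMode N.Y p a) (fourierMode N.Y q b) =
      ∑ j ∈ Finset.range (x.1 + z.1).toNat,
        Ring.choose p j • zeroMode C N (fourierMode A.Y j a b) := by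
  ext m
  have h := N.commutator_formula (C.mem_par ha) (C.mem_par hb) (K := (x.1 + z.1).toNat)
    (fun k hk => C.mode_eq_zero ha hb (by omega)) p q m
  have h3 : ∀ k : ℕ, p + q - k = x.1 + z.1 - k - 2 := fun k => by omega
  simp only [h3, ← zeroMode_mode (N := N) ha hb] at h
  rw [superComm, LinearMap.sub_apply, LinearMap.smul_apply, Module.End.mul_apply,
    Module.End.mul_apply, h, LinearMap.sum_apply]
  rfl

/-- The supertrace of `[a_(p), b_(q)]`, for modes of complementary weights. -/
noncomputable def commutatorTrace (x z : ℤ × ℤ × ZMod 2) (a b : V) (p : ℤ) : B⟦X⟧ :=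
  ∑ j ∈ Finset.range (x.1 + z.1).toNat,
    Ring.choose p j • supertraceSeries hN hfin Y (zeroMode C N (fourierMode A.Y j a b))

theorem supertraceSeries_superComm_mode {x z : ℤ × ℤ × ZMod 2} {a b : V} (ha : a ∈ C.piece x)
    (hb : b ∈ C.piece z) {p q : ℤ} (hpq : p + q = x.1 + z.1 - 2) :
    supertraceSeries hN hfin Y
      (superComm x.2.2 z.2.2 (fourierMode N.Y p a) (fourierMode N.Y q b)) =
        commutatorTrace hN hfin Y x z a b p := by
  rw [superComm_mode ha hb hpq, map_sum, commutatorTrace]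
  simp only [map_zsmul]

theorem parity_eq_of_snd_eq_neg {x z : ℤ × ℤ × ZMod 2} (hxz : z.2 = -x.2) : z.2.2 = x.2.2 := by
  rw [hxz]
  exact ZModModule.neg_eq_self _

/-- The supertraces of the two products of modes `a_(p)` and `b_(q)`, if `a_(p)` raises the
weight. -/
theorem supertraceSeries_mode_mul_mode_of_raising {x z : ℤ × ℤ × ZMod 2} {a b : V}
    (ha : a ∈ C.piece x) (hb : b ∈ C.piece z) (hxz : z.2 = -x.2) {p q : ℤ}
    (hpq : p + q = x.1 + z.1 - 2) {d : ℕ} (hd : d ≠ 0) (hp : x.1 - p - 1 = d) :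
    supertraceSeries hN hfin Y (fourierMode N.Y p a * fourierMode N.Y q b) =
        -(geometricTail Y d x.2.1 * commutatorTrace hN hfin Y x z a b p) ∧
      koszulSign x.2.2 z.2.2 • supertraceSeries hN hfin Y
          (fourierMode N.Y q b * fourierMode N.Y p a) =
        -((1 + geometricTail Y d x.2.1) * commutatorTrace hN hfin Y x z a b p) := by
  have hX : HasDegree C N (fourierMode N.Y p a) (d, x.2) := hp ▸ hasDegree_mode ha p
  have hZ : HasDegree C N (fourierMode N.Y q b) (-((d : ℤ), x.2)) := by
    rw [Prod.neg_mk, ← hxz, show -(d : ℤ) = z.1 - q - 1 by omega]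
    exact hasDegree_mode hb q
  rw [← supertraceSeries_superComm_mode hN hfin Y ha hb hpq, parity_eq_of_snd_eq_neg hxz]
  exact ⟨hX.supertraceSeries_mul_of_raising hN hfin Y hd hZ,
    hX.supertraceSeries_mul_of_raising' hN hfin Y hd hZ⟩

/-- The supertrace of the product of modes `b_(q)` and `a_(p)`, if `a_(p)` lowers the weight. -/
theorem supertraceSeries_mode_mul_mode_of_lowering {x z : ℤ × ℤ × ZMod 2} {a b : V}
    (ha : a ∈ C.piece x) (hb : b ∈ C.piece z) (hxz : z.2 = -x.2) {p q : ℤ}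
    (hpq : p + q = x.1 + z.1 - 2) {d : ℕ} (hd : d ≠ 0) (hp : x.1 - p - 1 = -d) :
    koszulSign x.2.2 z.2.2 • supertraceSeries hN hfin Y
        (fourierMode N.Y q b * fourierMode N.Y p a) =
      geometricTail Y d (-x.2.1) * commutatorTrace hN hfin Y x z a b p := by
  have hX : HasDegree C N (fourierMode N.Y p a) (-(d : ℤ), x.2) := hp ▸ hasDegree_mode ha p
  have hZ : HasDegree C N (fourierMode N.Y q b) ((d : ℤ), -x.2) := by
    rw [← hxz, show (d : ℤ) = z.1 - q - 1 by omega]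
    exact hasDegree_mode hb q
  rw [← supertraceSeries_superComm_mode hN hfin Y ha hb hpq, parity_eq_of_snd_eq_neg hxz]
  exact hX.supertraceSeries_mul_of_lowering hN hfin Y hd hZ

/-- The recursion for the supertraces of zero modes, coefficient by coefficient. The factors of
the series `S j` depend only on the weight and the charge of `a`. -/
theorem supertraceSeries_neg_one {x z : ℤ × ℤ × ZMod 2} {a b : V} (ha : a ∈ C.piece x)
    (hb : b ∈ C.piece z) (hxz : z.2 = -x.2) {d : ℕ} (hd : x.1 = d + 1) {S : ℕ → B⟦X⟧}
    (hS : ∀ j : ℕ, S j = supertraceSeries hN hfin Y (zeroMode C N (fourierMode A.Y j a b)))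
    {J : ℕ} (hJ : J = (x.1 + z.1).toNat) :
    supertraceSeries hN hfin Y (zeroMode C N (fourierMode A.Y (-1) a b)) =
      koszulSign x.2.2 z.2.2 • supertraceSeries hN hfin Y (zeroMode C N b * zeroMode C N a) -
        (∑ j ∈ Finset.range J, lambertSeries Y x.2.1
          (fun D => if d < D then Ring.choose ((d : ℤ) - D) j else 0) * S j) -
        (∑ s ∈ Finset.range d, (1 + geometricTail Y (d - s) x.2.1) *
          ∑ j ∈ Finset.range J, Ring.choose (s : ℤ) j • S j) +
        ∑ j ∈ Finset.range J, lambertSeries Y (-x.2.1)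
          (fun D => Ring.choose ((d : ℤ) + D) j) * S j := by
  have hc : ∀ p, commutatorTrace hN hfin Y x z a b p =
      ∑ j ∈ Finset.range J, Ring.choose p j • S j := fun p => by
    simp only [commutatorTrace, hS, hJ]
  ext n
  have h1 := coeff_supertraceSeries_congr hN hfin Y (n := n)
    (fun y hy m hm => zeroMode_neg_one_apply hN ha hb hd hy hm)
  rw [h1, map_sum]
  simp only [map_add (supertraceSeries hN hfin Y), map_smul (supertraceSeries hN hfin Y)]
  rw [Finset.sum_add_distrib]
  -- the terms in which `a` raises the weight
  have h2 : coeff n (∑ s ∈ Finset.range (d + 1 + n), supertraceSeries hN hfin Y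
      (fourierMode N.Y (-1 - s) a * fourierMode N.Y (x.1 + z.1 - 1 + s) b)) =
      -coeff n (∑ j ∈ Finset.range J, lambertSeries Y x.2.1
        (fun D => if d < D then Ring.choose ((d : ℤ) - D) j else 0) * S j) := by
    have hzero : ∀ s ∈ Finset.range d, geometricTail Y (s + 1) x.2.1 * ∑ j ∈ Finset.range J,
        (if d < s + 1 then Ring.choose ((d : ℤ) - (s + 1 : ℕ)) j else 0) • S j = 0 := by
      intro s hs
      have := Finset.mem_range.mp hs
      simp [show ¬ d < s + 1 by omega]
    rw [← coeff_sum_geometricTail_mul (L := d + (d + 1 + n)) Y x.2.1 (fun j D =>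
      if d < D then Ring.choose ((d : ℤ) - D) j else 0) S J (by omega),
      Finset.sum_range_add _ d (d + 1 + n), Finset.sum_eq_zero hzero, zero_add, ← map_neg,
      ← Finset.sum_neg_distrib]
    congr 1
    refine Finset.sum_congr rfl fun s _ => ?_
    rw [(supertraceSeries_mode_mul_mode_of_raising hN hfin Y ha hb hxz (d := d + s + 1)
      (by ring) (by omega) (by push_cast; omega)).1, hc]
    congr 2
    refine Finset.sum_congr rfl fun j _ => ?_
    rw [if_pos (by omega), show (d : ℤ) - (d + s + 1 : ℕ) = -1 - s by push_cast; ring]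
  have h3 : ∑ s ∈ Finset.range d, koszulSign x.2.2 z.2.2 • supertraceSeries hN hfin Y
      (fourierMode N.Y (x.1 + z.1 - 1 - 1 - s) b * fourierMode N.Y s a) =
      -∑ s ∈ Finset.range d, (1 + geometricTail Y (d - s) x.2.1) *
          ∑ j ∈ Finset.range J, Ring.choose (s : ℤ) j • S j := by
    rw [← Finset.sum_neg_distrib]
    refine Finset.sum_congr rfl fun s hs => ?_
    have := Finset.mem_range.mp hs
    rw [(supertraceSeries_mode_mul_mode_of_raising hN hfin Y ha hb hxz (d := d - s)
        (by ring) (by omega) (by omega)).2, hc]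
  have h4 : coeff n (∑ s ∈ Finset.range n, koszulSign x.2.2 z.2.2 • supertraceSeries hN hfin Y
      (fourierMode N.Y (x.1 + z.1 - 1 - 1 - (d + 1 + s : ℕ)) b *
        fourierMode N.Y (d + 1 + s : ℕ) a)) =
      coeff n (∑ j ∈ Finset.range J, lambertSeries Y (-x.2.1)
          (fun D => Ring.choose ((d : ℤ) + D) j) * S j) := by
    rw [← coeff_sum_geometricTail_mul (L := n) Y (-x.2.1) (fun j D =>
      Ring.choose ((d : ℤ) + D) j) S J le_rfl]
    congr 1
    refine Finset.sum_congr rfl fun s _ => ?_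
    rw [supertraceSeries_mode_mul_mode_of_lowering hN hfin Y ha hb hxz (d := s + 1)
        (by push_cast; ring) (by omega) (by push_cast; omega), hc]
    congr 1
    refine Finset.sum_congr rfl fun j _ => ?_
    congr 2
    push_cast
    ring
  rw [map_add, h2, Finset.sum_range_add, Finset.sum_range_succ, map_add, map_add, h3, h4,
    zeroMode_apply_of_mem ha, zeroMode_apply_of_mem hb,
    show x.1 + z.1 - 1 - 1 - d = z.1 - 1 by omega,
    show (d : ℤ) = x.1 - 1 by omega]
  simp only [map_add, map_sub, map_neg]
  abel

end Algebra

/-- If `𝒮` contains the series attached to all `a_(j) b`, `j ≥ 0`, then, up to an element of `𝒮`,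
the series attached to `a_(-1) b` is `± str(o(b) o(a) g)`. -/
theorem supertraceSeries_neg_one_mem {B : Type*} [NormedCommRing B] [NormedAlgebra ℂ B]
    (hN : N.IsPositiveEnergy C) (hfin : FiniteCharges C N) {Y : Bˣ}
    (hY : ∀ k : ℤ, ‖((Y ^ k : Bˣ) : B)‖ ≤ 1) {ρ : ℝ} (hρ : 0 ≤ ρ) (hρ1 : ρ < 1)
    (𝒮 : Submodule (convergentSeries B hρ) B⟦X⟧) {x z : ℤ × ℤ × ZMod 2} {a b : V}
    (ha : a ∈ C.piece x) (hb : b ∈ C.piece z) (hx : 1 ≤ x.1)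
    (h : ∀ j : ℕ, supertraceSeries hN hfin Y (zeroMode C N (fourierMode A.Y j a b)) ∈ 𝒮) :
    supertraceSeries hN hfin Y (zeroMode C N (fourierMode A.Y (-1) a b)) -
      koszulSign x.2.2 z.2.2 • supertraceSeries hN hfin Y (zeroMode C N b * zeroMode C N a) ∈
        𝒮 := by
  by_cases hxz : z.2 = -x.2
  · obtain ⟨d, hd⟩ : ∃ d : ℕ, x.1 = d + 1 := ⟨(x.1 - 1).toNat, by omega⟩
    have hsmul : ∀ f ∈ convergentSeries B hρ, ∀ g ∈ 𝒮, f * g ∈ 𝒮 := fun f hf g hg =>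
      𝒮.smul_mem ⟨f, hf⟩ hg
    rw [supertraceSeries_neg_one hN hfin Y ha hb hxz hd (fun _ => rfl) rfl]
    have h1 := 𝒮.sum_mem (t := Finset.range (x.1 + z.1).toNat) fun j _ =>
      hsmul _ (lambertSeries_mem hρ hρ1 hY x.2.1 (polynomiallyBounded_choose_neg d j)) _ (h j)
    have h2 := 𝒮.sum_mem (t := Finset.range d) fun s _ =>
      hsmul _ (add_mem (one_mem _) (geometricTail_mem hρ hρ1 hY (d - s) x.2.1)) _
        (𝒮.sum_mem (t := Finset.range (x.1 + z.1).toNat) fun j _ =>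
          zsmul_mem (h j) (Ring.choose (s : ℤ) j))
    have h3 := 𝒮.sum_mem (t := Finset.range (x.1 + z.1).toNat) fun j _ =>
      hsmul _ (lambertSeries_mem hρ hρ1 hY (-x.2.1) (polynomiallyBounded_choose d j)) _ (h j)
    convert sub_mem (sub_mem h3 h1) h2 using 1
    abel
  · have hne : x.2 + z.2 ≠ 0 := fun h0 => hxz (eq_neg_of_add_eq_zero_right h0)
    have h1 : HasDegree C N (zeroMode C N (fourierMode A.Y (-1) a b)) (0, x.2 + z.2) := by
      rw [zeroMode_apply_of_mem (C.mode_mem_piece ha hb (-1))]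
      convert hasDegree_mode (N := N) (C.mode_mem_piece ha hb (-1)) _ using 2
      simp
    have h2 : HasDegree C N (zeroMode C N b * zeroMode C N a) (0, x.2 + z.2) := by
      rw [zeroMode_apply_of_mem ha, zeroMode_apply_of_mem hb]
      convert (hasDegree_mode (N := N) hb _).mul (hasDegree_mode ha _) using 1
      ext <;> simp [add_comm]
    have h0 : ((0 : ℤ), x.2 + z.2) ≠ 0 := fun h' => hne (congrArg Prod.snd h')
    rw [h1.supertraceSeries_eq_zero hN hfin Y h0, h2.supertraceSeries_eq_zero hN hfin Y h0,
      smul_zero, sub_zero]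
    exact zero_mem _

end Recursion

/-! ### The differential equation and the growth of the coefficients -/

/-- A discrete Gronwall inequality: past the total mass of `F` the factor `n` on the left prevents
any further growth. -/
theorem exists_bound_of_nat_mul_le {a F : ℕ → ℝ} (ha : ∀ n, 0 ≤ a n) (hF : ∀ n, 0 ≤ F n)
    (hFs : Summable F)
    (h : ∀ n : ℕ, n * a n ≤ ∑ p ∈ Finset.HasAntidiagonal.antidiagonal n, F p.1 * a p.2) :
    ∃ K : ℝ, ∀ n, a n ≤ K := by
  obtain ⟨N, hN⟩ := exists_nat_ge (∑' l, F l)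
  refine ⟨∑ l ∈ Finset.range (N + 1), a l, fun n => ?_⟩
  induction n using Nat.strong_induction_on with
  | _ n ih =>
    rcases Nat.lt_or_ge n (N + 1) with hn | hn
    · exact Finset.single_le_sum (f := a) (fun _ _ => ha _) (Finset.mem_range.mpr hn)
    by_contra! hlt
    have hpos : 0 < a n := (Finset.sum_nonneg fun _ _ => ha _).trans_lt hlt
    have hle : ∀ l ≤ n, a l ≤ a n := fun l hl => by
      rcases hl.eq_or_lt with rfl | hl
      · exact le_rfl
      · exact (ih l hl).trans hlt.le
    have h1 : n * a n ≤ (∑' l, F l) * a n := by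
      refine (h n).trans ?_
      calc _ ≤ ∑ p ∈ Finset.HasAntidiagonal.antidiagonal n, F p.1 * a n :=
            Finset.sum_le_sum fun p hp => mul_le_mul_of_nonneg_left
              (hle _ (Finset.HasAntidiagonal.antidiagonal.snd_le hp)) (hF _)
        _ = (∑ l ∈ Finset.range (n + 1), F l) * a n := by
            rw [← Finset.sum_mul, Finset.Nat.sum_antidiagonal_eq_sum_range_succ_mk]
        _ ≤ _ := mul_le_mul_of_nonneg_right (hFs.sum_le_tsum _ fun _ _ => hF _) hpos.le
    have h2 := le_of_mul_le_mul_right h1 hpos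
    have h3 : ((N + 1 : ℕ) : ℝ) ≤ n := by exact_mod_cast hn
    push_cast at h3
    linarith

section BoundedSeries

open PowerSeries

variable (B : Type*) [NormedCommRing B] [NormedAlgebra ℂ B]

/-- The power series whose coefficients are `O(ρ⁻ⁿ)`. -/
def boundedSeries {ρ : ℝ} (hρ : 0 ≤ ρ) : Submodule (convergentSeries B hρ) B⟦X⟧ where
  carrier := {g | ∃ K : ℝ, ∀ n, ‖coeff n g‖ * ρ ^ n ≤ K}
  zero_mem' := ⟨0, fun n => by simp⟩
  add_mem' := by
    rintro f g ⟨K, hK⟩ ⟨K', hK'⟩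
    refine ⟨K + K', fun n => ?_⟩
    calc ‖coeff n (f + g)‖ * ρ ^ n ≤ (‖coeff n f‖ + ‖coeff n g‖) * ρ ^ n := by
          rw [map_add]
          exact mul_le_mul_of_nonneg_right (norm_add_le _ _) (by positivity)
      _ ≤ K + K' := by
          rw [add_mul]
          exact add_le_add (hK n) (hK' n)
  smul_mem' := by
    rintro ⟨f, hf⟩ g ⟨K, hK⟩
    have hK0 : 0 ≤ K := le_trans (by positivity) (hK 0)
    refine ⟨(∑' n, ‖coeff n f‖ * ρ ^ n) * K, fun n => (norm_coeff_mul_le hρ f g n).trans ?_⟩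
    calc _ ≤ ∑ p ∈ Finset.HasAntidiagonal.antidiagonal n, (‖coeff p.1 f‖ * ρ ^ p.1) * K :=
          Finset.sum_le_sum fun p _ => mul_le_mul_of_nonneg_left (hK _) (by positivity)
      _ = (∑ l ∈ Finset.range (n + 1), ‖coeff l f‖ * ρ ^ l) * K := by
          rw [← Finset.sum_mul, Finset.Nat.sum_antidiagonal_eq_sum_range_succ_mk]
      _ ≤ _ := mul_le_mul_of_nonneg_right
          (Summable.sum_le_tsum _ (fun _ _ => by positivity) hf) hK0

variable {B}

/-- Solutions of a linear system `q dS/dq = f S`, for which the coefficients of the matrix `f`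
converge absolutely on the closed disc of radius `ρ`, have coefficients `O(ρ⁻ⁿ)`. -/
theorem span_range_le_boundedSeries {ρ : ℝ} (hρ : 0 ≤ ρ) {ι : Type*} [Fintype ι] {S : ι → B⟦X⟧}
    (h : ∀ i, ∃ g ∈ Submodule.span (convergentSeries B hρ) (Set.range S),
      ∀ n : ℕ, coeff n g = (n : ℂ) • coeff n (S i)) :
    Submodule.span (convergentSeries B hρ) (Set.range S) ≤ boundedSeries B hρ := by
  choose g hg hn using h
  simp only [Submodule.mem_span_range_iff_exists_fun] at hg
  choose f hf using hg
  have hle : ∀ i n, ‖coeff n (S i)‖ * ρ ^ n ≤ ∑ i, ‖coeff n (S i)‖ * ρ ^ n := fun i n =>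
    Finset.single_le_sum (f := fun i => ‖coeff n (S i)‖ * ρ ^ n) (fun _ _ => by positivity)
      (Finset.mem_univ i)
  let a : ℕ → ℝ := fun n => ∑ i, ‖coeff n (S i)‖ * ρ ^ n
  have hrec : ∀ n : ℕ, n * a n ≤ ∑ p ∈ Finset.HasAntidiagonal.antidiagonal n,
      (∑ i, ∑ j, ‖coeff p.1 (f i j : B⟦X⟧)‖ * ρ ^ p.1) * a p.2 := by
    intro n
    have h1 : ∀ i, (n : ℝ) * (‖coeff n (S i)‖ * ρ ^ n) ≤
        ∑ j, ∑ p ∈ Finset.HasAntidiagonal.antidiagonal n,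
          (‖coeff p.1 (f i j : B⟦X⟧)‖ * ρ ^ p.1) * a p.2 := by
      intro i
      calc (n : ℝ) * (‖coeff n (S i)‖ * ρ ^ n) = ‖coeff n (g i)‖ * ρ ^ n := by
            rw [hn, norm_smul, Complex.norm_natCast]
            ring
        _ ≤ (∑ j, ‖coeff n ((f i j : B⟦X⟧) * S j)‖) * ρ ^ n := by
            refine mul_le_mul_of_nonneg_right ?_ (by positivity)
            rw [← hf i, map_sum]
            exact norm_sum_le _ _
        _ ≤ _ := by
            rw [Finset.sum_mul]
            refine Finset.sum_le_sum fun j _ => (norm_coeff_mul_le hρ _ _ n).trans ?_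
            exact Finset.sum_le_sum fun p _ =>
              mul_le_mul_of_nonneg_left (hle j p.2) (by positivity)
    simp only [Finset.sum_mul]
    rw [Finset.sum_comm, Finset.mul_sum]
    refine Finset.sum_le_sum fun i _ => (h1 i).trans_eq ?_
    rw [Finset.sum_comm]
  obtain ⟨K, hK⟩ := exists_bound_of_nat_mul_le
    (fun n => Finset.sum_nonneg fun _ _ => by positivity)
    (fun n => Finset.sum_nonneg fun _ _ => Finset.sum_nonneg fun _ _ => by positivity)
    (summable_sum fun i _ => summable_sum fun j _ => (f i j).2) hrec
  rw [Submodule.span_le]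
  rintro _ ⟨i, rfl⟩
  exact ⟨K, fun n => (hle i n).trans (hK n)⟩

end BoundedSeries

section Growth

open PowerSeries

variable {V M : Type*} [AddCommGroup V] [Module ℂ V] [AddCommGroup M] [Module ℂ M]
  {A : SUSYVertexAlgebra V} {C : ConformalStructure A} {N : SUSYModule A M}
  {B : Type*} [NormedCommRing B] [NormedAlgebra ℂ B]

/-- For a `C_2`-cofinite vertex algebra the series `str(o(v) g)` span a finitely generated module
over the ring of convergent power series. -/
theorem supertraceSeries_mem (hN : N.IsPositiveEnergy C)
    (hfin : FiniteCharges C N) {Y : Bˣ} (hY : ∀ k : ℤ, ‖((Y ^ k : Bˣ) : B)‖ ≤ 1) {ρ : ℝ}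
    (hρ : 0 ≤ ρ) (hρ1 : ρ < 1)
    {F : Finset (ℤ × ℤ × ZMod 2)}
    (hF : ∀ x ∉ F, C.piece x ≤ C.c2Piece x) (𝒮 : Submodule (convergentSeries B hρ) B⟦X⟧)
    (h : ∀ x ∈ F, ∀ v ∈ C.piece x, supertraceSeries hN hfin Y (zeroMode C N v) ∈ 𝒮) (v : V) :
    supertraceSeries hN hfin Y (zeroMode C N v) ∈ 𝒮 := by
  refine C.c2_induction hF (X := (𝒮.restrictScalars ℂ).comap
    (supertraceSeries hN hfin Y ∘ₗ zeroMode C N)) (fun x hx v hv => h x hx v hv)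
    (fun x y a ha b hb hlow => ?_) v
  change supertraceSeries hN hfin Y (zeroMode C N _) ∈ 𝒮
  have hlow' : ∀ z : ℤ × ℤ × ZMod 2, z.1 < x.1 + y.1 + 1 → ∀ v ∈ C.piece z,
      supertraceSeries hN hfin Y (zeroMode C N v) ∈ 𝒮 := fun z hz v hv => hlow z hz hv
  by_cases hx0 : x.1 < 0
  · simp [C.piece_neg hx0 ha]
  have h1 := supertraceSeries_neg_one_mem hN hfin hY hρ hρ1 𝒮 (C.T_mem_piece ha) hb
    (by dsimp only; omega)
    (fun j => hlow' _ (by dsimp only; omega) _ (C.mode_mem_piece (C.T_mem_piece ha) hb j))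
  have hT : fourierMode A.Y (-1) (A.T a) b = fourierMode A.Y (-2) a b := by
    rw [A.mode_T]
    norm_num
  rw [hT, zeroMode_T ha, mul_smul_comm, map_smul, smul_comm] at h1
  rcases (not_lt.mp hx0).eq_or_lt with h0 | h0
  · rw [← h0] at h1
    simpa using h1
  · have h2 := supertraceSeries_neg_one_mem hN hfin hY hρ hρ1 𝒮 ha hb h0
      (fun j => hlow' _ (by dsimp only; omega) _ (C.mode_mem_piece ha hb j))
    have h3 := hlow' _ (by dsimp only; omega) _ (C.mode_mem_piece ha hb (-1))
    -- `str(o(b) o(∂ a) g) = -Δ str(o(b) o(a) g)` cancels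
    have h4 := (𝒮.restrictScalars ℂ).smul_mem (x.1 : ℂ) (sub_mem h3 h2)
    have h5 := sub_mem h1 h4
    convert h5 using 1
    dsimp only
    module

/-- `str(o(v) L_0 g) = q d/dq str(o(v) g)`. -/
theorem coeff_supertraceSeries_mul_omega (hN : N.IsPositiveEnergy C)
    (hfin : FiniteCharges C N) {Y : Bˣ} {v : V} (n : ℕ) :
    coeff n (supertraceSeries hN hfin Y (zeroMode C N v * zeroMode C N C.omega)) =
      (n : ℂ) • coeff n (supertraceSeries hN hfin Y (zeroMode C N v)) := by
  rw [← coeff_smul, ← map_smul]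
  refine coeff_supertraceSeries_congr hN hfin Y fun y hy m hm => ?_
  rw [zeroMode_apply_of_mem C.omega_mem_piece, Module.End.mul_apply]
  have h := ((N.mem_piece_iff C).mp hm).1
  rw [hy] at h
  change zeroMode C N v (fourierMode N.Y 1 C.omega m) = _
  rw [h, map_smul]
  simp

theorem supertraceSeries_mul_omega_mem (hN : N.IsPositiveEnergy C)
    (hfin : FiniteCharges C N) {Y : Bˣ} (hY : ∀ k : ℤ, ‖((Y ^ k : Bˣ) : B)‖ ≤ 1) {ρ : ℝ}
    (hρ : 0 ≤ ρ) (hρ1 : ρ < 1)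
    (𝒮 : Submodule (convergentSeries B hρ) B⟦X⟧)
    (h : ∀ v, supertraceSeries hN hfin Y (zeroMode C N v) ∈ 𝒮) (v : V) :
    supertraceSeries hN hfin Y (zeroMode C N v * zeroMode C N C.omega) ∈ 𝒮 := by
  refine C.mem_of_pieces (X := (𝒮.restrictScalars ℂ).comap (supertraceSeries hN hfin Y ∘ₗ
    LinearMap.mulRight ℂ (zeroMode C N C.omega) ∘ₗ zeroMode C N)) (fun x v hv => ?_) v
  have h1 := supertraceSeries_neg_one_mem hN hfin hY hρ hρ1 𝒮 C.omega_mem_piece hv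
    (by norm_num) (fun j => h _)
  rw [SUSYVertexAlgebra.koszulSign_zero_left, one_smul] at h1
  have h2 := sub_mem (h (fourierMode A.Y (-1) C.omega v)) h1
  rwa [sub_sub_cancel] at h2

/-- The coefficients of `str(o(v) g)` are `O(ρ⁻ⁿ)` for all `ρ < 1`. -/
theorem exists_norm_coeff_supertraceSeries_le (hN : N.IsPositiveEnergy C)
    (hfin : FiniteCharges C N) {Y : Bˣ} (hY : ∀ k : ℤ, ‖((Y ^ k : Bˣ) : B)‖ ≤ 1) {ρ : ℝ}
    (hρ : 0 ≤ ρ) (hρ1 : ρ < 1)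
    (hA : A.IsC2Cofinite) (v : V) :
    ∃ K : ℝ, ∀ n, ‖coeff n (supertraceSeries hN hfin Y (zeroMode C N v))‖ * ρ ^ n ≤ K := by
  obtain ⟨F, hF⟩ := C.exists_finset_piece_le hA
  let U : Submodule ℂ V := ⨆ x : F, C.piece x
  have hpiece : ∀ x : F, FiniteDimensional ℂ (C.piece x) := fun x => by
    have := C.integrability.finite x.1.1 x.1.2.1
    exact Submodule.finiteDimensional_of_le (inf_le_left : C.piece x ≤ _)
  have hU : FiniteDimensional ℂ U := Submodule.finiteDimensional_iSup _
  obtain ⟨s, hs⟩ := (Submodule.fg_iff_finiteDimensional U).mpr hU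
  obtain ⟨S, hS⟩ : ∃ S : s → B⟦X⟧, ∀ u, S u = supertraceSeries hN hfin Y (zeroMode C N u) :=
    ⟨_, fun _ => rfl⟩
  obtain ⟨𝒮, h𝒮⟩ : ∃ 𝒮, 𝒮 = Submodule.span (convergentSeries B hρ) (Set.range S) := ⟨_, rfl⟩
  have hUS : U ≤ (𝒮.restrictScalars ℂ).comap (supertraceSeries hN hfin Y ∘ₗ zeroMode C N) := by
    rw [← hs, Submodule.span_le]
    intro u hu
    change supertraceSeries hN hfin Y (zeroMode C N u) ∈ 𝒮
    rw [← hS ⟨u, hu⟩, h𝒮]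
    exact Submodule.subset_span ⟨⟨u, hu⟩, rfl⟩
  have hmem := supertraceSeries_mem hN hfin hY hρ hρ1 hF 𝒮
    fun x hx v hv => hUS (Submodule.mem_iSup_of_mem (⟨x, hx⟩ : F) hv)
  have hle : 𝒮 ≤ boundedSeries B hρ := by
    rw [h𝒮]
    refine span_range_le_boundedSeries hρ fun u => ⟨_,
      h𝒮 ▸ supertraceSeries_mul_omega_mem hN hfin hY hρ hρ1 𝒮 hmem u, fun n => ?_⟩
    rw [coeff_supertraceSeries_mul_omega, hS]
  exact hle (hmem v)

end Growth

/-! ### Fourier coefficients and convergence -/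

section Fourier

/-- The characters `y ↦ y^k` of the circle, as units of the algebra of continuous functions. -/
noncomputable def circleCharacter : Multiplicative ℤ →* C(AddCircle (1 : ℝ), ℂ)ˣ :=
  MonoidHom.toHomUnits
    { toFun := fun k => fourier k.toAdd
      map_one' := by
        ext x
        simp
      map_mul' := fun k l => by
        ext x
        exact fourier_add }

theorem circleCharacter_zpow (k : ℤ) :
    ((circleCharacter (Multiplicative.ofAdd 1) ^ k : C(AddCircle (1 : ℝ), ℂ)ˣ) :
      C(AddCircle (1 : ℝ), ℂ)) = fourier k := by
  rw [← map_zpow, ← ofAdd_zsmul, smul_eq_mul, mul_one]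
  rfl

/-- A Fourier coefficient is bounded by the supremum norm. -/
theorem norm_le_norm_sum_smul_fourier (c : ℤ → ℂ) {s : Finset ℤ} {k : ℤ} (hk : k ∈ s) :
    ‖c k‖ ≤ ‖∑ l ∈ s, c l • (fourier l : C(AddCircle (1 : ℝ), ℂ))‖ := by
  have hsum : ContinuousMap.toLp 2 AddCircle.haarAddCircle ℂ
      (∑ l ∈ s, c l • (fourier l : C(AddCircle (1 : ℝ), ℂ))) = ∑ l ∈ s, c l • fourierLp 2 l := by
    simp only [map_sum, map_smul]
  have h := (orthonormal_fourier (T := 1)).inner_right_sum c hk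
  have hT : ‖(ContinuousMap.toLp 2 AddCircle.haarAddCircle ℂ :
      C(AddCircle (1 : ℝ), ℂ) →L[ℂ] _)‖ ≤ 1 := by
    refine (ContinuousMap.toLp_norm_le (𝕜 := ℂ) _).trans ?_
    simp [MeasureTheory.measureUnivNNReal]
  rw [← h, ← hsum]
  refine (norm_inner_le_norm _ _).trans ?_
  rw [(orthonormal_fourier (T := 1)).1 k, one_mul]
  exact (ContinuousLinearMap.le_of_opNorm_le _ hT _).trans_eq (one_mul _)

end Fourier

section Convergence

variable {V M : Type*} [AddCommGroup V] [Module ℂ V] [AddCommGroup M] [Module ℂ M]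
  {A : SUSYVertexAlgebra V} {C : ConformalStructure A} {N : SUSYModule A M}

theorem finiteCharges (hA : A.IsC2Cofinite) (hN : N.IsPositiveEnergy C) : FiniteCharges C N := by
  obtain ⟨K, T, h⟩ := exists_charge_bound hA hN
  intro n
  refine (Set.finite_Icc (-(K * (2 * T + 2 * n.natAbs + 2) : ℤ))
    (K * (2 * T + 2 * n.natAbs + 2))).subset ?_
  rintro k ⟨i, hk⟩
  obtain ⟨r, h1, h2⟩ := h _ hk
  have h3 : (r : ℤ) ≤ 2 * T + 2 * n.natAbs + 1 := by
    by_contra! hlt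
    dsimp only at h2
    have h4 : n ≤ n.natAbs := Int.le_natAbs
    have h5 : 0 ≤ (r - 1 : ℤ) * (r - 1 - 2 * T) := mul_nonneg (by omega) (by omega)
    linarith
  have h4 : |k| ≤ K * (2 * T + 2 * n.natAbs + 2) :=
    h1.trans (mul_le_mul_of_nonneg_left (by linarith) (Int.natCast_nonneg K))
  exact abs_le.mp h4

/-- The charges in the weight space `n` are `o(n)`. -/
theorem exists_pow_charge_le (hA : A.IsC2Cofinite) (hN : N.IsPositiveEnergy C) {η Λ : ℝ}
    (hη : 0 < η) (hη1 : η < 1) (hΛ : 1 ≤ Λ) : ∃ K : ℝ, 0 ≤ K ∧ ∀ x : ℤ × ℤ × ZMod 2,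
      N.piece C x ≠ ⊥ → Λ ^ x.2.1.natAbs * η ^ x.1.toNat ≤ K := by
  obtain ⟨K, T, h⟩ := exists_charge_bound hA hN
  obtain ⟨n₀, hn₀⟩ : ∃ n₀ : ℕ, Λ ^ K * η ^ n₀ ≤ 1 := by
    have h1 := (tendsto_pow_atTop_nhds_zero_of_lt_one hη.le hη1).const_mul (Λ ^ K)
    rw [mul_zero] at h1
    exact ((h1.eventually (gt_mem_nhds zero_lt_one)).exists).imp fun _ => le_of_lt
  have hΛ0 : 0 < Λ := zero_lt_one.trans_le hΛ
  refine ⟨Λ ^ K * (η ^ (n₀ * (2 * n₀ + 2 * T + 1)))⁻¹, by positivity, fun x hx => ?_⟩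
  obtain ⟨r, h1, h2⟩ := h x hx
  have h3 : n₀ * r ≤ x.1.toNat + n₀ * (2 * n₀ + 2 * T + 1) := by
    rcases Nat.le_total r (2 * n₀ + 2 * T + 1) with hr | hr
    · exact (Nat.mul_le_mul_left n₀ hr).trans (Nat.le_add_left _ _)
    · have h5 : (0 : ℤ) ≤ r * (r - (2 * n₀ + 2 * T + 1)) := mul_nonneg (by omega) (by omega)
      have h6 : x.1 ≤ x.1.toNat := Int.self_le_toNat x.1
      have h7 : 0 ≤ n₀ * (2 * n₀ + 2 * T + 1) := Nat.zero_le _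
      zify at h7 ⊢
      linarith
  have h4 : x.2.1.natAbs ≤ K * (r + 1) := by
    zify
    exact h1
  have hpos : 0 < η ^ (n₀ * (2 * n₀ + 2 * T + 1)) := by positivity
  calc Λ ^ x.2.1.natAbs * η ^ x.1.toNat
      ≤ Λ ^ (K * (r + 1)) * η ^ x.1.toNat := by gcongr
    _ = Λ ^ (K * (r + 1)) * η ^ (x.1.toNat + n₀ * (2 * n₀ + 2 * T + 1)) *
          (η ^ (n₀ * (2 * n₀ + 2 * T + 1)))⁻¹ := by
        rw [pow_add]
        field_simp
    _ ≤ Λ ^ (K * (r + 1)) * η ^ (n₀ * r) * (η ^ (n₀ * (2 * n₀ + 2 * T + 1)))⁻¹ := by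
        gcongr Λ ^ (K * (r + 1)) * ?_ * _
        exact pow_le_pow_of_le_one hη.le hη1.le h3
    _ = Λ ^ K * (Λ ^ K * η ^ n₀) ^ r * (η ^ (n₀ * (2 * n₀ + 2 * T + 1)))⁻¹ := by ring
    _ ≤ Λ ^ K * 1 * (η ^ (n₀ * (2 * n₀ + 2 * T + 1)))⁻¹ := by
        gcongr
        exact pow_le_one₀ (by positivity) hn₀
    _ = _ := by rw [mul_one]

/-- The coefficients `c_{n, k}(a)` are `O(ρ⁻ⁿ)`, uniformly in `k`, for all `ρ < 1`. -/
theorem exists_norm_supertraceCoeff_le (hA : A.IsC2Cofinite) (hN : N.IsPositiveEnergy C) (a : V)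
    {ρ : ℝ} (hρ : 0 ≤ ρ) (hρ1 : ρ < 1) :
    ∃ K : ℝ, ∀ (n : ℕ) (k : ℤ), ‖supertraceCoeff hN a n k‖ * ρ ^ n ≤ K := by
  obtain ⟨K, hK⟩ := exists_norm_coeff_supertraceSeries_le hN (finiteCharges hA hN)
    (Y := circleCharacter (Multiplicative.ofAdd 1))
    (fun k => by rw [circleCharacter_zpow, fourier_norm]) hρ hρ1 hA a
  refine ⟨K, fun n k => le_trans (mul_le_mul_of_nonneg_right ?_ (by positivity)) (hK n)⟩
  have hs := (finiteCharges hA hN).support_finite hN (circleCharacter (Multiplicative.ofAdd 1))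
    (zeroMode C N a) n
  rw [coeff_supertraceSeries, finsum_eq_sum_of_support_subset (s := insert k hs.toFinset) _
    (by simp)]
  simp only [circleCharacter_zpow]
  exact norm_le_norm_sum_smul_fourier (fun k => blockSupertrace hN n k (zeroMode C N a))
    (Finset.mem_insert_self k _)

/-- A summable majorant for the terms of the series on a compact set. -/
theorem exists_summable_bound (hA : A.IsC2Cofinite) (hN : N.IsPositiveEnergy C) (a : V)
    {K : Set (ℂ × ℂ)} (hK : IsCompact K) (hKd : ∀ p ∈ K, 0 < p.1.im) :
    ∃ u : ℤ × ℤ → ℝ, Summable u ∧ ∀ x, ∀ p ∈ K, ‖supertraceTerm hN a x p‖ ≤ u x := by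
  rcases K.eq_empty_or_nonempty with rfl | hne
  · exact ⟨0, summable_zero, fun x p hp => absurd hp (Set.notMem_empty p)⟩
  let q : ℂ × ℂ → ℂ := fun p => Complex.exp (2 * Real.pi * Complex.I * p.1)
  let y : ℂ × ℂ → ℂ := fun p => Complex.exp (2 * Real.pi * Complex.I * p.2)
  have hq : Continuous q := by fun_prop
  have hy : Continuous y := by fun_prop
  obtain ⟨p₀, hp₀, hmax⟩ := hK.exists_isMaxOn hne hq.norm.continuousOn
  have hq1 : ‖q p₀‖ < 1 := by
    have h1 := hKd p₀ hp₀
    rw [Complex.norm_exp, Real.exp_lt_one_iff]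
    simpa using mul_pos Real.two_pi_pos h1
  -- one factor `η` pays for the growth of the coefficients, one for the charges, and one is left
  obtain ⟨η, hη, hη1, hqη⟩ : ∃ η : ℝ, 0 < η ∧ η < 1 ∧ ‖q p₀‖ ≤ η ^ 3 := by
    have h1 := norm_nonneg (q p₀)
    refine ⟨1 - (1 - ‖q p₀‖) / 3, by linarith, by linarith, ?_⟩
    have := one_add_mul_le_pow (a := -(1 - ‖q p₀‖) / 3) (by linarith) 3
    push_cast at this
    calc _ = 1 + 3 * (-(1 - ‖q p₀‖) / 3) := by ring
      _ ≤ _ := this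
      _ = _ := by ring
  obtain ⟨Λ₁, hΛ₁⟩ := hK.exists_bound_of_continuousOn hy.continuousOn
  obtain ⟨Λ₂, hΛ₂⟩ := hK.exists_bound_of_continuousOn
    (hy.inv₀ fun p => Complex.exp_ne_zero _).continuousOn
  obtain ⟨Λ, hΛ, hΛ1, hΛ2⟩ : ∃ Λ : ℝ, 1 ≤ Λ ∧ Λ₁ ≤ Λ ∧ Λ₂ ≤ Λ :=
    ⟨max 1 (max Λ₁ Λ₂), by simp, by simp, by simp⟩
  have hypow : ∀ p ∈ K, ∀ k : ℤ, ‖y p ^ k‖ ≤ Λ ^ k.natAbs := by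
    intro p hp k
    rcases k.natAbs_eq with h | h
    · rw [h, zpow_natCast, norm_pow, Int.natAbs_natCast]
      exact pow_le_pow_left₀ (norm_nonneg _) ((hΛ₁ p hp).trans hΛ1) _
    · rw [h, zpow_neg, zpow_natCast, ← inv_pow, norm_pow, Int.natAbs_neg, Int.natAbs_natCast]
      exact pow_le_pow_left₀ (norm_nonneg _) ((hΛ₂ p hp).trans hΛ2) _
  obtain ⟨K₁, hK₁⟩ := exists_norm_supertraceCoeff_le hA hN a hη.le hη1
  -- the factor `2` leaves `2^{-|k|}` for the sum over the charges
  obtain ⟨K₂, hK₂0, hK₂⟩ := exists_pow_charge_le hA hN hη hη1 (Λ := 2 * Λ) (by linarith)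
  have hK₁0 : 0 ≤ K₁ := le_trans (by positivity) (hK₁ 0 0)
  have hsum : ∀ r : ℝ, 0 ≤ r → r < 1 → Summable fun n : ℤ => r ^ n.natAbs := fun r hr hr1 =>
    Summable.of_nat_of_neg (by simpa using summable_geometric_of_lt_one hr hr1)
      (by simpa using summable_geometric_of_lt_one hr hr1)
  refine ⟨fun x => K₁ * K₂ * (η ^ x.1.natAbs * (1 / 2) ^ x.2.natAbs),
    ((hsum η hη.le hη1).mul_of_nonneg (hsum (1 / 2) (by norm_num) (by norm_num))
      (fun _ => by positivity) (fun _ => by positivity)).mul_left _, ?_⟩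
  rintro ⟨n, k⟩ p hp
  by_cases hnk : ∀ i, N.piece C (n, k, i) = ⊥
  · rw [supertraceTerm, supertraceCoeff_eq, blockSupertrace_eq_zero_of_eq_bot _ hnk, zero_mul,
      zero_mul, norm_zero]
    positivity
  push Not at hnk
  obtain ⟨i, hi⟩ := hnk
  have hn : 0 ≤ n := by
    by_contra! hn
    exact hi ((Submodule.eq_bot_iff _).mpr fun _ hm => hN.piece_neg (x := (n, k, i)) hn hm)
  obtain ⟨n, rfl⟩ := Int.eq_ofNat_of_zero_le hn
  have h1 := hK₁ n k
  have h2 : (2 * Λ) ^ k.natAbs * η ^ n ≤ K₂ := hK₂ _ hi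
  calc ‖supertraceTerm hN a (n, k) p‖ = ‖supertraceCoeff hN a n k‖ * ‖q p‖ ^ n * ‖y p ^ k‖ := by
        rw [supertraceTerm, norm_mul, norm_mul, zpow_natCast, norm_pow]
    _ ≤ ‖supertraceCoeff hN a n k‖ * (η ^ 3) ^ n * Λ ^ k.natAbs := by
        gcongr
        · exact (hmax hp).trans hqη
        · exact hypow p hp k
    _ = (‖supertraceCoeff hN a n k‖ * η ^ n) * ((2 * Λ) ^ k.natAbs * η ^ n) *
          (η ^ n * (1 / 2) ^ k.natAbs) := by
        rw [mul_pow 2 Λ, one_div, inv_pow]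
        field_simp
        ring
    _ ≤ K₁ * K₂ * (η ^ n * (1 / 2) ^ k.natAbs) := by gcongr

end Convergence

theorem mainTheorem5 {V M : Type*} [AddCommGroup V] [Module ℂ V] [AddCommGroup M] [Module ℂ M]
    (A : SUSYVertexAlgebra V) (C : ConformalStructure A) (hA : A.IsC2Cofinite)
    (N : SUSYModule A M) (hN : N.IsPositiveEnergy C) (a : V) :
    (∀ p ∈ convergenceDomain, Summable fun x : ℤ × ℤ => ‖supertraceTerm hN a x p‖) ∧
      ∀ K : Set (ℂ × ℂ), IsCompact K → K ⊆ convergenceDomain →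
        SummableUniformlyOn (supertraceTerm hN a) K := by
  refine ⟨fun p hp => ?_, fun K hK hKd => ?_⟩
  · obtain ⟨u, hu, h⟩ := exists_summable_bound hA hN a (isCompact_singleton (x := p))
      (by simpa using hp.1)
    exact Summable.of_nonneg_of_le (fun _ => norm_nonneg _) (fun x => h x p rfl) hu
  · obtain ⟨u, hu, h⟩ := exists_summable_bound hA hN a hK fun p hp => (hKd hp).1
    exact (hasSumUniformlyOn_iff_tendstoUniformlyOn.mpr
      (tendstoUniformlyOn_tsum hu h)).summableUniformlyOn
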